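/- **Theorem 4.1.** Let $p\ge 0$ be an integer. For a real symmetric invertible matrix $K$ let $o(K)=\{X : XK+KX^T=0\}$ and let $e(K)$ be the Lie algebra of the matrices $\begin{pmatrix}X&\alpha\\0&0\end{pmatrix}$ with $X\in o(K)$ and $\alpha$ an arbitrary column; the elements with $X=0$ are the translations. Let $e(p,1)=e(K)$ for $K=\mathrm{diag}(1,\dots,1,-1)$ ($p$ entries $1$), and let $E(p,1)$ be the group of the matrices $\begin{pmatrix}G&a\\0&1\end{pmatrix}$ with $GKG^T=K$. A MASA of a Lie algebra is an abelian subalgebra equal to its centralizer. A subalgebra of $e(p,1)$ is splitting if it is $E(p,1)$-conjugate to a sum of a subalgebra of $o(p,1)$ and a space of translations. A subalgebra $L$ has translation type $(k_+,k_-,k_0)$ if its subspace of translations has an orthogonal basis (for the Minkowski scalar product) of $k_+$ vectors of positive length, $k_-$ of negative length and $k_0$ isotropic vectors. For a block $M_0$, a column $\gamma^T$ and integers $l,k_+\ge 0$ consider the matrices $$M=\begin{pmatrix}M_0&&&&&\gamma^T\\&M_1&&&&0\\&&\ddots&&&\vdots\\&&&M_l&&0\\&&&&0_{k_+}&x^T\\&&&&&0\end{pmatrix},\qquad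 M_i=\begin{pmatrix}0&a_i\\-a_i&0\end{pmatrix},\qquad K'=\mathrm{diag}(K_0,I_{2l},I_{k_+}),$$ $a_i\in\mathbf R$, $x\in\mathbf R^{1\times k_+}$, of the following three kinds, in each of which all the entries $a_i,x,z,c,\alpha$ are free. * **A.** $M_0=0\in\mathbf R$, $\gamma^T=z\in\mathbf R$, $K_0=-1$, where $0\le k_+\le p$, $p-k_+$ is even and $l=\frac{p-k_+}{2}$. * **B.** $M_0=\begin{pmatrix}c&0\\0&-c\end{pmatrix}$, $\gamma=0$, $K_0=\begin{pmatrix}0&1\\1&0\end{pmatrix}$, where $0\le k_+\le p-1$, $p-k_+$ is odd and $l=\frac{p-k_+-1}{2}$. * **C.** $M_0=\begin{pmatrix}0&\alpha&0\\0&0&-\alpha^T\\0&0&0\end{pmatrix}$, $\gamma^T=\begin{pmatrix}z\\0_\mu\\0\end{pmatrix}$, $K_0=\begin{pmatrix}&&1\\&I_\mu&\\1&&\end{pmatrix}$, $\alpha\in\mathbf R^{1\times\mu}$, $z\in\mathbf R$, where $0\le k_+\le p-2$, $1\le\mu\le p-1$, $0\le l\le\frac{p-k_+-2}{2}$ and $\mu+1+2l+k_+=p$.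 Say that a subalgebra $L$ of $e(p,1)$ has such a normal form if some invertible matrix $H=\begin{pmatrix}G&a\\0&1\end{pmatrix}$ with $GKG^T=K'$ satisfies $HLH^{-1}=\{M\}$. Then: 1. For all parameters allowed above there are subalgebras $L$ of $e(p,1)$ with that normal form. Every such $L$ is a splitting MASA of $e(p,1)$. Its translation type is $(k_+,1,0)$ for kind A, $(k_+,0,0)$ for kind B and $(k_+,0,1)$ for kind C, and it has no other translation type. Its dimension $d$ satisfies $d=1+l+k_+$ and $\left[\frac{p+3}{2}\right]\le d\le p+1$ for kind A; $d=1+l+k_+$ and $\left[\frac{p+2}{2}\right]\le d\le p$ for kind B; $d=\mu+l+k_++1$ and $\left[\frac{p+3}{2}\right]\le d\le p$ for kind C. 2. Every splitting MASA of $e(p,1)$ has precisely one of these normal forms (with allowed parameters), and two subalgebras with the same normal form are conjugate under $E(p,1)$. 3. The blocks $M_0$ of kind B form the whole of $o(K_0)\cong o(1,1)$. For $\mu\ge1$ the blocks $M_0$ of kind C form a maximal abelian nilpotent subalgebra of $o(K_0)\cong o(\mu+1,1)$, that is, a MASA $N$ such that for some $m$ all $m$-fold brackets $[\dots[[Y,Z_1],Z_2],\dots,Z_m]$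 with $Y\in o(K_0)$ and $Z_i\in N$ vanish. -/

import Mathlib

open Matrix

attribute [local instance 100] LieRing.ofAssociativeRing

noncomputable section

namespace PseudoEuclidean

/-- The matrix with blocks `X`, `α` on top of a zero row: the infinitesimal affine map
`x ↦ X x + α`. -/
def affineMatrix {ι : Type} (X : Matrix ι ι ℝ) (α : ι → ℝ) : Matrix (ι ⊕ Unit) (ι ⊕ Unit) ℝ :=
  fromBlocks X (replicateCol Unit α) 0 0

/-- The pseudoorthogonal Lie algebra `o(K)` of all real `X` with `X K + K Xᵀ = 0`. -/
def pseudoOrthogonal {ι : Type} [Fintype ι] [DecidableEq ι] (K : Matrix ι ι ℝ) :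
    LieSubalgebra ℝ (Matrix ι ι ℝ) where
  carrier := {X | X * K + K * Xᵀ = 0}
  zero_mem' := by simp
  add_mem' := by
    intro X Y hX hY
    simp only [Set.mem_ofPred_eq] at *
    have : (X + Y) * K + K * (X + Y)ᵀ = (X * K + K * Xᵀ) + (Y * K + K * Yᵀ) := by
      rw [transpose_add, add_mul, mul_add]; abel
    rw [this, hX, hY, add_zero]
  smul_mem' := by
    intro c X hX
    simp only [Set.mem_ofPred_eq] at *
    rw [transpose_smul, smul_mul, Matrix.mul_smul, ← smul_add, hX, smul_zero]
  lie_mem' := by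
    intro X Y hX hY
    simp only [Set.mem_ofPred_eq] at *
    have h1 : K * Xᵀ = -(X * K) := (neg_eq_of_add_eq_zero_right hX).symm
    have h2 : K * Yᵀ = -(Y * K) := (neg_eq_of_add_eq_zero_right hY).symm
    rw [Ring.lie_def, transpose_sub, transpose_mul, transpose_mul, sub_mul, mul_sub,
      ← Matrix.mul_assoc K, ← Matrix.mul_assoc K, h1, h2, neg_mul, neg_mul,
      Matrix.mul_assoc X K, Matrix.mul_assoc Y K, h1, h2]
    simp only [mul_neg, Matrix.mul_assoc]
    abel

/-- The pseudoeuclidean Lie algebra `e(K)`: all `affineMatrix X α` with `X ∈ o(K)` and `α` an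
arbitrary column. -/
def pseudoEuclidean {ι : Type} [Fintype ι] [DecidableEq ι] (K : Matrix ι ι ℝ) :
    LieSubalgebra ℝ (Matrix (ι ⊕ Unit) (ι ⊕ Unit) ℝ) where
  carrier := {Y | ∃ X ∈ pseudoOrthogonal K, ∃ α : ι → ℝ, Y = affineMatrix X α}
  zero_mem' := ⟨0, zero_mem _, 0, by simp [affineMatrix]⟩
  add_mem' := by
    rintro _ _ ⟨X, hX, α, rfl⟩ ⟨Y, hY, β, rfl⟩
    refine ⟨X + Y, add_mem hX hY, α + β, ?_⟩
    simp [affineMatrix, fromBlocks_add, replicateCol_add]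
  smul_mem' := by
    rintro c _ ⟨X, hX, α, rfl⟩
    refine ⟨c • X, (pseudoOrthogonal K).smul_mem c hX, c • α, ?_⟩
    simp [affineMatrix, fromBlocks_smul, replicateCol_smul]
  lie_mem' := by
    rintro _ _ ⟨X, hX, α, rfl⟩ ⟨Y, hY, β, rfl⟩
    refine ⟨⁅X, Y⁆, LieSubalgebra.lie_mem _ hX hY, X *ᵥ β - Y *ᵥ α, ?_⟩
    rw [Ring.lie_def, Ring.lie_def]
    ext (i | i) (j | j) <;>
      simp [affineMatrix, fromBlocks_multiply, Matrix.mul_apply, mulVec, dotProduct]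

/-- `M` is a maximal abelian subalgebra of the Lie algebra `A`: an abelian subalgebra of `A`
that is equal to its centralizer in `A`. -/
def IsMASA {𝔤 : Type} [LieRing 𝔤] [LieAlgebra ℝ 𝔤] (A M : LieSubalgebra ℝ 𝔤) : Prop :=
  M ≤ A ∧ (∀ Y ∈ M, ∀ Z ∈ M, ⁅Y, Z⁆ = 0) ∧ ∀ Y ∈ A, (∀ Z ∈ M, ⁅Y, Z⁆ = 0) → Y ∈ M

/-- A maximal abelian nilpotent subalgebra: a MASA `M` of `A` such that for some `m` all
`m`-fold brackets `[[…[[Y, Z₁], Z₂], …], Z_m]` with `Y ∈ A` and `Z_i ∈ M` vanish. -/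
def IsMANS {𝔤 : Type} [LieRing 𝔤] [LieAlgebra ℝ 𝔤] (A M : LieSubalgebra ℝ 𝔤) : Prop :=
  IsMASA A M ∧ ∃ m : ℕ, ∀ Y ∈ A, ∀ Zs : List 𝔤, Zs.length = m → (∀ Z ∈ Zs, Z ∈ M) →
    Zs.foldl (fun W Z => ⁅W, Z⁆) Y = 0

/-- `S ⊆ e(K)` and `S' ⊆ e(K')` are conjugate: an invertible affine matrix `H` with linear part
`G`, where `G K Gᵀ = K'`, carries `S` onto `S'` by `Y ↦ H Y H⁻¹`. For `K' = K` this is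
conjugacy under the pseudoeuclidean group `E(K)`; for `K' ≠ K` it is conjugacy combined with the
change of basis that changes the matrix `K` into `K'`. -/
def Conjugate {ι κ : Type} [Fintype ι] [DecidableEq ι] [Fintype κ] [DecidableEq κ]
    (K : Matrix ι ι ℝ) (S : Set (Matrix (ι ⊕ Unit) (ι ⊕ Unit) ℝ))
    (K' : Matrix κ κ ℝ) (S' : Set (Matrix (κ ⊕ Unit) (κ ⊕ Unit) ℝ)) : Prop :=
  ∃ (G : Matrix κ ι ℝ) (a : κ → ℝ)
    (H : Matrix (κ ⊕ Unit) (ι ⊕ Unit) ℝ) (Hinv : Matrix (ι ⊕ Unit) (κ ⊕ Unit) ℝ),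
    G * K * Gᵀ = K' ∧ H = fromBlocks G (replicateCol Unit a) 0 1 ∧
    H * Hinv = 1 ∧ Hinv * H = 1 ∧ S' = (fun Y => H * Y * Hinv) '' S

/-- `L ⊆ e(K)` is splitting: it is conjugate under `E(K)` to a sum of a subalgebra `F` of `o(K)`
and a subspace `N` of the translations. -/
def IsSplitting {ι : Type} [Fintype ι] [DecidableEq ι] (K : Matrix ι ι ℝ)
    (L : LieSubalgebra ℝ (Matrix (ι ⊕ Unit) (ι ⊕ Unit) ℝ)) : Prop :=
  ∃ L' F N : LieSubalgebra ℝ (Matrix (ι ⊕ Unit) (ι ⊕ Unit) ℝ),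
    Conjugate K (L : Set (Matrix (ι ⊕ Unit) (ι ⊕ Unit) ℝ))
      K (L' : Set (Matrix (ι ⊕ Unit) (ι ⊕ Unit) ℝ)) ∧
    (∀ Y ∈ F, ∃ X ∈ pseudoOrthogonal K, Y = affineMatrix X 0) ∧
    (∀ Y ∈ N, ∃ α : ι → ℝ, Y = affineMatrix 0 α) ∧
    L'.toSubmodule = F.toSubmodule ⊔ N.toSubmodule

/-- The Minkowski metric `diag(1, …, 1, -1)` with `p` entries `1`. It defines `e(p,1)`. -/
def minkowski (p : ℕ) : Matrix (Fin p ⊕ Unit) (Fin p ⊕ Unit) ℝ :=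
  LieAlgebra.Orthogonal.indefiniteDiagonal (Fin p) Unit ℝ

/-- Real matrices of size `(p + 2) × (p + 2)`, the ambient Lie algebra of `e(p,1)`. -/
abbrev Ambient (p : ℕ) : Type :=
  Matrix ((Fin p ⊕ Unit) ⊕ Unit) ((Fin p ⊕ Unit) ⊕ Unit) ℝ

/-- `L` is a splitting MASA of `e(p,1)`. -/
def IsSplittingMASA (p : ℕ) (L : LieSubalgebra ℝ (Ambient p)) : Prop :=
  IsMASA (pseudoEuclidean (minkowski p)) L ∧ IsSplitting (minkowski p) L

/-- The Minkowski scalar product `g_{μν} x_μ y_ν`. -/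
def minkowskiProduct (p : ℕ) (x y : Fin p ⊕ Unit → ℝ) : ℝ := x ⬝ᵥ (minkowski p *ᵥ y)

/-- The space of the translations that belong to `L`. -/
def translationSpace {ι : Type} [Fintype ι] [DecidableEq ι]
    (L : LieSubalgebra ℝ (Matrix (ι ⊕ Unit) (ι ⊕ Unit) ℝ)) : Submodule ℝ (ι → ℝ) where
  carrier := {α | affineMatrix 0 α ∈ L}
  zero_mem' := by
    have h : affineMatrix (0 : Matrix ι ι ℝ) 0 = 0 := by simp [affineMatrix]
    simp only [Set.mem_ofPred_eq, h]
    exact zero_mem _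
  add_mem' := by
    intro α β hα hβ
    have h : affineMatrix (0 : Matrix ι ι ℝ) (α + β) = affineMatrix 0 α + affineMatrix 0 β := by
      simp [affineMatrix, fromBlocks_add, replicateCol_add]
    simp only [Set.mem_ofPred_eq, h]
    exact add_mem hα hβ
  smul_mem' := by
    intro c α hα
    have h : affineMatrix (0 : Matrix ι ι ℝ) (c • α) = c • affineMatrix 0 α := by
      simp [affineMatrix, fromBlocks_smul, replicateCol_smul]
    simp only [Set.mem_ofPred_eq, h]
    exact L.smul_mem c hα

/-- The translations in `L` have type `(kPos, kNeg, kNull)`: they have an orthogonal basis of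
`kPos` vectors of positive length, `kNeg` of negative length and `kNull` isotropic vectors. -/
def HasTranslationType (p : ℕ) (L : LieSubalgebra ℝ (Ambient p)) (kPos kNeg kNull : ℕ) : Prop :=
  ∃ b : Module.Basis (Fin kPos ⊕ (Fin kNeg ⊕ Fin kNull)) ℝ (translationSpace L),
    (∀ i j, i ≠ j → minkowskiProduct p (b i : Fin p ⊕ Unit → ℝ) (b j) = 0) ∧
    (∀ i, 0 < minkowskiProduct p (b (Sum.inl i) : Fin p ⊕ Unit → ℝ) (b (Sum.inl i))) ∧
    (∀ i, minkowskiProduct p (b (Sum.inr (Sum.inl i)) : Fin p ⊕ Unit → ℝ)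
      (b (Sum.inr (Sum.inl i))) < 0) ∧
    (∀ i, minkowskiProduct p (b (Sum.inr (Sum.inr i)) : Fin p ⊕ Unit → ℝ)
      (b (Sum.inr (Sum.inr i))) = 0)

/-- The index set of the columns `β ∪ (l blocks of size 2) ∪ (k further columns)`. -/
abbrev BlockIndex (β : Type) (l k : ℕ) : Type := β ⊕ ((Fin 2 × Fin l) ⊕ Fin k)

/-- `diag(K₀, I_{2l}, I_k)`. -/
def blockMetric {β : Type} (l k : ℕ) (K₀ : Matrix β β ℝ) :
    Matrix (BlockIndex β l k) (BlockIndex β l k) ℝ :=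
  fromBlocks K₀ 0 0 1

/-- The matrix with diagonal blocks `M₀, M₁, …, M_l, 0_k`, where `M_i` is the rotation block with
entries `a_i` and `-a_i`, and with last column `(γ, 0, …, 0, x)`. -/
def masaMatrix {β : Type} {l k : ℕ} (M₀ : Matrix β β ℝ) (γ : β → ℝ) (a : Fin l → ℝ)
    (x : Fin k → ℝ) : Matrix (BlockIndex β l k ⊕ Unit) (BlockIndex β l k ⊕ Unit) ℝ :=
  affineMatrix
    (fromBlocks M₀ 0 0 (fromBlocks (blockDiagonal fun i => !![0, a i; -a i, 0]) 0 0 0))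
    (Sum.elim γ (Sum.elim 0 x))

/-- `K₀ = -1`, of size one. -/
def metricA : Matrix Unit Unit ℝ := -1

/-- The antidiagonal `K₀` of size two. -/
def metricB : Matrix (Fin 2) (Fin 2) ℝ := !![0, 1; 1, 0]

/-- `M₀ = diag(c, -c)`. -/
def blockB (c : ℝ) : Matrix (Fin 2) (Fin 2) ℝ := !![c, 0; 0, -c]

/-- `K₀` with rows `(0, 0, 1)`, `(0, I_μ, 0)`, `(1, 0, 0)`. -/
def metricC (μ : ℕ) : Matrix (Unit ⊕ (Fin μ ⊕ Unit)) (Unit ⊕ (Fin μ ⊕ Unit)) ℝ :=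
  fromBlocks 0 (fromCols 0 1) (fromRows 0 1) (fromBlocks 1 0 0 0)

/-- `M₀` with rows `(0, α, 0)`, `(0, 0, -αᵀ)`, `(0, 0, 0)`. -/
def blockC {μ : ℕ} (α : Fin μ → ℝ) :
    Matrix (Unit ⊕ (Fin μ ⊕ Unit)) (Unit ⊕ (Fin μ ⊕ Unit)) ℝ :=
  fromBlocks 0 (fromCols (replicateRow Unit α) 0) 0
    (fromBlocks 0 (-replicateCol Unit α) 0 0)

/-- The three kinds of normal forms with their integer parameters; `k` is the number `k₊`. -/
inductive NormalForm : Type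
  | A (k l : ℕ)
  | B (k l : ℕ)
  | C (k μ l : ℕ)

/-- The parameters allowed in `e(p,1)`. The last condition of each kind says that the blocks fill
a matrix of size `p + 1`. -/
def NormalForm.Allowed (p : ℕ) : NormalForm → Prop
  | .A k l => k ≤ p ∧ Even (p - k) ∧ 2 * l + k = p
  | .B k l => k + 1 ≤ p ∧ Odd (p - k) ∧ 1 + 2 * l + k = p
  | .C k μ l => k + 2 ≤ p ∧ 1 ≤ μ ∧ μ ≤ p - 1 ∧ l ≤ (p - k - 2) / 2 ∧ (μ + 1) + 2 * l + k = p

/-- The subalgebra `L` of `e(p,1)` is represented by the given normal form, with all entries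
`a`, `x`, `z`, `c`, `α` free. -/
def HasNormalForm (p : ℕ) (L : LieSubalgebra ℝ (Ambient p)) : NormalForm → Prop
  | .A k l => Conjugate (minkowski p) (L : Set (Ambient p)) (blockMetric l k metricA)
      {Y | ∃ (z : ℝ) (a : Fin l → ℝ) (x : Fin k → ℝ), Y = masaMatrix 0 (fun _ => z) a x}
  | .B k l => Conjugate (minkowski p) (L : Set (Ambient p)) (blockMetric l k metricB)
      {Y | ∃ (c : ℝ) (a : Fin l → ℝ) (x : Fin k → ℝ), Y = masaMatrix (blockB c) 0 a x}
  | .C k μ l => Conjugate (minkowski p) (L : Set (Ambient p)) (blockMetric l k (metricC μ))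
      {Y | ∃ (z : ℝ) (α : Fin μ → ℝ) (a : Fin l → ℝ) (x : Fin k → ℝ),
        Y = masaMatrix (blockC α) (Sum.elim (fun _ => z) 0) a x}

end PseudoEuclidean

end

/-! Up to conjugacy a splitting algebra is a pair: a space `𝓜` of linear parts and a space `N` of
translations. By `isMASA_iff_isSplitPair` it is a MASA exactly when `𝓜` is an abelian subspace of
`o(K)`, `N` is its common kernel, and `𝓜` is its own centralizer among the elements of `o(K)` that
kill `N`. This turns the problem into linear algebra for a commuting family of skew operators on a
Lorentzian space.

Let `U` be a maximal invariant positive definite subspace. It is an orthogonal sum of lines killed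
by the family and planes rotated by it (`exists_isRotationFrame`); the lines give the translations
`x`, the planes the blocks `M_i`. The complement `W` is nondegenerate and contains no nonzero
positive definite invariant subspace (`exists_isLorentzCore`). A minimal invariant subspace of `W`
yields either a timelike vector killed by the family or a null vector that is a common eigenvector
(`IsLorentzCore.timelike_or_null`). In the first case `W` is a line, kind A. If the null vector is
not killed, `W` is a hyperbolic plane, kind B. If it is killed, the family acts on `W` by the
nilpotent matrices of kind C, with `μ ≥ 1`.

This analysis only bounds the family and its common kernel from above. Equality comes from
maximality: the larger model is abelian and kills the translations, so it lies in the centralizer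
(`IsIsometry.image_splitSet`). Conversely each model is maximal by a computation of centralizers
(`IsSplitPair.block`, `isSplitPair_metricB`, `isSplitPair_metricC`).

The parameters are invariants: by Sylvester's law (`HasType.unique`) the translation type determines
the kind and `k₊`, and the size `p + 1`, together with the dimension for kind C, determines the
rest. -/

noncomputable section

namespace PseudoEuclidean

/-! ### Minimal invariant subspaces of a commuting skew family. -/

section Invariant

variable {V : Type*} [AddCommGroup V] [Module ℝ V]

/-- A commuting space of endomorphisms that are skew for the symmetric form `B`. -/
structure IsSkewFamily (B : LinearMap.BilinForm ℝ V) (F : Submodule ℝ (Module.End ℝ V)) :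
    Prop where
  symm : ∀ v w, B v w = B w v
  comm : ∀ X ∈ F, ∀ Y ∈ F, ∀ v, X (Y v) = Y (X v)
  skew : ∀ X ∈ F, ∀ v w, B (X v) w = -B v (X w)

/-- The subspace `M` is carried into itself by all elements of `F`. -/
def IsInvariant (F : Submodule ℝ (Module.End ℝ V)) (M : Submodule ℝ V) : Prop :=
  ∀ X ∈ F, ∀ v ∈ M, X v ∈ M

/-- A minimal nonzero invariant subspace. -/
structure IsMinimalInvariant (F : Submodule ℝ (Module.End ℝ V)) (M : Submodule ℝ V) : Prop where
  ne_bot : M ≠ ⊥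
  invariant : IsInvariant F M
  eq_of_le : ∀ M' ≤ M, IsInvariant F M' → M' ≠ ⊥ → M' = M

/-- `B` is positive definite on `M`. -/
def IsPosOn (B : LinearMap.BilinForm ℝ V) (M : Submodule ℝ V) : Prop :=
  ∀ v ∈ M, v ≠ 0 → 0 < B v v

variable {B : LinearMap.BilinForm ℝ V} {F : Submodule ℝ (Module.End ℝ V)} {M U : Submodule ℝ V}

lemma IsInvariant.inf {M M' : Submodule ℝ V} (h : IsInvariant F M) (h' : IsInvariant F M') :
    IsInvariant F (M ⊓ M') :=
  fun X hX v hv => ⟨h X hX v hv.1, h' X hX v hv.2⟩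

lemma IsInvariant.sup {M M' : Submodule ℝ V} (h : IsInvariant F M) (h' : IsInvariant F M') :
    IsInvariant F (M ⊔ M') := by
  intro X hX v hv
  obtain ⟨a, ha, b, hb, rfl⟩ := Submodule.mem_sup.1 hv
  rw [map_add]
  exact Submodule.add_mem_sup (h X hX a ha) (h' X hX b hb)

lemma IsInvariant.span {s : Set V} (h : ∀ X ∈ F, ∀ v ∈ s, X v ∈ Submodule.span ℝ s) :
    IsInvariant F (Submodule.span ℝ s) := by
  intro X hX v hv
  induction hv using Submodule.span_induction with
  | mem x hx => exact h X hX x hx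
  | zero => simp
  | add x y _ _ hx hy => rw [map_add]; exact add_mem hx hy
  | smul a x _ hx => rw [map_smul]; exact Submodule.smul_mem _ _ hx

lemma IsInvariant.orthogonal (hF : IsSkewFamily B F) (h : IsInvariant F M) :
    IsInvariant F (B.orthogonal M) := by
  intro X hX v hv
  rw [LinearMap.BilinForm.mem_orthogonal_iff] at hv ⊢
  intro n hn
  have := hF.skew X hX n v
  rw [hv _ (h X hX n hn)] at this
  linarith

lemma IsInvariant.ker {Y : Module.End ℝ V}
    (h : ∀ X ∈ F, ∀ v, Y (X v) = X (Y v)) : IsInvariant F (LinearMap.ker Y) := by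
  intro X hX v hv
  rw [LinearMap.mem_ker] at hv ⊢
  rw [h X hX, hv, map_zero]

/-- A form of Schur's lemma: the kernel of an operator commuting with `F` is invariant, so it meets
a minimal subspace in zero or contains it. The operator need not belong to `F`. -/
lemma IsMinimalInvariant.ker_of_mem (hM : IsMinimalInvariant F M)
    {Y : Module.End ℝ V} (h : ∀ X ∈ F, ∀ v, Y (X v) = X (Y v)) {v : V} (hv : v ∈ M)
    (h0 : v ≠ 0) (hYv : Y v = 0) : ∀ w ∈ M, Y w = 0 := by
  have := hM.eq_of_le (M ⊓ LinearMap.ker Y) inf_le_left (hM.invariant.inf (.ker h))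
    ((Submodule.ne_bot_iff _).2 ⟨v, ⟨hv, hYv⟩, h0⟩)
  intro w hw
  rw [← this] at hw
  exact hw.2

lemma exists_isMinimalInvariant [FiniteDimensional ℝ V] (hU : IsInvariant F U) (h0 : U ≠ ⊥) :
    ∃ M ≤ U, IsMinimalInvariant F M := by
  obtain ⟨M, ⟨hM0, hMF, hMU⟩, hmin⟩ := WellFounded.has_min (wellFounded_lt (α := Submodule ℝ V))
    {M | M ≠ ⊥ ∧ IsInvariant F M ∧ M ≤ U} ⟨U, h0, hU, le_rfl⟩
  refine ⟨M, hMU, hM0, hMF, fun M' hle hinv hne => ?_⟩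
  by_contra hcon
  exact hmin M' ⟨hne, hinv, hle.trans hMU⟩ (lt_of_le_of_ne hle hcon)

/-- Factor the minimal polynomial of `X` on `M` as `p * q` with `p` irreducible, hence of degree at
most two over the reals. By minimality `q` does not annihilate the restriction, so `p` kills a
nonzero vector of `M`, and then all of `M` by Schur. -/
lemma IsMinimalInvariant.exists_quadratic [FiniteDimensional ℝ V] (hF : IsSkewFamily B F)
    (hM : IsMinimalInvariant F M) {X : Module.End ℝ V} (hX : X ∈ F) :
    ∃ a b c : ℝ, (a ≠ 0 ∨ b ≠ 0) ∧ ∀ v ∈ M, a • X (X v) + b • X v + c • v = 0 := by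
  set T : Module.End ℝ M := X.restrict (hM.invariant X hX) with hT
  have : Nontrivial M := Submodule.nontrivial_iff_ne_bot.2 hM.ne_bot
  have hne : minpoly ℝ T ≠ 0 := minpoly.ne_zero (Algebra.IsIntegral.isIntegral T)
  obtain ⟨p, hp, q, hq⟩ := WfDvdMonoid.exists_irreducible_factor (minpoly.not_isUnit ℝ T) hne
  have hq0 : q ≠ 0 := by rintro rfl; simp [hq] at hne
  have hqT : Polynomial.aeval T q ≠ 0 := by
    intro h
    have h1 := minpoly.degree_le_of_ne_zero ℝ T hq0 h
    rw [hq, Polynomial.degree_mul, Polynomial.degree_eq_natDegree hq0,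
      Polynomial.degree_eq_natDegree hp.ne_zero] at h1
    have h2 := hp.natDegree_pos
    norm_cast at h1
    omega
  obtain ⟨w, hw⟩ : ∃ w, Polynomial.aeval T q w ≠ 0 := by
    by_contra! h
    exact hqT (LinearMap.ext h)
  have hpw : Polynomial.aeval T p (Polynomial.aeval T q w) = 0 := by
    have := minpoly.aeval ℝ T
    rw [hq, map_mul] at this
    simpa using LinearMap.congr_fun this w
  have hdeg := hp.degree_le_two
  have hform := Polynomial.eq_quadratic_of_degree_le_two hdeg
  refine ⟨p.coeff 2, p.coeff 1, p.coeff 0, ?_, ?_⟩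
  · by_contra! h
    rw [h.1, h.2] at hform
    have h2 := hp.natDegree_pos
    rw [hform] at h2
    simp at h2
  · set Y : Module.End ℝ V := p.coeff 2 • (X * X) + p.coeff 1 • X + p.coeff 0 • 1 with hY
    have key := hM.ker_of_mem (Y := Y) (v := (Polynomial.aeval T q w : M)) ?_
      (Subtype.property _) (by simpa using hw) ?_
    · intro v hv
      simpa [hY] using key v hv
    · intro Z hZ v
      simp [hY, hF.comm X hX Z hZ]
    · rw [hform] at hpw
      simpa [hY, pow_two, hT] using congrArg Subtype.val hpw

/-- The adjoint of `X` is `-X`, so on a nondegenerate `M` the quadratic relation also holds with the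
sign of its linear term reversed. Subtracting removes that term: either `b = 0`, or `X` vanishes on
`M`. -/
lemma IsMinimalInvariant.sq_eq_smul [FiniteDimensional ℝ V] (hF : IsSkewFamily B F)
    (hM : IsMinimalInvariant F M) (hnd : ∀ v ∈ M, (∀ w ∈ M, B v w = 0) → v = 0)
    {X : Module.End ℝ V} (hX : X ∈ F) : ∃ c : ℝ, ∀ v ∈ M, X (X v) = c • v := by
  obtain ⟨a, b, c, hab, h⟩ := hM.exists_quadratic hF hX
  have inv := hM.invariant X hX
  have h' : ∀ v ∈ M, a • X (X v) - b • X v + c • v = 0 := by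
    intro v hv
    refine hnd _ (add_mem (sub_mem (M.smul_mem _ (inv _ (inv _ hv))) (M.smul_mem _ (inv _ hv)))
      (M.smul_mem _ hv)) fun w hw => ?_
    have h1 := congrArg (B v) (h w hw)
    have e1 : B (X (X v)) w = B v (X (X w)) := by
      rw [hF.skew X hX, hF.skew X hX, neg_neg]
    simp only [map_add, map_sub, map_smul, LinearMap.add_apply, LinearMap.sub_apply,
      LinearMap.smul_apply, e1, hF.skew X hX v w, map_zero, smul_eq_mul] at h1 ⊢
    linarith
  have hb : ∀ v ∈ M, b • X v = 0 := by
    intro v hv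
    have h1 := h v hv
    have h2 := h' v hv
    have h3 : (2 : ℝ) • (b • X v) = 0 := by
      rw [← sub_zero (2 • _)]
      calc (2 : ℝ) • (b • X v) - 0 = (a • X (X v) + b • X v + c • v)
            - (a • X (X v) - b • X v + c • v) := by module
        _ = 0 := by rw [h1, h2, sub_zero]
    simpa using h3
  by_cases hb0 : b = 0
  · have ha : a ≠ 0 := by simpa [hb0] using hab
    refine ⟨-(c / a), fun v hv => ?_⟩
    have h1 := h v hv
    rw [hb v hv, add_zero] at h1
    have h2 : a⁻¹ • (a • X (X v) + c • v) = 0 := by rw [h1, smul_zero]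
    rw [smul_add, smul_smul, inv_mul_cancel₀ ha, one_smul, smul_smul] at h2
    rw [eq_neg_of_add_eq_zero_left h2, neg_smul, div_eq_inv_mul]
  · refine ⟨0, fun v hv => ?_⟩
    have := hb v hv
    rw [smul_eq_zero_iff_right hb0] at this
    rw [this, map_zero, zero_smul]

lemma IsPosOn.nondegenerate (h : IsPosOn B M) : ∀ v ∈ M, (∀ w ∈ M, B v w = 0) → v = 0 := by
  intro v hv hw
  by_contra h0
  exact (h v hv h0).ne' (hw v hv)

lemma exists_normalized {v : V} (h : 0 < B v v) :
    ∃ r : ℝ, r ≠ 0 ∧ B (r • v) (r • v) = 1 := by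
  refine ⟨(√(B v v))⁻¹, by positivity, ?_⟩
  simp only [map_smul, LinearMap.smul_apply, smul_eq_mul]
  have := Real.mul_self_sqrt h.le
  have h2 : √(B v v) ≠ 0 := by positivity
  field_simp
  nlinarith

/-- A minimal invariant subspace on which the form is positive definite is a line in the common
kernel or a plane on which the family acts by infinitesimal rotations. -/
lemma IsMinimalInvariant.line_or_plane [FiniteDimensional ℝ V] (hF : IsSkewFamily B F)
    (hM : IsMinimalInvariant F M) (hpos : IsPosOn B M) :
    (∃ u, B u u = 1 ∧ M = Submodule.span ℝ {u} ∧ ∀ X ∈ F, X u = 0) ∨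
    (∃ u w, B u u = 1 ∧ B w w = 1 ∧ B u w = 0 ∧ M = Submodule.span ℝ {u, w} ∧
      (∀ X ∈ F, ∃ a : ℝ, X u = -a • w ∧ X w = a • u) ∧ ∃ X ∈ F, X u ≠ 0) := by
  obtain ⟨v, hv, hv0⟩ := (Submodule.ne_bot_iff _).1 hM.ne_bot
  obtain ⟨r, hr, hrv⟩ := exists_normalized (hpos v hv hv0)
  obtain ⟨u, hrv, huM, hu0⟩ : ∃ u, B u u = 1 ∧ u ∈ M ∧ u ≠ 0 :=
    ⟨r • v, hrv, M.smul_mem _ hv, smul_ne_zero hr hv0⟩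
  by_cases hkill : ∀ X ∈ F, X u = 0
  · left
    refine ⟨u, hrv, (hM.eq_of_le _ (by simpa using huM) (.span ?_) (by simpa using hu0)).symm,
      hkill⟩
    rintro X hX _ rfl
    rw [hkill X hX]; exact zero_mem _
  · right
    push Not at hkill
    obtain ⟨X₀, hX₀, hX₀u⟩ := hkill
    have hXM : X₀ u ∈ M := hM.invariant X₀ hX₀ u huM
    obtain ⟨s, hs, hsw⟩ := exists_normalized (hpos _ hXM hX₀u)
    obtain ⟨c, hc⟩ := hM.sq_eq_smul hF hpos.nondegenerate hX₀
    -- By skewness `B (X₀ u) (X₀ u) = -c * B u u`, and the left side is positive.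
    have hc0 : c ≠ 0 := by
      rintro rfl
      have := hF.skew X₀ hX₀ u (X₀ u)
      rw [hc u huM, zero_smul, map_zero, neg_zero] at this
      exact (hpos _ hXM hX₀u).ne' this
    have hskew0 : ∀ X ∈ F, ∀ v, B (X v) v = 0 := by
      intro X hX v
      have := hF.skew X hX v v
      rw [hF.symm v] at this
      linarith
    -- Polarization: the squares of `X₀`, `X` and `X₀ + X` are scalars on `M`, and the operators
    -- commute, so the product is a scalar too.
    have hmul : ∀ X ∈ F, ∃ d : ℝ, X (X₀ u) = d • u := by
      intro X hX
      obtain ⟨d, hd⟩ := hM.sq_eq_smul hF hpos.nondegenerate hX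
      obtain ⟨e, he⟩ := hM.sq_eq_smul hF hpos.nondegenerate (add_mem hX₀ hX)
      refine ⟨(e - c - d) / 2, ?_⟩
      have h1 := he u huM
      simp only [LinearMap.add_apply, map_add, hc u huM, hd u huM, hF.comm X₀ hX₀ X hX] at h1
      have h2 : (2 : ℝ) • X (X₀ u) = (e - c - d) • u := by
        rw [sub_smul, sub_smul, ← h1]; module
      rw [div_eq_inv_mul, ← smul_smul, ← h2, smul_smul]
      norm_num
    have hact : ∀ X ∈ F, ∃ a : ℝ, X u = -a • (s • X₀ u) ∧ X (s • X₀ u) = a • u := by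
      intro X hX
      obtain ⟨d, hd⟩ := hmul X hX
      have h1 : c • X u = d • X₀ u := by
        rw [← hc _ (hM.invariant X hX u huM), ← hF.comm X hX X₀ hX₀, hd, map_smul]
      have h2 : X (s • X₀ u) = (s * d) • u := by rw [map_smul, hd, smul_smul]
      refine ⟨s * d, ?_, h2⟩
      -- The normalization of `s` means `s * s * c = -1`, which turns the coefficient `d / c` into
      -- `-(s * d) * s`.
      have h3 : X u = (d / c) • X₀ u := by
        rw [div_eq_inv_mul, ← smul_smul, ← h1, smul_smul, inv_mul_cancel₀ hc0, one_smul]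
      have h4 := hF.skew X₀ hX₀ u (X₀ u)
      rw [hc u huM, map_smul, hrv] at h4
      have h5 : s * s * B (X₀ u) (X₀ u) = 1 := by
        rw [← hsw]; simp [mul_assoc]
      rw [h4, smul_eq_mul, mul_one] at h5
      rw [h3, smul_smul]
      congr 1
      field_simp
      linear_combination (-d) * h5
    refine ⟨u, s • X₀ u, hrv, hsw, ?_, ?_, hact, X₀, hX₀, hX₀u⟩
    · rw [hF.symm, map_smul, LinearMap.smul_apply, hskew0 X₀ hX₀, smul_zero]
    · refine (hM.eq_of_le _ ?_ (.span ?_) ?_).symm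
      · rw [Submodule.span_le]
        rintro x (rfl | rfl)
        · exact huM
        · exact M.smul_mem _ hXM
      · rintro X hX x (rfl | rfl)
        · obtain ⟨a, h1, -⟩ := hact X hX
          rw [h1]
          exact Submodule.smul_mem _ _ (Submodule.subset_span (by simp))
        · obtain ⟨a, -, h1⟩ := hact X hX
          rw [h1]
          exact Submodule.smul_mem _ _ (Submodule.subset_span (by simp))
      · exact (Submodule.ne_bot_iff _).2 ⟨u, Submodule.subset_span (by simp), hu0⟩

end Invariant

/-! ### Decomposition of a positive definite invariant subspace into lines and planes. -/

section Rotation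

variable {V : Type*} [AddCommGroup V] [Module ℝ V]

/-- An orthonormal family adapted to `F`: each plane `{b (0, i), b (1, i)}` is rotated by `F`, not
trivially, and the remaining vectors are annihilated. -/
structure IsRotationFrame (B : LinearMap.BilinForm ℝ V) (F : Submodule ℝ (Module.End ℝ V))
    (U : Submodule ℝ V) {l k : ℕ} (e : Fin 2 → Fin l → V) (f : Fin k → V) : Prop where
  plane_gram : ∀ s i t j, B (e s i) (e t j) = if s = t ∧ i = j then 1 else 0
  kernel_gram : ∀ i j, B (f i) (f j) = if i = j then 1 else 0
  plane_kernel : ∀ s i j, B (e s i) (f j) = 0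
  span_eq : Submodule.span ℝ (Set.range (fun q : Fin 2 × Fin l => e q.1 q.2) ∪ Set.range f) = U
  rotate : ∀ X ∈ F, ∃ a : Fin l → ℝ, ∀ i, X (e 0 i) = -a i • e 1 i ∧ X (e 1 i) = a i • e 0 i
  rotate_ne : ∀ i, ∃ X ∈ F, X (e 0 i) ≠ 0
  kernel : ∀ X ∈ F, ∀ j, X (f j) = 0

variable {B : LinearMap.BilinForm ℝ V} {F : Submodule ℝ (Module.End ℝ V)} {M U : Submodule ℝ V}

lemma IsPosOn.mono {M M' : Submodule ℝ V} (h : IsPosOn B M) (hle : M' ≤ M) : IsPosOn B M' :=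
  fun v hv => h v (hle hv)

lemma IsRotationFrame.mem_plane {l k : ℕ} {e : Fin 2 → Fin l → V} {f : Fin k → V}
    (h : IsRotationFrame B F U e f) (s : Fin 2) (i : Fin l) : e s i ∈ U := by
  rw [← h.span_eq]
  exact Submodule.subset_span (Or.inl ⟨(s, i), rfl⟩)

lemma IsRotationFrame.mem_kernel {l k : ℕ} {e : Fin 2 → Fin l → V} {f : Fin k → V}
    (h : IsRotationFrame B F U e f) (j : Fin k) : f j ∈ U := by
  rw [← h.span_eq]
  exact Submodule.subset_span (Or.inr ⟨j, rfl⟩)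

/-- Definiteness makes `M` meet its orthogonal trivially, so the two are complementary; the modular
law restricts this to `U`. -/
lemma sup_inf_orthogonal [FiniteDimensional ℝ V] (hs : ∀ v w, B v w = B w v) (hpos : IsPosOn B M)
    (hle : M ≤ U) : M ⊔ (B.orthogonal M ⊓ U) = U := by
  have hc : IsCompl M (B.orthogonal M) := by
    refine (LinearMap.BilinForm.isCompl_orthogonal_iff_disjoint (fun v w h => by rw [hs, h])).2 ?_
    rw [Submodule.disjoint_def]
    intro v hv ho
    by_contra h0
    exact (hpos v hv h0).ne' (LinearMap.BilinForm.mem_orthogonal_iff.1 ho v hv)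
  rw [← sup_inf_assoc_of_le _ hle, hc.sup_eq_top, top_inf_eq]

lemma IsRotationFrame.empty : IsRotationFrame B F ⊥ (fun _ (i : Fin 0) => i.elim0)
    (fun i : Fin 0 => i.elim0) where
  plane_gram _ i := i.elim0
  kernel_gram i := i.elim0
  plane_kernel _ i := i.elim0
  span_eq := by simp
  rotate _ _ := ⟨0, fun i => i.elim0⟩
  rotate_ne i := i.elim0
  kernel _ _ i := i.elim0

lemma IsRotationFrame.cons_line {l k : ℕ} {e : Fin 2 → Fin l → V} {f : Fin k → V}
    (hs : ∀ v w, B v w = B w v) (h : IsRotationFrame B F U e f) {u : V} (hu : B u u = 1)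
    (hk : ∀ X ∈ F, X u = 0) (ho : ∀ v ∈ U, B u v = 0) :
    IsRotationFrame B F (Submodule.span ℝ {u} ⊔ U) e (Fin.cons u f : Fin (k + 1) → V) where
  plane_gram := h.plane_gram
  kernel_gram i j := by
    cases i using Fin.cases <;> cases j using Fin.cases
    · simp [hu]
    · simp [ho _ (h.mem_kernel _), (Fin.succ_ne_zero _).symm]
    · simp [hs _ u, ho _ (h.mem_kernel _)]
    · simp [h.kernel_gram]
  plane_kernel s i j := by
    cases j using Fin.cases
    · simp [hs _ u, ho _ (h.mem_plane _ _)]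
    · simp [h.plane_kernel]
  span_eq := by
    rw [Fin.range_cons, ← h.span_eq, Set.union_insert, ← Set.singleton_union, Submodule.span_union]
  rotate := h.rotate
  rotate_ne := h.rotate_ne
  kernel X hX j := by
    cases j using Fin.cases
    · simp [hk X hX]
    · simp [h.kernel X hX]

lemma IsRotationFrame.cons_plane {l k : ℕ} {e : Fin 2 → Fin l → V} {f : Fin k → V}
    (hs : ∀ v w, B v w = B w v) (h : IsRotationFrame B F U e f) {u w : V} (hu : B u u = 1)
    (hw : B w w = 1) (huw : B u w = 0)
    (hr : ∀ X ∈ F, ∃ a : ℝ, X u = -a • w ∧ X w = a • u) (hn : ∃ X ∈ F, X u ≠ 0)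
    (hou : ∀ v ∈ U, B u v = 0) (how : ∀ v ∈ U, B w v = 0) :
    IsRotationFrame B F (Submodule.span ℝ {u, w} ⊔ U)
      (fun s => (Fin.cons (![u, w] s) (e s) : Fin (l + 1) → V)) f where
  plane_gram s i t j := by
    have hwu : B w u = 0 := by rw [hs, huw]
    cases i using Fin.cases <;> cases j using Fin.cases
    · fin_cases s <;> fin_cases t <;> simp [hu, hw, huw, hwu]
    · fin_cases s <;> simp [hou _ (h.mem_plane _ _), how _ (h.mem_plane _ _),
        (Fin.succ_ne_zero _).symm]
    · fin_cases t <;> simp [hs _ u, hs _ w, hou _ (h.mem_plane _ _), how _ (h.mem_plane _ _)]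
    · simp [h.plane_gram]
  kernel_gram := h.kernel_gram
  plane_kernel s i j := by
    cases i using Fin.cases
    · fin_cases s <;> simp [hou _ (h.mem_kernel _), how _ (h.mem_kernel _)]
    · simp [h.plane_kernel]
  span_eq := by
    rw [← h.span_eq, ← Submodule.span_union, ← Set.union_assoc]
    congr 2
    ext x
    constructor
    · rintro ⟨⟨s, i⟩, rfl⟩
      cases i using Fin.cases with
      | zero => left; fin_cases s <;> simp
      | succ i => exact Or.inr ⟨(s, i), by simp⟩
    · rintro ((rfl | rfl) | ⟨⟨s, i⟩, rfl⟩)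
      · exact ⟨(0, 0), by simp⟩
      · exact ⟨(1, 0), by simp⟩
      · exact ⟨(s, i.succ), by simp⟩
  rotate X hX := by
    obtain ⟨a, ha⟩ := h.rotate X hX
    obtain ⟨c, hc⟩ := hr X hX
    refine ⟨Fin.cons c a, fun i => ?_⟩
    cases i using Fin.cases
    · simpa using hc
    · simpa using ha _
  rotate_ne i := by
    cases i using Fin.cases
    · simpa using hn
    · simpa using h.rotate_ne _
  kernel := h.kernel

/-- Induction on the dimension: split off a minimal invariant subspace, which is a killed line or a
rotated plane. By skewness its orthogonal complement in `U` is again invariant. -/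
lemma exists_isRotationFrame [FiniteDimensional ℝ V] (hF : IsSkewFamily B F)
    (hU : IsInvariant F U) (hpos : IsPosOn B U) :
    ∃ (l k : ℕ) (e : Fin 2 → Fin l → V) (f : Fin k → V), IsRotationFrame B F U e f := by
  induction hn : Module.finrank ℝ U using Nat.strong_induction_on generalizing U with
  | _ n ih =>
  by_cases h0 : U = ⊥
  · subst h0
    exact ⟨0, 0, _, _, .empty⟩
  obtain ⟨M, hMU, hM⟩ := exists_isMinimalInvariant hU h0
  have hsup := sup_inf_orthogonal hF.symm (hpos.mono hMU) hMU
  set U' := B.orthogonal M ⊓ U with hU'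
  have horth : ∀ u ∈ M, ∀ v ∈ U', B u v = 0 := fun u hu v hv =>
    LinearMap.BilinForm.mem_orthogonal_iff.1 hv.1 u hu
  have hlt : U' < U := by
    refine lt_of_le_of_ne inf_le_right fun h => ?_
    obtain ⟨v, hv, hv0⟩ := (Submodule.ne_bot_iff _).1 hM.ne_bot
    exact (hpos v (hMU hv) hv0).ne' (horth v hv v (h ▸ hMU hv))
  obtain ⟨l, k, e, f, h⟩ := ih _ (hn ▸ Submodule.finrank_lt_finrank_of_lt hlt)
    ((hM.invariant.orthogonal hF).inf hU) (hpos.mono inf_le_right) rfl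
  rcases hM.line_or_plane hF (hpos.mono hMU) with
    ⟨u, hu, hspan, hk⟩ | ⟨u, w, hu, hw, huw, hspan, hr, hn⟩
  · have hcons := h.cons_line hF.symm hu hk
      (horth u (by rw [hspan]; exact Submodule.subset_span (by simp)))
    rw [← hspan, hsup] at hcons
    exact ⟨l, k + 1, _, _, hcons⟩
  · have hcons := h.cons_plane hF.symm hu hw huw hr hn
      (horth u (by rw [hspan]; exact Submodule.subset_span (by simp)))
      (horth w (by rw [hspan]; exact Submodule.subset_span (by simp)))
    rw [← hspan, hsup] at hcons
    exact ⟨l + 1, k, _, _, hcons⟩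

end Rotation

/-! ### Lorentzian geometry and the core without positive definite invariant subspaces. -/

section Lorentz

variable {V : Type*} [AddCommGroup V] [Module ℝ V]

/-- A symmetric form with one negative and otherwise positive directions. -/
def IsLorentzian (B : LinearMap.BilinForm ℝ V) : Prop :=
  (∀ v w, B v w = B w v) ∧ ∃ t, B t t < 0 ∧ ∀ v, B t v = 0 → v ≠ 0 → 0 < B v v

variable {B : LinearMap.BilinForm ℝ V} {F : Submodule ℝ (Module.End ℝ V)} {W : Submodule ℝ V}

/-- Orthogonal causal vectors are proportional. -/
lemma IsLorentzian.causal_parallel (hB : IsLorentzian B) {v w : V} (h0 : v ≠ 0) (hv : B v v ≤ 0)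
    (hw : B w w ≤ 0) (ho : B v w = 0) : ∃ r : ℝ, w = r • v := by
  obtain ⟨hs, t, ht, hpos⟩ := hB
  have ha : B t v ≠ 0 := fun h => (hpos v h h0).not_ge hv
  -- This combination is orthogonal to `t`, while its square `(B t v)² B w w + (B t w)² B v v` is
  -- not positive because `v` and `w` are orthogonal.
  have hu : B t v • w - B t w • v = 0 := by
    by_contra hne
    refine (hpos _ ?_ hne).not_ge ?_
    · simp only [map_sub, map_smul, smul_eq_mul]; ring
    · simp only [map_sub, map_smul, smul_eq_mul, LinearMap.sub_apply, LinearMap.smul_apply,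
        hs w v, ho]
      nlinarith [mul_nonneg (mul_self_nonneg (B t v)) (neg_nonneg.2 hw),
        mul_nonneg (mul_self_nonneg (B t w)) (neg_nonneg.2 hv)]
  refine ⟨B t w / B t v, ?_⟩
  rw [div_eq_inv_mul, ← smul_smul, ← sub_eq_zero.1 hu, smul_smul, inv_mul_cancel₀ ha, one_smul]

/-- Every timelike vector can play the role of the distinguished one: a causal vector orthogonal to
`t` would be a multiple of `t`, and a nonzero multiple is not orthogonal to `t`. -/
lemma IsLorentzian.pos_of_orthogonal (hB : IsLorentzian B) {t w : V} (ht : B t t < 0)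
    (ho : B t w = 0) (hw : w ≠ 0) : 0 < B w w := by
  by_contra! h
  have ht0 : t ≠ 0 := by rintro rfl; simp at ht
  obtain ⟨r, rfl⟩ := hB.causal_parallel ht0 ht.le h ho
  simp only [map_smul, smul_eq_mul, mul_eq_zero, ht.ne, or_false] at ho
  simp [ho] at hw

/-- `W` is nonzero, nondegenerate, invariant and has no nonzero invariant subspace on which the
form is positive definite. -/
structure IsLorentzCore (B : LinearMap.BilinForm ℝ V) (F : Submodule ℝ (Module.End ℝ V))
    (W : Submodule ℝ V) : Prop where
  ne_bot : W ≠ ⊥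
  invariant : IsInvariant F W
  nondegenerate : ∀ v ∈ W, (∀ w ∈ W, B v w = 0) → v = 0
  eq_bot : ∀ M ≤ W, IsInvariant F M → IsPosOn B M → M = ⊥

lemma IsSkewFamily.apply_self (hF : IsSkewFamily B F) {X : Module.End ℝ V} (hX : X ∈ F) (v : V) :
    B (X v) v = 0 := by
  have := hF.skew X hX v v
  rw [hF.symm v] at this
  linarith

lemma exists_timelike {M : Submodule ℝ V} (hs : ∀ v w, B v w = B w v)
    (hnd : ∀ v ∈ M, (∀ w ∈ M, B v w = 0) → v = 0) (hM : ¬ IsPosOn B M) :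
    ∃ t ∈ M, B t t < 0 := by
  simp only [IsPosOn, not_forall, not_lt] at hM
  obtain ⟨v, hv, h0, hvv⟩ := hM
  rcases hvv.lt_or_eq with h | h
  · exact ⟨v, hv, h⟩
  · have : ∃ w ∈ M, B v w ≠ 0 := by
      by_contra! hcon
      exact h0 (hnd v hv hcon)
    obtain ⟨w, hw, hvw⟩ := this
    -- Since `v` is null, subtracting `r • v` changes the square of `w` by `-2 * r * B v w`; this
    -- `r` makes it `-1`.
    refine ⟨w - ((B w w + 1) / (2 * B v w)) • v, sub_mem hw (M.smul_mem _ hv), ?_⟩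
    simp only [map_sub, map_smul, smul_eq_mul, LinearMap.sub_apply, LinearMap.smul_apply,
      hs w v, h]
    have : (B w w + 1) / (2 * B v w) * B v w = (B w w + 1) / 2 := by field_simp
    rw [mul_zero, sub_zero, this]
    linarith

/-- The radical of a minimal invariant `M` is invariant, hence zero or `M`. If it is zero, `M`
contains a timelike `t`, and skewness together with minimality forces every `X` to kill it. If it is
`M`, all of `M` is isotropic, and orthogonal null vectors in a Lorentzian space are parallel, so
every vector of `M` is an eigenvector. -/
lemma IsLorentzCore.timelike_or_null [FiniteDimensional ℝ V] (hB : IsLorentzian B)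
    (hF : IsSkewFamily B F) (hW : IsLorentzCore B F W) :
    (∃ t ∈ W, B t t < 0 ∧ ∀ X ∈ F, X t = 0) ∨
    ∃ n ∈ W, n ≠ 0 ∧ B n n = 0 ∧ ∀ X ∈ F, ∃ c : ℝ, X n = c • n := by
  obtain ⟨M, hMW, hM⟩ := exists_isMinimalInvariant hW.invariant hW.ne_bot
  by_cases hR : M ⊓ B.orthogonal M = ⊥
  · left
    have hnd : ∀ v ∈ M, (∀ w ∈ M, B v w = 0) → v = 0 := by
      intro v hv h
      have : v ∈ M ⊓ B.orthogonal M :=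
        ⟨hv, LinearMap.BilinForm.mem_orthogonal_iff.2 fun w hw => by rw [hF.symm, h w hw]⟩
      simpa [hR] using this
    obtain ⟨t, ht, htt⟩ := exists_timelike hF.symm hnd
      fun h => hM.ne_bot (hW.eq_bot M hMW hM.invariant h)
    refine ⟨t, hMW ht, htt, fun X hX => ?_⟩
    obtain ⟨c, hc⟩ := hM.sq_eq_smul hF hnd hX
    have hty : B t (X t) = 0 := by rw [hF.symm, hF.apply_self hX]
    by_contra hne
    -- `X t` is orthogonal to the timelike `t`, hence spacelike, and its square equals `-c * B t t`.
    have hcpos : 0 < c := by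
      have h1 := hB.pos_of_orthogonal htt hty hne
      rw [hF.skew X hX, hc t ht, map_smul, smul_eq_mul] at h1
      nlinarith
    have hs := Real.mul_self_sqrt hcpos.le
    have hs0 : √c ≠ 0 := by positivity
    -- From `X² = c` on `M` the operator `X - √c` kills `X t + √c • t`. It therefore kills `t`, and
    -- `X t = √c • t` contradicts the orthogonality of `X t` and `t`.
    have key := hM.ker_of_mem (Y := X - √c • 1) (v := X t + √c • t) (fun Z hZ v => ?_)
      (add_mem (hM.invariant X hX t ht) (M.smul_mem _ ht)) ?_ ?_ t ht
    · have h1 : X t = √c • t := by simpa [sub_eq_zero] using key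
      rw [h1, map_smul, smul_eq_mul] at hty
      simp [hs0, htt.ne] at hty
    · simp [hF.comm X hX Z hZ]
    · intro h
      have h1 := congrArg (B t) h
      simp [hty, hs0, htt.ne] at h1
    · simp only [LinearMap.sub_apply, map_add, map_smul, hc t ht, LinearMap.smul_apply,
        Module.End.one_apply]
      rw [smul_sub, smul_smul, hs]
      abel
  · right
    have hle : M ≤ B.orthogonal M := by
      have := hM.eq_of_le _ inf_le_left (hM.invariant.inf (hM.invariant.orthogonal hF)) hR
      exact inf_eq_left.1 this
    have hz : ∀ v ∈ M, ∀ w ∈ M, B v w = 0 := fun v hv w hw =>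
      LinearMap.BilinForm.mem_orthogonal_iff.1 (hle hw) v hv
    obtain ⟨n, hn, hn0⟩ := (Submodule.ne_bot_iff _).1 hM.ne_bot
    refine ⟨n, hMW hn, hn0, hz n hn n hn, fun X hX => ?_⟩
    have hXn := hM.invariant X hX n hn
    exact hB.causal_parallel hn0 (hz n hn n hn).le (hz _ hXn _ hXn).le (hz _ hn _ hXn)

/-- In the basis `c` of `W` the form has the matrix `K₀`, the family acts by matrices from `𝓜`, and
its common kernel has coordinates in `N`. -/
structure IsModel (B : LinearMap.BilinForm ℝ V) (F : Submodule ℝ (Module.End ℝ V))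
    (W : Submodule ℝ V) {β : Type} [Fintype β] (K₀ : Matrix β β ℝ)
    (𝓜 : Submodule ℝ (Matrix β β ℝ)) (N : Submodule ℝ (β → ℝ)) (c : β → V) : Prop where
  gram : ∀ i j, B (c i) (c j) = K₀ i j
  span_eq : Submodule.span ℝ (Set.range c) = W
  act : ∀ X ∈ F, ∃ M ∈ 𝓜, ∀ j, X (c j) = ∑ i, M i j • c i
  kernel : ∀ γ : β → ℝ, (∀ X ∈ F, X (∑ i, γ i • c i) = 0) → γ ∈ N

/-- The map `c ↦ blockB c`. -/
def blockBLin : ℝ →ₗ[ℝ] Matrix (Fin 2) (Fin 2) ℝ where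
  toFun := blockB
  map_add' x y := by ext i j; fin_cases i <;> fin_cases j <;> simp [blockB]; ring
  map_smul' x y := by ext i j; fin_cases i <;> fin_cases j <;> simp [blockB]

/-- The map `α ↦ blockC α`. -/
def blockCLin (μ : ℕ) : (Fin μ → ℝ) →ₗ[ℝ]
    Matrix (Unit ⊕ (Fin μ ⊕ Unit)) (Unit ⊕ (Fin μ ⊕ Unit)) ℝ where
  toFun := blockC
  map_add' x y := by
    ext (i | i | i) (j | j | j) <;> simp [blockC]; ring
  map_smul' x y := by
    ext (i | i | i) (j | j | j) <;> simp [blockC]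

/-- The map `z ↦ (z, 0, 0)`. -/
def nullCLin (μ : ℕ) : ℝ →ₗ[ℝ] (Unit ⊕ (Fin μ ⊕ Unit) → ℝ) where
  toFun z := Sum.elim (fun _ => z) 0
  map_add' x y := by ext (i | i) <;> simp
  map_smul' x y := by ext (i | i) <;> simp

/-- The complement of `t` in `W` is invariant because `t` is killed, and positive definite because
`t` is timelike. In a core it must vanish, so `W` is the line of `t`. -/
lemma IsLorentzCore.model_timelike [FiniteDimensional ℝ V] (hB : IsLorentzian B)
    (hF : IsSkewFamily B F) (hW : IsLorentzCore B F W) {t : V} (ht : t ∈ W) (htt : B t t < 0)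
    (hk : ∀ X ∈ F, X t = 0) : ∃ c : Unit → V, IsModel B F W metricA ⊥ ⊤ c := by
  have h1 : 0 < (-B) t t := by simpa using htt
  obtain ⟨r, hr, hrt⟩ := exists_normalized h1
  obtain ⟨u, huu, huW, hku⟩ : ∃ u, B u u = -1 ∧ u ∈ W ∧ ∀ X ∈ F, X u = 0 :=
    ⟨r • t, by simpa [neg_eq_iff_eq_neg] using hrt, W.smul_mem _ ht,
      fun X hX => by rw [map_smul, hk X hX, smul_zero]⟩
  refine ⟨fun _ => u, fun i j => by simp [huu, metricA], ?_, fun X hX => ⟨0, zero_mem _, ?_⟩,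
    fun _ _ => trivial⟩
  · have hline : IsInvariant F (Submodule.span ℝ {u}) := .span (by
      rintro X hX _ rfl
      rw [hku X hX]; exact zero_mem _)
    have hbot := hW.eq_bot (W ⊓ B.orthogonal (Submodule.span ℝ {u})) inf_le_left
      (hW.invariant.inf (hline.orthogonal hF)) fun v hv h0 => by
        refine hB.pos_of_orthogonal (t := u) (by rw [huu]; norm_num) ?_ h0
        exact LinearMap.BilinForm.mem_orthogonal_iff.1 hv.2 u (Submodule.mem_span_singleton_self u)
    apply le_antisymm
    · rw [Submodule.span_le]
      rintro _ ⟨_, rfl⟩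
      exact huW
    · intro v hv
      have hmem : v + B u v • u ∈ W ⊓ B.orthogonal (Submodule.span ℝ {u}) := by
        refine ⟨add_mem hv (W.smul_mem _ huW), LinearMap.BilinForm.mem_orthogonal_iff.2 ?_⟩
        intro n hn
        obtain ⟨a, rfl⟩ := Submodule.mem_span_singleton.1 hn
        simp [huu]
      rw [hbot, Submodule.mem_bot, add_eq_zero_iff_eq_neg] at hmem
      rw [hmem, Set.range_const]
      exact neg_mem (Submodule.smul_mem _ _ (Submodule.mem_span_singleton_self u))
  · simp [hku X hX]

end Lorentz

/-! ### Cores with a null eigenvector: the boost and the nilpotent models. -/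

section NullVector

variable {V : Type*} [AddCommGroup V] [Module ℝ V]
variable {B : LinearMap.BilinForm ℝ V} {F : Submodule ℝ (Module.End ℝ V)} {W : Submodule ℝ V}

lemma mem_orthogonal_span_pair {n m v : V} :
    v ∈ B.orthogonal (Submodule.span ℝ {n, m}) ↔ B n v = 0 ∧ B m v = 0 := by
  rw [LinearMap.BilinForm.mem_orthogonal_iff]
  constructor
  · exact fun h => ⟨h n (Submodule.subset_span (by simp)), h m (Submodule.subset_span (by simp))⟩
  · rintro ⟨h1, h2⟩ w hw
    obtain ⟨a, b, rfl⟩ := Submodule.mem_span_pair.1 hw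
    simp [h1, h2]

/-- The vector `n - m` has square `-2`, so whatever is orthogonal to both `n` and `m` is orthogonal
to a timelike vector. -/
lemma IsLorentzian.isPosOn_orthogonal_span_pair (hB : IsLorentzian B) {n m : V} (hn : B n n = 0)
    (hm : B m m = 0) (hnm : B n m = 1) : IsPosOn B (B.orthogonal (Submodule.span ℝ {n, m})) := by
  intro v hv h0
  obtain ⟨h1, h2⟩ := mem_orthogonal_span_pair.1 hv
  refine hB.pos_of_orthogonal (t := n - m) ?_ (by simp [h1, h2]) h0
  simp [hn, hm, hnm, hB.1 m n]

lemma sub_mem_orthogonal_span_pair (hs : ∀ v w, B v w = B w v) {n m : V} (hn : B n n = 0)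
    (hm : B m m = 0) (hnm : B n m = 1) (hnW : n ∈ W) (hmW : m ∈ W) {v : V} (hv : v ∈ W) :
    v - B m v • n - B n v • m ∈ W ⊓ B.orthogonal (Submodule.span ℝ {n, m}) := by
  refine ⟨sub_mem (sub_mem hv (W.smul_mem _ hnW)) (W.smul_mem _ hmW),
    mem_orthogonal_span_pair.2 ⟨?_, ?_⟩⟩
  · simp [hn, hnm]
  · simp [hm, hs m n, hnm]

/-- An operator with eigenvalue `c₀ ≠ 0` on `n` also has the eigenvalue `-c₀` on `W`, with a null
eigenvector `m` paired with `n`. The whole family preserves the plane of `n` and `m`; its complement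
in `W` is invariant and positive definite, hence zero. -/
lemma IsLorentzCore.model_boost [FiniteDimensional ℝ V] (hB : IsLorentzian B)
    (hF : IsSkewFamily B F) (hW : IsLorentzCore B F W) {n : V} (hnW : n ∈ W) (hn0 : n ≠ 0)
    (hn : B n n = 0) (hk : ∀ X ∈ F, ∃ c : ℝ, X n = c • n) (hne : ∃ X ∈ F, X n ≠ 0) :
    ∃ c : Fin 2 → V, IsModel B F W metricB (LinearMap.range blockBLin) ⊥ c := by
  obtain ⟨X₀, hX₀, hX₀n⟩ := hne
  obtain ⟨c₀, hc₀⟩ := hk X₀ hX₀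
  have hc₀0 : c₀ ≠ 0 := by rintro rfl; simp [hc₀] at hX₀n
  -- By skewness the image of `X₀ + c₀` is orthogonal to `n`. Were it injective on `W`, it would be
  -- onto, and `n` would lie in the radical of `W`.
  obtain ⟨w, hwW, hw0, hw⟩ : ∃ w ∈ W, w ≠ 0 ∧ X₀ w = -c₀ • w := by
    by_contra! hcon
    set T : Module.End ℝ W := X₀.restrict (hW.invariant X₀ hX₀) + c₀ • 1 with hT
    have hinj : Function.Injective T := by
      rw [← LinearMap.ker_eq_bot, LinearMap.ker_eq_bot']
      intro w hw
      by_contra h0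
      refine hcon w w.2 (by simpa using h0) ?_
      have := congrArg Subtype.val hw
      simp only [hT, LinearMap.add_apply, LinearMap.smul_apply, Module.End.one_apply,
        Submodule.coe_add, LinearMap.coe_restrict_apply, Submodule.coe_smul,
        Submodule.coe_zero] at this
      rw [neg_smul]
      exact eq_neg_of_add_eq_zero_left this
    refine hn0 (hW.nondegenerate n hnW fun v hv => ?_)
    obtain ⟨u, hu⟩ := LinearMap.injective_iff_surjective.1 hinj ⟨v, hv⟩
    have hu' : X₀ u + c₀ • (u : V) = v := by
      simpa [hT] using congrArg Subtype.val hu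
    have := hF.skew X₀ hX₀ n u
    rw [hc₀, map_smul, LinearMap.smul_apply, smul_eq_mul] at this
    rw [← hu', map_add, map_smul, smul_eq_mul]
    linarith
  have heig : ∀ y z : V, X₀ y = -c₀ • y → X₀ z = -c₀ • z → B y z = 0 := by
    intro y z hy hz
    have := hF.skew X₀ hX₀ y z
    rw [hy, hz, map_smul, map_smul, LinearMap.smul_apply, smul_eq_mul] at this
    have h2 : c₀ * B y z = 0 := by linarith
    simpa [hc₀0] using h2
  -- Otherwise the null vectors `n` and `w` would be parallel, although their eigenvalues `c₀` and
  -- `-c₀` differ.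
  have hnw : B n w ≠ 0 := by
    intro h
    obtain ⟨r, rfl⟩ := hB.causal_parallel hn0 hn.le (heig w w hw hw).le h
    rw [map_smul, hc₀, smul_smul, smul_smul, ← sub_eq_zero, ← sub_smul, smul_eq_zero] at hw
    have hr : r ≠ 0 := by rintro rfl; simp at hw0
    rcases hw with hw | hw
    · have : c₀ * r = 0 := by linarith
      simp [hc₀0, hr] at this
    · exact hn0 hw
  obtain ⟨m, hmW, hnm, hm0, hm⟩ : ∃ m ∈ W, B n m = 1 ∧ m ≠ 0 ∧ X₀ m = -c₀ • m :=
    ⟨(B n w)⁻¹ • w, W.smul_mem _ hwW, by simp [hnw], smul_ne_zero (inv_ne_zero hnw) hw0, by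
      rw [map_smul, hw, smul_comm]⟩
  have hmm := heig m m hm hm
  -- Each `X` commutes with `X₀` and so preserves the eigenspace of `-c₀`. That space is totally
  -- isotropic, so `X m` is a multiple of `m`; skewness fixes the factor.
  have hmact : ∀ X ∈ F, ∃ c : ℝ, X n = c • n ∧ X m = -c • m := by
    intro X hX
    obtain ⟨c, hc⟩ := hk X hX
    have hXm : X₀ (X m) = -c₀ • X m := by rw [hF.comm X₀ hX₀ X hX, hm, map_smul]
    obtain ⟨r, hr⟩ := hB.causal_parallel hm0 hmm.le (heig _ _ hXm hXm).le (heig _ _ hm hXm)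
    refine ⟨c, hc, ?_⟩
    have := hF.skew X hX n m
    rw [hc, hr, map_smul, map_smul, LinearMap.smul_apply, hnm] at this
    rw [hr]
    congr 1
    simpa [eq_neg_iff_add_eq_zero, add_comm] using this
  have hplane : IsInvariant F (Submodule.span ℝ {n, m}) := .span (by
    rintro X hX x (rfl | rfl) <;> obtain ⟨c, h1, h2⟩ := hmact X hX
    · rw [h1]; exact Submodule.smul_mem _ _ (Submodule.subset_span (by simp))
    · rw [h2]; exact Submodule.smul_mem _ _ (Submodule.subset_span (by simp)))
  have hbot := hW.eq_bot (W ⊓ B.orthogonal (Submodule.span ℝ {n, m})) inf_le_left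
    (hW.invariant.inf (hplane.orthogonal hF))
    ((hB.isPosOn_orthogonal_span_pair hn hmm hnm).mono inf_le_right)
  refine ⟨![n, m], ?_, ?_, ?_, ?_⟩
  · intro i j
    fin_cases i <;> fin_cases j <;> simp [metricB, hn, hmm, hnm, hF.symm m n]
  · rw [Matrix.range_cons, Matrix.range_cons, Matrix.range_empty, Set.union_empty,
      Set.singleton_union]
    apply le_antisymm
    · rw [Submodule.span_le]
      rintro x (rfl | rfl)
      · exact hnW
      · exact hmW
    · intro v hv
      have := sub_mem_orthogonal_span_pair hF.symm hn hmm hnm hnW hmW hv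
      rw [hbot, Submodule.mem_bot, sub_sub, sub_eq_zero] at this
      rw [this]
      exact Submodule.mem_span_pair.2 ⟨_, _, rfl⟩
  · intro X hX
    obtain ⟨c, h1, h2⟩ := hmact X hX
    refine ⟨blockB c, ⟨c, rfl⟩, fun j => ?_⟩
    fin_cases j <;> simp [blockB, h1, h2]
  · intro γ hγ
    have := hγ X₀ hX₀
    simp only [Fin.sum_univ_two, cons_val_zero, cons_val_one, map_add, map_smul, hc₀, hm] at this
    have h1 := congrArg (B n) this
    have h2 := congrArg (B m) this
    simp [hn, hmm, hnm, hF.symm m n, hc₀0] at h1 h2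
    rw [Submodule.mem_bot]
    ext i
    fin_cases i <;> simp [h1, h2]

/-- The image of `W ∩ n^⊥` under `X²` is invariant, and it is positive definite: if `X² w` were
causal and nonzero, it would be a multiple of `n`, then `X w` would be null, hence a multiple of
`n`, and `X² w = 0`. In a core the image is therefore zero, so `X v` is null and orthogonal to `n`.
-/
lemma IsLorentzCore.exists_eq_smul_of_orthogonal (hB : IsLorentzian B)
    (hF : IsSkewFamily B F) (hW : IsLorentzCore B F W) {n : V} (hn0 : n ≠ 0)
    (hn : B n n = 0) (hk : ∀ X ∈ F, X n = 0) {X : Module.End ℝ V} (hX : X ∈ F) {v : V}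
    (hv : v ∈ W) (hnv : B n v = 0) : ∃ r : ℝ, X v = r • n := by
  have hperp : ∀ Y ∈ F, ∀ w, B n (Y w) = 0 := by
    intro Y hY w
    have := hF.skew Y hY n w
    rw [hk Y hY] at this
    simpa using this.symm
  have hmem : ∀ w : V, w ∈ B.orthogonal (Submodule.span ℝ {n}) ↔ B n w = 0 := by
    intro w
    rw [← Set.insert_eq_of_mem (Set.mem_singleton n), mem_orthogonal_span_pair]
    simp
  have hbot := hW.eq_bot (Submodule.map (X * X) (W ⊓ B.orthogonal (Submodule.span ℝ {n}))) ?_ ?_ ?_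
  · have h1 : X (X v) = 0 := by
      have : X (X v) ∈ Submodule.map (X * X) (W ⊓ B.orthogonal (Submodule.span ℝ {n})) :=
        ⟨v, ⟨hv, (hmem v).2 hnv⟩, rfl⟩
      simpa [hbot] using this
    refine hB.causal_parallel hn0 hn.le ?_ (hperp X hX v)
    rw [hF.skew X hX, h1]; simp
  · rintro _ ⟨w, hw, rfl⟩
    exact hW.invariant X hX _ (hW.invariant X hX _ hw.1)
  · rintro Y hY _ ⟨w, hw, rfl⟩
    refine ⟨Y w, ⟨hW.invariant Y hY _ hw.1, (hmem _).2 (hperp Y hY w)⟩, ?_⟩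
    simp [hF.comm X hX Y hY]
  · rintro _ ⟨w, hw, rfl⟩ hne
    by_contra! hle
    obtain ⟨r, hr⟩ := hB.causal_parallel hn0 hn.le hle (hperp X hX _)
    have hr' : X (X w) = r • n := hr
    obtain ⟨s, hs⟩ := hB.causal_parallel (w := X w) hn0 hn.le
      (by rw [hF.skew X hX, hr', map_smul, hF.symm, (hmem w).1 hw.2]; simp) (hperp X hX w)
    apply hne
    simp [hs, hk X hX]

/-- The decomposition is applied to the zero family, which rotates no plane, so only killed lines
occur. -/
lemma exists_orthonormal_frame [FiniteDimensional ℝ V] (hs : ∀ v w, B v w = B w v)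
    (hpos : IsPosOn B W) : ∃ (k : ℕ) (f : Fin k → V),
      (∀ i j, B (f i) (f j) = if i = j then 1 else 0) ∧ Submodule.span ℝ (Set.range f) = W := by
  have hF : IsSkewFamily B ⊥ := ⟨hs, by rintro X rfl; simp, by rintro X rfl; simp⟩
  obtain ⟨l, k, e, f, h⟩ := exists_isRotationFrame hF (U := W) (by rintro X rfl; simp) hpos
  refine ⟨k, f, h.kernel_gram, ?_⟩
  have hl : IsEmpty (Fin 2 × Fin l) := ⟨fun q => by
    obtain ⟨X, rfl, hX⟩ := h.rotate_ne q.2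
    simp at hX⟩
  rw [← h.span_eq, Set.range_eq_empty (fun q : Fin 2 × Fin l => e q.1 q.2), Set.empty_union]

lemma eq_sum_of_orthonormal {κ : Type} [Fintype κ] [DecidableEq κ] {f : κ → V}
    (hf : ∀ i j, B (f i) (f j) = if i = j then 1 else 0) {v : V}
    (hv : v ∈ Submodule.span ℝ (Set.range f)) : v = ∑ i, B (f i) v • f i := by
  obtain ⟨c, rfl⟩ := Submodule.mem_span_range_iff_exists_fun ℝ |>.1 hv
  simp [map_sum, hf]

/-- Complete `n` to a hyperbolic pair `n`, `m` and take an orthonormal basis `f` of the complement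
`E` in `W`. Then `X (f i)` is a multiple `α i • n`, and skewness determines `X m`. No spacelike
vector of `W` is killed by the whole family, since its line would be invariant and positive
definite; this gives both `μ ≥ 1` and the common kernel `ℝ n`. -/
lemma IsLorentzCore.model_null [FiniteDimensional ℝ V] (hB : IsLorentzian B)
    (hF : IsSkewFamily B F) (hW : IsLorentzCore B F W) {n : V} (hnW : n ∈ W) (hn0 : n ≠ 0)
    (hn : B n n = 0) (hk : ∀ X ∈ F, X n = 0) :
    ∃ (μ : ℕ) (c : Unit ⊕ (Fin μ ⊕ Unit) → V), 1 ≤ μ ∧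
      IsModel B F W (metricC μ) (LinearMap.range (blockCLin μ)) (LinearMap.range (nullCLin μ)) c := by
  obtain ⟨m, hmW, hm, hnm⟩ : ∃ m ∈ W, B m m = 0 ∧ B n m = 1 := by
    obtain ⟨w, hwW, hw⟩ : ∃ w ∈ W, B n w ≠ 0 := by
      by_contra! hcon
      exact hn0 (hW.nondegenerate n hnW hcon)
    obtain ⟨u, huW, hu⟩ : ∃ u ∈ W, B n u = 1 := ⟨(B n w)⁻¹ • w, W.smul_mem _ hwW, by simp [hw]⟩
    refine ⟨u - (B u u / 2) • n, sub_mem huW (W.smul_mem _ hnW), ?_, ?_⟩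
    · simp [hn, hu, hF.symm u n]; ring
    · simp [hn, hu]
  have hmn : B m n = 1 := by rw [hF.symm, hnm]
  have hkill : ∀ v ∈ W, 0 < B v v → ∃ X ∈ F, X v ≠ 0 := by
    intro v hv hvv
    by_contra! hcon
    have hbot := hW.eq_bot (Submodule.span ℝ {v}) (by simpa using hv)
      (.span (by rintro X hX _ rfl; rw [hcon X hX]; exact zero_mem _)) ?_
    · rw [Submodule.span_singleton_eq_bot] at hbot
      simp [hbot] at hvv
    · intro y hy hy0
      obtain ⟨a, rfl⟩ := Submodule.mem_span_singleton.1 hy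
      have ha : a ≠ 0 := by rintro rfl; simp at hy0
      simp only [map_smul, LinearMap.smul_apply, smul_eq_mul]
      have := mul_self_pos.2 ha
      rw [← mul_assoc]
      positivity
  -- The vector `n + m` has square `2`, so it is not killed by the whole family, whereas `n` is.
  obtain ⟨X₁, hX₁, hX₁m⟩ : ∃ X ∈ F, X m ≠ 0 := by
    obtain ⟨X, hX, h⟩ := hkill (n + m) (add_mem hnW hmW) (by simp [hn, hm, hnm, hmn])
    exact ⟨X, hX, by simpa [hk X hX] using h⟩
  set E := W ⊓ B.orthogonal (Submodule.span ℝ {n, m}) with hE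
  have hEpos : IsPosOn B E := (hB.isPosOn_orthogonal_span_pair hn hm hnm).mono inf_le_right
  obtain ⟨μ, f, hf, hspan⟩ := exists_orthonormal_frame hF.symm hEpos
  have hfE : ∀ i, f i ∈ E := fun i => hspan ▸ Submodule.subset_span ⟨i, rfl⟩
  have hnf : ∀ i, B n (f i) = 0 := fun i => (mem_orthogonal_span_pair.1 (hfE i).2).1
  have hmf : ∀ i, B m (f i) = 0 := fun i => (mem_orthogonal_span_pair.1 (hfE i).2).2
  have hXm : ∀ X ∈ F, X m ∈ E := by
    intro X hX
    have h := sub_mem_orthogonal_span_pair hF.symm hn hm hnm hnW hmW (hW.invariant X hX m hmW)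
    have h2 := hF.skew X hX n m
    rw [hk X hX, map_zero, LinearMap.zero_apply, zero_eq_neg] at h2
    rwa [hF.symm, hF.apply_self hX, h2, zero_smul, zero_smul, sub_zero, sub_zero] at h
  have hact : ∀ X ∈ F, ∃ α : Fin μ → ℝ, (∀ i, X (f i) = α i • n) ∧ X m = ∑ i, -α i • f i := by
    intro X hX
    choose α hα using fun i =>
      hW.exists_eq_smul_of_orthogonal hB hF hn0 hn hk hX (hfE i).1 (hnf i)
    refine ⟨α, hα, ?_⟩
    refine (eq_sum_of_orthonormal hf (hspan ▸ hXm X hX)).trans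
      (Finset.sum_congr rfl fun i _ => ?_)
    have := hF.skew X hX (f i) m
    rw [hα, map_smul, LinearMap.smul_apply, hnm, smul_eq_mul, mul_one] at this
    rw [this, neg_neg]
  refine ⟨μ, Sum.elim (fun _ => n) (Sum.elim f (fun _ => m)), ?_, ?_, ?_, ?_, ?_⟩
  · by_contra hμ
    obtain rfl : μ = 0 := by omega
    obtain ⟨α, -, h⟩ := hact X₁ hX₁
    simp [h] at hX₁m
  · rintro (i | i | i) (j | j | j) <;>
      simp [metricC, hn, hm, hnm, hmn, hf, hnf, hmf, hF.symm (f _) n, hF.symm (f _) m,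
        Matrix.one_apply]
  · apply le_antisymm
    · rw [Submodule.span_le]
      rintro _ ⟨i | i | i, rfl⟩
      · exact hnW
      · exact (hfE i).1
      · exact hmW
    · intro v hv
      have h := sub_mem_orthogonal_span_pair hF.symm hn hm hnm hnW hmW hv
      have hle : E ≤ Submodule.span ℝ
          (Set.range (Sum.elim (fun _ : Unit => n) (Sum.elim f (fun _ : Unit => m)))) := by
        rw [← hspan]
        refine Submodule.span_mono ?_
        rintro _ ⟨i, rfl⟩
        exact ⟨.inr (.inl i), rfl⟩
      rw [sub_sub] at h
      rw [← sub_add_cancel v (B m v • n + B n v • m)]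
      exact add_mem (hle h) (add_mem
        (Submodule.smul_mem _ _ (Submodule.subset_span ⟨.inl (), rfl⟩))
        (Submodule.smul_mem _ _ (Submodule.subset_span ⟨.inr (.inr ()), rfl⟩)))
  · intro X hX
    obtain ⟨α, h1, h2⟩ := hact X hX
    refine ⟨blockC α, ⟨α, rfl⟩, ?_⟩
    rintro (j | j | j) <;> simp [blockC, h1, h2, hk X hX]
  · intro γ hγ
    set v := ∑ i, γ (.inr (.inl i)) • f i with hv
    have hvE : v ∈ E := sum_mem fun i _ => E.smul_mem _ (hfE i)
    have hsum : ∀ X ∈ F, X v = 0 ∧ γ (.inr (.inr ())) • X m = 0 := by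
      intro X hX
      have h := hγ X hX
      simp only [Fintype.sum_sum_type, Sum.elim_inl, Sum.elim_inr, Finset.univ_unique,
        Finset.sum_singleton, ← hv, map_add, map_smul, hk X hX, smul_zero, zero_add] at h
      obtain ⟨r, hr⟩ := hW.exists_eq_smul_of_orthogonal hB hF hn0 hn hk hX hvE.1
        (mem_orthogonal_span_pair.1 hvE.2).1
      -- Here `X v` is a multiple of `n`, and `X m` lies in `E`, orthogonal to `m`. Pairing with `m`
      -- isolates the multiple of `n` and separates the two terms.
      have h1 := congrArg (B m) h
      rw [hr] at h1 h
      simp [hmn, (mem_orthogonal_span_pair.1 (hXm X hX).2).2] at h1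
      subst h1
      exact ⟨by simpa using hr, by simpa using h⟩
    have hv0 : v = 0 := by
      by_contra h0
      obtain ⟨X, hX, h⟩ := hkill v hvE.1 (hEpos v hvE h0)
      exact h (hsum X hX).1
    have hγm : γ (.inr (.inr ())) = 0 := by simpa [hX₁m] using (hsum X₁ hX₁).2
    have hγf : ∀ i, γ (.inr (.inl i)) = 0 := by
      intro i
      have := congrArg (B (f i)) hv0
      simpa [hv, map_sum, hf] using this
    refine ⟨γ (.inl ()), ?_⟩
    ext (i | i | i) <;> simp [nullCLin, hγf, hγm]

end NullVector

/-! ### Linear parametrizations of the blocks. -/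

/-- The map `a ↦ diag(M₁, …, M_l, 0_k)` with the rotation blocks `M_i`. -/
def rotationLin (l k : ℕ) : (Fin l → ℝ) →ₗ[ℝ]
    Matrix ((Fin 2 × Fin l) ⊕ Fin k) ((Fin 2 × Fin l) ⊕ Fin k) ℝ where
  toFun a := fromBlocks (blockDiagonal fun i => !![0, a i; -a i, 0]) 0 0 0
  map_add' x y := by
    ext (⟨i, i'⟩ | i) (⟨j, j'⟩ | j) <;> simp [blockDiagonal_apply]
    fin_cases i <;> fin_cases j <;> simp <;> split_ifs <;> simp [add_comm]
  map_smul' x y := by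
    ext (⟨i, i'⟩ | i) (⟨j, j'⟩ | j) <;> simp [blockDiagonal_apply]
    fin_cases i <;> fin_cases j <;> simp

/-- The map `x ↦ (0, x)`. -/
def fixedLin (l k : ℕ) : (Fin k → ℝ) →ₗ[ℝ] ((Fin 2 × Fin l) ⊕ Fin k → ℝ) where
  toFun x := Sum.elim 0 x
  map_add' x y := by ext (i | i) <;> simp
  map_smul' x y := by ext (i | i) <;> simp

/-- The map `(M, M') ↦ diag(M, M')`. -/
def diagLin (β κ : Type) : (Matrix β β ℝ × Matrix κ κ ℝ) →ₗ[ℝ] Matrix (β ⊕ κ) (β ⊕ κ) ℝ where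
  toFun q := fromBlocks q.1 0 0 q.2
  map_add' x y := by simp [fromBlocks_add]
  map_smul' x y := by simp [fromBlocks_smul]

/-- The map that joins two columns. -/
def elimLin (β κ : Type) : ((β → ℝ) × (κ → ℝ)) →ₗ[ℝ] (β ⊕ κ → ℝ) where
  toFun q := Sum.elim q.1 q.2
  map_add' x y := by ext (i | i) <;> simp
  map_smul' x y := by ext (i | i) <;> simp

/-- The block diagonal matrices with blocks from `𝓜` and from the rotation matrices. -/
def blockLin {β : Type} (l k : ℕ) (𝓜 : Submodule ℝ (Matrix β β ℝ)) :
    Submodule ℝ (Matrix (BlockIndex β l k) (BlockIndex β l k) ℝ) :=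
  (𝓜.prod (LinearMap.range (rotationLin l k))).map (diagLin _ _)

/-- The columns `(γ, 0, x)` with `γ ∈ N`. -/
def blockTrans {β : Type} (l k : ℕ) (N : Submodule ℝ (β → ℝ)) :
    Submodule ℝ (BlockIndex β l k → ℝ) :=
  (N.prod (LinearMap.range (fixedLin l k))).map (elimLin _ _)

/-! ### Classification of commuting skew families on a Lorentzian space. -/

section Classification

variable {V : Type*} [AddCommGroup V] [Module ℝ V]
variable {B : LinearMap.BilinForm ℝ V} {F : Submodule ℝ (Module.End ℝ V)} {W U : Submodule ℝ V}

lemma IsModel.mem {β : Type} [Fintype β] {K₀ : Matrix β β ℝ} {𝓜 : Submodule ℝ (Matrix β β ℝ)}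
    {N : Submodule ℝ (β → ℝ)} {c : β → V} (h : IsModel B F W K₀ 𝓜 N c) (i : β) : c i ∈ W :=
  h.span_eq ▸ Submodule.subset_span ⟨i, rfl⟩

lemma IsRotationFrame.isModel (hF : IsSkewFamily B F) {l k : ℕ} {e : Fin 2 → Fin l → V}
    {f : Fin k → V} (h : IsRotationFrame B F U e f) :
    IsModel B F U 1 (LinearMap.range (rotationLin l k)) (LinearMap.range (fixedLin l k))
      (Sum.elim (fun q => e q.1 q.2) f) where
  gram := by
    rintro (⟨s, i⟩ | i) (⟨t, j⟩ | j) <;>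
      simp [h.plane_gram, h.plane_kernel, h.kernel_gram, hF.symm (f _), Matrix.one_apply]
  span_eq := by rw [Set.Sum.elim_range, h.span_eq]
  act X hX := by
    obtain ⟨a, ha⟩ := h.rotate X hX
    refine ⟨rotationLin l k a, ⟨a, rfl⟩, ?_⟩
    rintro (⟨s, j⟩ | j)
    · fin_cases s <;>
        simp [rotationLin, Fintype.sum_prod_type, blockDiagonal_apply, (ha j).1, (ha j).2,
          ite_smul]
    · simp [rotationLin, h.kernel X hX]
  kernel γ hγ := by
    have hzero : ∀ i, γ (.inl (0, i)) = 0 ∧ γ (.inl (1, i)) = 0 := by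
      intro i
      obtain ⟨X, hX, hne⟩ := h.rotate_ne i
      obtain ⟨a, ha⟩ := h.rotate X hX
      have hai : a i ≠ 0 := by
        intro h0
        simp [(ha i).1, h0] at hne
      have h1 := hγ X hX
      have h2 := congrArg (B (e 0 i)) h1
      have h3 := congrArg (B (e 1 i)) h1
      simp [map_sum, Fintype.sum_prod_type, h.kernel X hX, fun i => (ha i).1,
        fun i => (ha i).2, h.plane_gram, hai] at h2 h3
      exact ⟨h3, h2⟩
    refine ⟨fun j => γ (.inr j), ?_⟩
    ext (⟨s, i⟩ | i)
    · fin_cases s <;> simp [fixedLin, hzero]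
    · simp [fixedLin]

/-- Both summands are invariant and meet trivially, so a vector is killed exactly when its two
components are. The blocks of an operator may be correlated; only membership in the full product is
recorded. -/
lemma IsModel.sum {β κ : Type} [Fintype β] [Fintype κ] {K₀ : Matrix β β ℝ} {K₁ : Matrix κ κ ℝ}
    {𝓜 : Submodule ℝ (Matrix β β ℝ)} {𝓜' : Submodule ℝ (Matrix κ κ ℝ)}
    {N : Submodule ℝ (β → ℝ)} {N' : Submodule ℝ (κ → ℝ)} {c : β → V} {d : κ → V}
    (hs : ∀ v w, B v w = B w v) (hW : IsInvariant F W) (hU : IsInvariant F U)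
    (hdis : W ⊓ U = ⊥) (horth : ∀ w ∈ W, ∀ u ∈ U, B w u = 0)
    (hc : IsModel B F W K₀ 𝓜 N c) (hd : IsModel B F U K₁ 𝓜' N' d) :
    IsModel B F (W ⊔ U) (fromBlocks K₀ 0 0 K₁) ((𝓜.prod 𝓜').map (diagLin _ _))
      ((N.prod N').map (elimLin _ _)) (Sum.elim c d) where
  gram := by
    rintro (i | i) (j | j)
    · simp [hc.gram]
    · simp [horth _ (hc.mem i) _ (hd.mem j)]
    · simp [hs (d i), horth _ (hc.mem j) _ (hd.mem i)]
    · simp [hd.gram]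
  span_eq := by rw [Set.Sum.elim_range, Submodule.span_union, hc.span_eq, hd.span_eq]
  act X hX := by
    obtain ⟨M, hM, h1⟩ := hc.act X hX
    obtain ⟨M', hM', h2⟩ := hd.act X hX
    refine ⟨fromBlocks M 0 0 M', ⟨(M, M'), ⟨hM, hM'⟩, rfl⟩, ?_⟩
    rintro (j | j) <;> simp [h1, h2]
  kernel γ hγ := by
    have key : ∀ X ∈ F, X (∑ i, γ (.inl i) • c i) = 0 ∧ X (∑ i, γ (.inr i) • d i) = 0 := by
      intro X hX
      have h := hγ X hX
      simp only [Fintype.sum_sum_type, Sum.elim_inl, Sum.elim_inr, map_add X] at h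
      have h1 : X (∑ i, γ (.inl i) • c i) ∈ W :=
        hW X hX _ (sum_mem fun i _ => W.smul_mem _ (hc.mem i))
      have h2 : X (∑ i, γ (.inr i) • d i) ∈ U :=
        hU X hX _ (sum_mem fun i _ => U.smul_mem _ (hd.mem i))
      have h3 : X (∑ i, γ (.inl i) • c i) ∈ W ⊓ U :=
        ⟨h1, by rw [eq_neg_of_add_eq_zero_left h]; exact neg_mem h2⟩
      rw [hdis, Submodule.mem_bot] at h3
      exact ⟨h3, by simpa [h3] using h⟩
    refine ⟨(fun i => γ (.inl i), fun i => γ (.inr i)),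
      ⟨hc.kernel _ fun X hX => (key X hX).1, hd.kernel _ fun X hX => (key X hX).2⟩, ?_⟩
    ext (i | i) <;> simp [elimLin]

/-- Choose `U` maximal among the invariant positive definite subspaces. A positive definite
invariant subspace of the complement could be added to `U`, so it is zero; the complement itself is
nonzero because a timelike vector cannot lie in `U`. -/
lemma exists_isLorentzCore [FiniteDimensional ℝ V] (hB : IsLorentzian B) (hF : IsSkewFamily B F) :
    ∃ U, IsInvariant F U ∧ IsPosOn B U ∧ IsLorentzCore B F (B.orthogonal U) ∧
      B.orthogonal U ⊓ U = ⊥ ∧ B.orthogonal U ⊔ U = ⊤ := by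
  obtain ⟨U, ⟨hU, hpos⟩, hmax⟩ := WellFounded.has_min (wellFounded_gt (α := Submodule ℝ V))
    {U | IsInvariant F U ∧ IsPosOn B U} ⟨⊥, by rintro X - v hv; simp_all, by
      rintro v hv h0; simp_all⟩
  have hsup := sup_inf_orthogonal hF.symm hpos le_top
  rw [inf_top_eq, sup_comm] at hsup
  have horth : ∀ u ∈ U, ∀ w ∈ B.orthogonal U, B u w = 0 := fun u hu w hw =>
    LinearMap.BilinForm.mem_orthogonal_iff.1 hw u hu
  have hinf : B.orthogonal U ⊓ U = ⊥ := by
    rw [eq_bot_iff]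
    rintro v ⟨h1, h2⟩
    by_contra h0
    exact (hpos v h2 h0).ne' (horth v h2 v h1)
  obtain ⟨t, ht, htpos⟩ := hB.2
  refine ⟨U, hU, hpos, ⟨?_, hU.orthogonal hF, ?_, ?_⟩, hinf, hsup⟩
  · intro h
    rw [h, bot_sup_eq] at hsup
    have := hpos t (hsup ▸ trivial) (by rintro rfl; simp at ht)
    linarith
  · intro v hv h
    by_contra h0
    have hall : ∀ w, B v w = 0 := by
      intro w
      have hw : w ∈ B.orthogonal U ⊔ U := hsup ▸ trivial
      obtain ⟨a, ha, b, hb, rfl⟩ := Submodule.mem_sup.1 hw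
      rw [map_add, h a ha, hF.symm v b, horth b hb v hv, add_zero]
    exact (htpos v (by rw [hF.symm, hall]) h0).ne' (hall v)
  · intro M hMW hM hMpos
    by_contra h0
    refine hmax (U ⊔ M) ⟨hU.sup hM, ?_⟩ (lt_of_le_of_ne le_sup_left fun h => h0 ?_)
    · intro v hv hv0
      obtain ⟨a, ha, b, hb, rfl⟩ := Submodule.mem_sup.1 hv
      have hab := horth a ha b (hMW hb)
      have e : B (a + b) (a + b) = B a a + B b b := by
        simp [hab, hF.symm b a]
      rw [e]
      by_cases ha0 : a = 0
      · subst ha0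
        simpa using hMpos b hb (by simpa using hv0)
      · by_cases hb0 : b = 0
        · subst hb0
          simpa using hpos a ha ha0
        · exact add_pos (hpos a ha ha0) (hMpos b hb hb0)
    · rw [eq_bot_iff, ← hinf]
      exact le_inf hMW (h ▸ le_sup_right)

/-- A commuting skew family on a Lorentzian space has one of three models. -/
theorem exists_isModel [FiniteDimensional ℝ V] (hB : IsLorentzian B) (hF : IsSkewFamily B F) :
    ∃ l k : ℕ,
      (∃ c, IsModel B F ⊤ (blockMetric l k metricA) (blockLin l k ⊥) (blockTrans l k ⊤) c) ∨
      (∃ c, IsModel B F ⊤ (blockMetric l k metricB) (blockLin l k (LinearMap.range blockBLin))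
        (blockTrans l k ⊥) c) ∨
      ∃ (μ : ℕ) (c : _), 1 ≤ μ ∧ IsModel B F ⊤ (blockMetric l k (metricC μ))
        (blockLin l k (LinearMap.range (blockCLin μ)))
        (blockTrans l k (LinearMap.range (nullCLin μ))) c := by
  obtain ⟨U, hU, hpos, hW, hinf, hsup⟩ := exists_isLorentzCore hB hF
  obtain ⟨l, k, e, f, hrot⟩ := exists_isRotationFrame hF hU hpos
  have horth : ∀ w ∈ B.orthogonal U, ∀ u ∈ U, B w u = 0 := fun w hw u hu => by
    rw [hF.symm]; exact LinearMap.BilinForm.mem_orthogonal_iff.1 hw u hu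
  have hsum : ∀ {β : Type} [Fintype β] {K₀ : Matrix β β ℝ} {𝓜 : Submodule ℝ (Matrix β β ℝ)}
      {N : Submodule ℝ (β → ℝ)} {c : β → V}, IsModel B F (B.orthogonal U) K₀ 𝓜 N c →
      IsModel B F ⊤ (blockMetric l k K₀) (blockLin l k 𝓜) (blockTrans l k N)
        (Sum.elim c (Sum.elim (fun q => e q.1 q.2) f)) := fun h =>
    hsup ▸ h.sum hF.symm hW.invariant hU hinf horth (hrot.isModel hF)
  refine ⟨l, k, ?_⟩
  rcases hW.timelike_or_null hB hF with ⟨t, ht, htt, hk⟩ | ⟨n, hnW, hn0, hn, hk⟩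
  · obtain ⟨c, hc⟩ := hW.model_timelike hB hF ht htt hk
    exact .inl ⟨_, hsum hc⟩
  · by_cases hne : ∃ X ∈ F, X n ≠ 0
    · obtain ⟨c, hc⟩ := hW.model_boost hB hF hnW hn0 hn hk hne
      exact .inr (.inl ⟨_, hsum hc⟩)
    · push Not at hne
      obtain ⟨μ, c, hμ, hc⟩ := hW.model_null hB hF hnW hn0 hn hne
      exact .inr (.inr ⟨μ, _, hμ, hsum hc⟩)

end Classification

/-! ### Affine conjugation. -/

section Affine

variable {ι κ ν : Type}

lemma affineMatrix_inj {X Y : Matrix ι ι ℝ} {v w : ι → ℝ}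
    (h : affineMatrix X v = affineMatrix Y w) : X = Y ∧ v = w := by
  obtain ⟨h1, h2, -⟩ := fromBlocks_inj.1 h
  exact ⟨h1, funext fun i => congrFun (congrFun h2 i) ()⟩

lemma affineMatrix_add (X Y : Matrix ι ι ℝ) (v w : ι → ℝ) :
    affineMatrix X v + affineMatrix Y w = affineMatrix (X + Y) (v + w) := by
  simp [affineMatrix, fromBlocks_add, replicateCol_add]

lemma affineMatrix_smul (c : ℝ) (X : Matrix ι ι ℝ) (v : ι → ℝ) :
    c • affineMatrix X v = affineMatrix (c • X) (c • v) := by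
  simp [affineMatrix, fromBlocks_smul, replicateCol_smul]

lemma affineMatrix_zero : affineMatrix (0 : Matrix ι ι ℝ) 0 = 0 := by
  simp [affineMatrix]

lemma affineMatrix_lie [Fintype ι] [DecidableEq ι] (X Y : Matrix ι ι ℝ) (v w : ι → ℝ) :
    ⁅affineMatrix X v, affineMatrix Y w⁆ = affineMatrix (X * Y - Y * X) (X *ᵥ w - Y *ᵥ v) := by
  rw [Ring.lie_def]
  ext (i | i) (j | j) <;>
    simp [affineMatrix, fromBlocks_multiply, Matrix.mul_apply, mulVec, dotProduct]

/-- The matrix of the affine map `x ↦ G x + a`. -/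
def affineMap (G : Matrix κ ι ℝ) (a : κ → ℝ) : Matrix (κ ⊕ Unit) (ι ⊕ Unit) ℝ :=
  fromBlocks G (replicateCol Unit a) 0 1

lemma affineMap_mul [Fintype κ] (G : Matrix ν κ ℝ) (a : ν → ℝ) (Q : Matrix κ ι ℝ) (b : κ → ℝ) :
    affineMap G a * affineMap Q b = affineMap (G * Q) (G *ᵥ b + a) := by
  ext (i | i) (j | j) <;>
    simp [affineMap, Matrix.mul_apply, mulVec, dotProduct]

lemma affineMap_one [DecidableEq ι] : affineMap (1 : Matrix ι ι ℝ) 0 = 1 := by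
  ext (i | i) (j | j) <;> simp [affineMap, Matrix.one_apply]

lemma affineMap_conj [Fintype ι] (G : Matrix κ ι ℝ) (a : κ → ℝ) (Q : Matrix ι κ ℝ) (b : ι → ℝ)
    (X : Matrix ι ι ℝ) (v : ι → ℝ) :
    affineMap G a * affineMatrix X v * affineMap Q b =
      affineMatrix (G * X * Q) (G *ᵥ (X *ᵥ b + v)) := by
  have h1 : affineMap G a * affineMatrix X v =
      fromBlocks (G * X) (replicateCol Unit (G *ᵥ v)) 0 0 := by
    ext (i | i) (j | j) <;>
      simp [affineMap, affineMatrix, Matrix.mul_apply, mulVec, dotProduct]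
  rw [h1, mulVec_add, mulVec_mulVec]
  ext (i | i) (j | j) <;>
    simp [affineMap, affineMatrix, Matrix.mul_apply, mulVec, dotProduct]

variable [Fintype ι] [DecidableEq ι] [Fintype κ] [DecidableEq κ] [Fintype ν] [DecidableEq ν]

/-- `G` is an invertible map with inverse `Q` that carries the metric `K` to `K'`. -/
structure IsIsometry (K : Matrix ι ι ℝ) (K' : Matrix κ κ ℝ) (G : Matrix κ ι ℝ)
    (Q : Matrix ι κ ℝ) : Prop where
  map : G * K * Gᵀ = K'
  left_inv : Q * G = 1
  right_inv : G * Q = 1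

lemma IsIsometry.symm {K : Matrix ι ι ℝ} {K' : Matrix κ κ ℝ} {G : Matrix κ ι ℝ}
    {Q : Matrix ι κ ℝ} (h : IsIsometry K K' G Q) : IsIsometry K' K Q G where
  map := by
    rw [← h.map]
    calc Q * (G * K * Gᵀ) * Qᵀ = (Q * G) * K * (Gᵀ * Qᵀ) := by simp only [Matrix.mul_assoc]
      _ = K := by rw [← transpose_mul, h.left_inv]; simp
  left_inv := h.right_inv
  right_inv := h.left_inv

lemma IsIsometry.mul {K : Matrix ι ι ℝ} {K' : Matrix κ κ ℝ} {K'' : Matrix ν ν ℝ}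
    {G : Matrix κ ι ℝ} {Q : Matrix ι κ ℝ} {G' : Matrix ν κ ℝ} {Q' : Matrix κ ν ℝ}
    (h : IsIsometry K K' G Q) (h' : IsIsometry K' K'' G' Q') :
    IsIsometry K K'' (G' * G) (Q * Q') where
  map := by
    rw [← h'.map, ← h.map, transpose_mul]
    simp only [Matrix.mul_assoc]
  left_inv := by
    rw [Matrix.mul_assoc, ← Matrix.mul_assoc Q', h'.left_inv, Matrix.one_mul, h.left_inv]
  right_inv := by
    rw [Matrix.mul_assoc, ← Matrix.mul_assoc G, h.right_inv, Matrix.one_mul, h'.right_inv]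

lemma IsIsometry.conj_mem {K : Matrix ι ι ℝ} {K' : Matrix κ κ ℝ} {G : Matrix κ ι ℝ}
    {Q : Matrix ι κ ℝ} (h : IsIsometry K K' G Q) {X : Matrix ι ι ℝ}
    (hX : X ∈ pseudoOrthogonal K) : G * X * Q ∈ pseudoOrthogonal K' := by
  have hX' : X * K + K * Xᵀ = 0 := hX
  change G * X * Q * K' + K' * (G * X * Q)ᵀ = 0
  have e1 : G * X * Q * K' = G * (X * K) * Gᵀ := by
    rw [← h.map]
    calc G * X * Q * (G * K * Gᵀ) = G * X * (Q * G) * K * Gᵀ := by simp only [Matrix.mul_assoc]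
      _ = _ := by rw [h.left_inv]; simp only [Matrix.mul_assoc, Matrix.one_mul]
  have e2 : K' * (G * X * Q)ᵀ = G * (K * Xᵀ) * Gᵀ := by
    rw [← h.map]
    calc G * K * Gᵀ * (G * X * Q)ᵀ = G * K * (Gᵀ * Qᵀ) * Xᵀ * Gᵀ := by
          simp only [transpose_mul, Matrix.mul_assoc]
      _ = _ := by
          rw [← transpose_mul, h.left_inv, transpose_one]
          simp only [Matrix.mul_assoc, Matrix.one_mul]
  rw [e1, e2, ← Matrix.add_mul, ← Matrix.mul_add, hX', Matrix.mul_zero, Matrix.zero_mul]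

/-- The bottom row `(0, 1)` of `H` forces the same bottom row on its inverse, which is thus the
affine map with linear part `Q` and translation `-Q a`. -/
lemma conjugate_iff {K : Matrix ι ι ℝ} {S : Set (Matrix (ι ⊕ Unit) (ι ⊕ Unit) ℝ)}
    {K' : Matrix κ κ ℝ} {S' : Set (Matrix (κ ⊕ Unit) (κ ⊕ Unit) ℝ)} :
    Conjugate K S K' S' ↔ ∃ G Q a, IsIsometry K K' G Q ∧
      S' = (fun Y => affineMap G a * Y * affineMap Q (-(Q *ᵥ a))) '' S := by
  constructor
  · rintro ⟨G, a, H, Hinv, hG, rfl, h1, h2, rfl⟩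
    obtain ⟨Q, b, c, d, rfl⟩ : ∃ Q b c d, Hinv = fromBlocks Q b c d :=
      ⟨_, _, _, _, (fromBlocks_toBlocks Hinv).symm⟩
    rw [fromBlocks_multiply, ← fromBlocks_one, fromBlocks_inj] at h1 h2
    obtain ⟨h11, h12, h13, h14⟩ := h1
    simp only [Matrix.zero_mul, Matrix.one_mul, zero_add] at h13 h14
    subst h13 h14
    simp only [Matrix.mul_zero, add_zero, Matrix.mul_one] at h11 h12 h2
    refine ⟨G, Q, a, ⟨hG, h2.1, h11⟩, ?_⟩
    have hb : b = replicateCol Unit (-(Q *ᵥ a)) := by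
      rw [eq_neg_of_add_eq_zero_right h2.2.1]
      ext i j
      simp [Matrix.mul_apply, mulVec, dotProduct]
    rw [hb]
    rfl
  · rintro ⟨G, Q, a, h, rfl⟩
    refine ⟨G, a, affineMap G a, affineMap Q (-(Q *ᵥ a)), h.map, rfl, ?_, ?_, rfl⟩
    · rw [affineMap_mul, h.right_inv, mulVec_neg, mulVec_mulVec, h.right_inv, one_mulVec,
        neg_add_cancel, affineMap_one]
    · rw [affineMap_mul, h.left_inv, add_neg_cancel, affineMap_one]

lemma IsIsometry.conjugate {K : Matrix ι ι ℝ} {K' : Matrix κ κ ℝ} {G : Matrix κ ι ℝ}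
    {Q : Matrix ι κ ℝ} (h : IsIsometry K K' G Q) (S : Set (Matrix (ι ⊕ Unit) (ι ⊕ Unit) ℝ)) :
    Conjugate K S K' ((fun Y => affineMap G 0 * Y * affineMap Q 0) '' S) :=
  conjugate_iff.2 ⟨G, Q, 0, h, by simp⟩

lemma affineMap_inverse {K : Matrix ι ι ℝ} {K' : Matrix κ κ ℝ} {G : Matrix κ ι ℝ}
    {Q : Matrix ι κ ℝ} (h : IsIsometry K K' G Q) (a : κ → ℝ) :
    affineMap Q (-(Q *ᵥ a)) * affineMap G a = 1 := by
  rw [affineMap_mul, h.left_inv, add_neg_cancel, affineMap_one]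

lemma affineMap_inverse' {K : Matrix ι ι ℝ} {K' : Matrix κ κ ℝ} {G : Matrix κ ι ℝ}
    {Q : Matrix ι κ ℝ} (h : IsIsometry K K' G Q) (a : κ → ℝ) :
    affineMap G a * affineMap Q (-(Q *ᵥ a)) = 1 := by
  rw [affineMap_mul, h.right_inv, mulVec_neg, mulVec_mulVec, h.right_inv, one_mulVec,
    neg_add_cancel, affineMap_one]

lemma Conjugate.symm {K : Matrix ι ι ℝ} {S : Set (Matrix (ι ⊕ Unit) (ι ⊕ Unit) ℝ)}
    {K' : Matrix κ κ ℝ} {S' : Set (Matrix (κ ⊕ Unit) (κ ⊕ Unit) ℝ)}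
    (h : Conjugate K S K' S') : Conjugate K' S' K S := by
  obtain ⟨G, Q, a, hG, rfl⟩ := conjugate_iff.1 h
  refine ⟨Q, -(Q *ᵥ a), affineMap Q (-(Q *ᵥ a)), affineMap G a, hG.symm.map, rfl,
    affineMap_inverse hG a, affineMap_inverse' hG a, ?_⟩
  rw [Set.image_image]
  have : ∀ Y : Matrix (ι ⊕ Unit) (ι ⊕ Unit) ℝ, affineMap Q (-(Q *ᵥ a)) *
      (affineMap G a * Y * affineMap Q (-(Q *ᵥ a))) * affineMap G a = Y := by
    intro Y
    calc _ = (affineMap Q (-(Q *ᵥ a)) * affineMap G a) * Y *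
          (affineMap Q (-(Q *ᵥ a)) * affineMap G a) := by simp only [Matrix.mul_assoc]
      _ = Y := by rw [affineMap_inverse hG]; simp
  simp [this]

lemma Conjugate.trans {K : Matrix ι ι ℝ} {S : Set (Matrix (ι ⊕ Unit) (ι ⊕ Unit) ℝ)}
    {K' : Matrix κ κ ℝ} {S' : Set (Matrix (κ ⊕ Unit) (κ ⊕ Unit) ℝ)}
    {K'' : Matrix ν ν ℝ} {S'' : Set (Matrix (ν ⊕ Unit) (ν ⊕ Unit) ℝ)}
    (h : Conjugate K S K' S') (h' : Conjugate K' S' K'' S'') : Conjugate K S K'' S'' := by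
  obtain ⟨G, Q, a, hG, rfl⟩ := conjugate_iff.1 h
  obtain ⟨G', Q', a', hG', rfl⟩ := conjugate_iff.1 h'
  refine ⟨G' * G, G' *ᵥ a + a', affineMap G' a' * affineMap G a,
    affineMap Q (-(Q *ᵥ a)) * affineMap Q' (-(Q' *ᵥ a')), (hG.mul hG').map, affineMap_mul .., ?_, ?_,
    ?_⟩
  · rw [Matrix.mul_assoc, ← Matrix.mul_assoc (affineMap G a), affineMap_inverse' hG,
      Matrix.one_mul, affineMap_inverse' hG']
  · rw [Matrix.mul_assoc, ← Matrix.mul_assoc (affineMap Q' _), affineMap_inverse hG',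
      Matrix.one_mul, affineMap_inverse hG]
  · rw [Set.image_image]
    simp only [Matrix.mul_assoc]

/-- Conjugation by an affine map as an isomorphism of Lie algebras. -/
def conjEquiv (H : Matrix (κ ⊕ Unit) (ι ⊕ Unit) ℝ) (Hinv : Matrix (ι ⊕ Unit) (κ ⊕ Unit) ℝ)
    (h : H * Hinv = 1) (h' : Hinv * H = 1) :
    Matrix (ι ⊕ Unit) (ι ⊕ Unit) ℝ ≃ₗ⁅ℝ⁆ Matrix (κ ⊕ Unit) (κ ⊕ Unit) ℝ where
  toFun Y := H * Y * Hinv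
  invFun Y := Hinv * Y * H
  map_add' X Y := by rw [Matrix.mul_add, Matrix.add_mul]
  map_smul' c X := by simp
  map_lie' := by
    intro X Y
    have key : ∀ X Y : Matrix (ι ⊕ Unit) (ι ⊕ Unit) ℝ,
        H * X * Hinv * (H * Y * Hinv) = H * (X * Y) * Hinv := by
      intro X Y
      calc _ = H * X * (Hinv * H) * Y * Hinv := by simp only [Matrix.mul_assoc]
        _ = _ := by rw [h']; simp only [Matrix.mul_assoc, Matrix.one_mul]
    simp only [Ring.lie_def, key, Matrix.mul_sub, Matrix.sub_mul]
  left_inv Y := by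
    calc _ = (Hinv * H) * Y * (Hinv * H) := by simp only [Matrix.mul_assoc]
      _ = Y := by rw [h']; simp
  right_inv Y := by
    calc _ = (H * Hinv) * Y * (H * Hinv) := by simp only [Matrix.mul_assoc]
      _ = Y := by rw [h]; simp

/-- A conjugation is an isomorphism of Lie algebras that is linear on the translations. -/
lemma Conjugate.exists_equiv {K : Matrix ι ι ℝ} {S : Set (Matrix (ι ⊕ Unit) (ι ⊕ Unit) ℝ)}
    {K' : Matrix κ κ ℝ} {S' : Set (Matrix (κ ⊕ Unit) (κ ⊕ Unit) ℝ)}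
    (h : Conjugate K S K' S') :
    ∃ (Φ : Matrix (ι ⊕ Unit) (ι ⊕ Unit) ℝ ≃ₗ⁅ℝ⁆ Matrix (κ ⊕ Unit) (κ ⊕ Unit) ℝ)
      (G : Matrix κ ι ℝ) (Q : Matrix ι κ ℝ), IsIsometry K K' G Q ∧ S' = Φ '' S ∧
      (∀ Y, Φ Y ∈ pseudoEuclidean K' ↔ Y ∈ pseudoEuclidean K) ∧
      ∀ v, Φ (affineMatrix 0 v) = affineMatrix 0 (G *ᵥ v) := by
  obtain ⟨G, Q, a, hG, rfl⟩ := conjugate_iff.1 h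
  refine ⟨conjEquiv _ _ (affineMap_inverse' hG a) (affineMap_inverse hG a), G, Q, hG, rfl,
    fun Y => ⟨?_, ?_⟩, fun v => ?_⟩
  · rintro ⟨X, hX, v, hY⟩
    refine ⟨Q * X * G, hG.symm.conj_mem hX, Q *ᵥ (X *ᵥ a + v), ?_⟩
    rw [← affineMap_conj Q (-(Q *ᵥ a)), ← hY]
    exact ((conjEquiv _ _ (affineMap_inverse' hG a) (affineMap_inverse hG a)).left_inv Y).symm
  · rintro ⟨X, hX, v, rfl⟩
    exact ⟨_, hG.conj_mem hX, _, affineMap_conj ..⟩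
  · refine (affineMap_conj G a Q _ 0 v).trans ?_
    simp

lemma Conjugate.isMASA {K : Matrix ι ι ℝ} {L : LieSubalgebra ℝ (Matrix (ι ⊕ Unit) (ι ⊕ Unit) ℝ)}
    {K' : Matrix κ κ ℝ} {L' : LieSubalgebra ℝ (Matrix (κ ⊕ Unit) (κ ⊕ Unit) ℝ)}
    (h : Conjugate K (L : Set _) K' (L' : Set _)) (hL : IsMASA (pseudoEuclidean K) L) :
    IsMASA (pseudoEuclidean K') L' := by
  obtain ⟨Φ, G, Q, -, hS, hE, -⟩ := h.exists_equiv
  have hmem : ∀ Y, Y ∈ L' ↔ ∃ Z ∈ L, Φ Z = Y := by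
    intro Y
    rw [← SetLike.mem_coe, hS]; rfl
  refine ⟨fun Y hY => ?_, fun Y hY Z hZ => ?_, fun Y hY hc => ?_⟩
  · obtain ⟨Z, hZ, rfl⟩ := (hmem Y).1 hY
    exact (hE Z).2 (hL.1 hZ)
  · obtain ⟨Y', hY', rfl⟩ := (hmem Y).1 hY
    obtain ⟨Z', hZ', rfl⟩ := (hmem Z).1 hZ
    rw [← LieEquiv.map_lie, hL.2.1 Y' hY' Z' hZ', map_zero]
  · obtain ⟨Y, rfl⟩ : ∃ Y', Φ Y' = Y := Φ.surjective Y
    refine (hmem _).2 ⟨Y, hL.2.2 Y ((hE Y).1 hY) fun Z hZ => ?_, rfl⟩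
    have := hc (Φ Z) ((hmem _).2 ⟨Z, hZ, rfl⟩)
    rw [← LieEquiv.map_lie] at this
    exact Φ.injective (this.trans (map_zero Φ).symm)

end Affine

/-! ### Splitting MASAs as pairs of linear parts and translations. -/

section SplitPair

variable {ι κ : Type}

/-- The matrices with linear part in `𝓜` and translation part in `N`. -/
def splitSet (𝓜 : Submodule ℝ (Matrix ι ι ℝ)) (N : Submodule ℝ (ι → ℝ)) :
    Set (Matrix (ι ⊕ Unit) (ι ⊕ Unit) ℝ) :=
  {Y | ∃ X ∈ 𝓜, ∃ v ∈ N, Y = affineMatrix X v}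

lemma affineMatrix_mem_splitSet {𝓜 : Submodule ℝ (Matrix ι ι ℝ)} {N : Submodule ℝ (ι → ℝ)}
    {X : Matrix ι ι ℝ} {v : ι → ℝ} : affineMatrix X v ∈ splitSet 𝓜 N ↔ X ∈ 𝓜 ∧ v ∈ N := by
  constructor
  · rintro ⟨Y, hY, w, hw, h⟩
    obtain ⟨rfl, rfl⟩ := affineMatrix_inj h
    exact ⟨hY, hw⟩
  · rintro ⟨h1, h2⟩
    exact ⟨X, h1, v, h2, rfl⟩

variable [Fintype ι] [DecidableEq ι]

/-- The data `𝓜 ⊆ o(K)` and `N` of a splitting MASA of `e(K)`: `N` is the common kernel of the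
abelian space `𝓜`, and `𝓜` is its own centralizer among the elements of `o(K)` that annihilate
`N`. -/
structure IsSplitPair (K : Matrix ι ι ℝ) (𝓜 : Submodule ℝ (Matrix ι ι ℝ))
    (N : Submodule ℝ (ι → ℝ)) : Prop where
  skew : ∀ X ∈ 𝓜, X ∈ pseudoOrthogonal K
  comm : ∀ X ∈ 𝓜, ∀ Y ∈ 𝓜, X * Y = Y * X
  mem_iff : ∀ v, v ∈ N ↔ ∀ X ∈ 𝓜, X *ᵥ v = 0
  maximal : ∀ X ∈ pseudoOrthogonal K, (∀ v ∈ N, X *ᵥ v = 0) → (∀ Y ∈ 𝓜, X * Y = Y * X) → X ∈ 𝓜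

/-- The abelian Lie algebra `splitSet 𝓜 N`. -/
def splitAlgebra (𝓜 : Submodule ℝ (Matrix ι ι ℝ)) (N : Submodule ℝ (ι → ℝ))
    (hc : ∀ X ∈ 𝓜, ∀ Y ∈ 𝓜, X * Y = Y * X) (hk : ∀ v ∈ N, ∀ X ∈ 𝓜, X *ᵥ v = 0) :
    LieSubalgebra ℝ (Matrix (ι ⊕ Unit) (ι ⊕ Unit) ℝ) where
  carrier := splitSet 𝓜 N
  zero_mem' := ⟨0, zero_mem _, 0, zero_mem _, affineMatrix_zero.symm⟩
  add_mem' := by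
    rintro _ _ ⟨X, hX, v, hv, rfl⟩ ⟨Y, hY, w, hw, rfl⟩
    exact ⟨_, add_mem hX hY, _, add_mem hv hw, affineMatrix_add ..⟩
  smul_mem' := by
    rintro c _ ⟨X, hX, v, hv, rfl⟩
    exact ⟨_, 𝓜.smul_mem c hX, _, N.smul_mem c hv, affineMatrix_smul ..⟩
  lie_mem' := by
    rintro _ _ ⟨X, hX, v, hv, rfl⟩ ⟨Y, hY, w, hw, rfl⟩
    rw [affineMatrix_lie, hc X hX Y hY, hk w hw X hX, hk v hv Y hY, sub_self, sub_self]
    exact ⟨0, zero_mem _, 0, zero_mem _, rfl⟩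

/-- The bracket of `(X, v)` and `(Y, w)` is `([X, Y], X w - Y v)`. As a split set contains `(X, 0)`
and `(0, v)` separately, commutation decouples: testing translations characterizes the common
kernel, testing linear elements the centralizer. -/
lemma isMASA_iff_isSplitPair {K : Matrix ι ι ℝ} {𝓜 : Submodule ℝ (Matrix ι ι ℝ)}
    {N : Submodule ℝ (ι → ℝ)} {L : LieSubalgebra ℝ (Matrix (ι ⊕ Unit) (ι ⊕ Unit) ℝ)}
    (hL : (L : Set (Matrix (ι ⊕ Unit) (ι ⊕ Unit) ℝ)) = splitSet 𝓜 N) :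
    IsMASA (pseudoEuclidean K) L ↔ IsSplitPair K 𝓜 N := by
  have hmem : ∀ Y, Y ∈ L ↔ Y ∈ splitSet 𝓜 N := fun Y => by rw [← hL]; rfl
  have hmem' : ∀ X v, affineMatrix X v ∈ L ↔ X ∈ 𝓜 ∧ v ∈ N := fun X v => by
    rw [hmem, affineMatrix_mem_splitSet]
  constructor
  · rintro ⟨hle, hab, hmax⟩
    have hbr : ∀ X ∈ 𝓜, ∀ Y ∈ 𝓜, ∀ v ∈ N, ∀ w ∈ N, X * Y = Y * X ∧ X *ᵥ w = Y *ᵥ v := by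
      intro X hX Y hY v hv w hw
      have := hab _ ((hmem' X v).2 ⟨hX, hv⟩) _ ((hmem' Y w).2 ⟨hY, hw⟩)
      rw [affineMatrix_lie, ← affineMatrix_zero] at this
      obtain ⟨h1, h2⟩ := affineMatrix_inj this
      exact ⟨sub_eq_zero.1 h1, sub_eq_zero.1 h2⟩
    have hkill : ∀ X ∈ 𝓜, ∀ v ∈ N, X *ᵥ v = 0 := fun X hX v hv => by
      rw [(hbr X hX 0 (zero_mem _) v hv v hv).2, zero_mulVec]
    refine ⟨fun X hX => ?_, fun X hX Y hY => (hbr X hX Y hY 0 (zero_mem _) 0 (zero_mem _)).1,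
      fun v => ⟨fun hv X hX => hkill X hX v hv, fun h => ?_⟩, fun X hX hXN hXc => ?_⟩
    · obtain ⟨X', hX', v, h⟩ := hle ((hmem' X 0).2 ⟨hX, zero_mem _⟩)
      rwa [(affineMatrix_inj h).1]
    · refine ((hmem' 0 v).1 (hmax _ ⟨0, zero_mem _, v, rfl⟩ fun Z hZ => ?_)).2
      obtain ⟨X, hX, w, hw, rfl⟩ := (hmem Z).1 hZ
      rw [affineMatrix_lie, h X hX, zero_mulVec, sub_zero, Matrix.zero_mul, Matrix.mul_zero,
        sub_zero, affineMatrix_zero]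
    · refine ((hmem' X 0).1 (hmax _ ⟨X, hX, 0, rfl⟩ fun Z hZ => ?_)).1
      obtain ⟨Y, hY, w, hw, rfl⟩ := (hmem Z).1 hZ
      rw [affineMatrix_lie, hXN w hw, mulVec_zero, sub_zero, hXc Y hY, sub_self, affineMatrix_zero]
  · intro h
    refine ⟨fun Y hY => ?_, fun Y hY Z hZ => ?_, fun Y hY hc => ?_⟩
    · obtain ⟨X, hX, v, -, rfl⟩ := (hmem Y).1 hY
      exact ⟨X, h.skew X hX, v, rfl⟩
    · obtain ⟨X, hX, v, hv, rfl⟩ := (hmem Y).1 hY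
      obtain ⟨X', hX', w, hw, rfl⟩ := (hmem Z).1 hZ
      rw [affineMatrix_lie, h.comm X hX X' hX', (h.mem_iff w).1 hw X hX,
        (h.mem_iff v).1 hv X' hX', sub_self, sub_self, affineMatrix_zero]
    · obtain ⟨X, hX, v, rfl⟩ := hY
      have key : ∀ X' ∈ 𝓜, ∀ w ∈ N, X * X' = X' * X ∧ X *ᵥ w = X' *ᵥ v := by
        intro X' hX' w hw
        have := hc _ ((hmem' X' w).2 ⟨hX', hw⟩)
        rw [affineMatrix_lie, ← affineMatrix_zero] at this
        obtain ⟨h1, h2⟩ := affineMatrix_inj this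
        exact ⟨sub_eq_zero.1 h1, sub_eq_zero.1 h2⟩
      refine (hmem' X v).2 ⟨h.maximal X hX (fun w hw => ?_) fun Y hY =>
        (key Y hY 0 (zero_mem _)).1, (h.mem_iff v).2 fun Y hY => ?_⟩
      · rw [(key 0 (zero_mem _) w hw).2, zero_mulVec]
      · rw [← (key Y hY 0 (zero_mem _)).2, mulVec_zero]

/-- A splitting algebra is conjugate to a split set. -/
lemma IsSplitting.exists_splitSet {K : Matrix ι ι ℝ}
    {L : LieSubalgebra ℝ (Matrix (ι ⊕ Unit) (ι ⊕ Unit) ℝ)} (h : IsSplitting K L) :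
    ∃ (L' : LieSubalgebra ℝ (Matrix (ι ⊕ Unit) (ι ⊕ Unit) ℝ)) (𝓜 : Submodule ℝ (Matrix ι ι ℝ))
      (N : Submodule ℝ (ι → ℝ)), Conjugate K (L : Set _) K (L' : Set _) ∧
      (L' : Set _) = splitSet 𝓜 N := by
  obtain ⟨L', F, N, hconj, hF, hN, hsum⟩ := h
  refine ⟨L', ⟨⟨⟨{X | affineMatrix X 0 ∈ F}, ?_⟩, ?_⟩, ?_⟩, translationSpace N, hconj, ?_⟩
  · intro X Y hX hY
    have := F.add_mem hX hY
    rwa [affineMatrix_add, add_zero] at this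
  · change affineMatrix 0 0 ∈ F
    rw [affineMatrix_zero]; exact zero_mem _
  · intro c X hX
    have := F.smul_mem c hX
    rwa [affineMatrix_smul, smul_zero] at this
  · ext Y
    have : Y ∈ L' ↔ Y ∈ F.toSubmodule ⊔ N.toSubmodule := by rw [← hsum]; rfl
    rw [SetLike.mem_coe, this, Submodule.mem_sup]
    constructor
    · rintro ⟨A, hA, T, hT, rfl⟩
      obtain ⟨X, -, rfl⟩ := hF A hA
      obtain ⟨v, rfl⟩ := hN T hT
      exact ⟨X, hA, v, hT, by rw [affineMatrix_add, add_zero, zero_add]⟩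
    · rintro ⟨X, hX, v, hv, rfl⟩
      exact ⟨_, hX, _, hv, by rw [affineMatrix_add, add_zero, zero_add]⟩

lemma isSplitting_of_splitSet {K : Matrix ι ι ℝ} {L L' : LieSubalgebra ℝ (Matrix (ι ⊕ Unit) (ι ⊕ Unit) ℝ)}
    {𝓜 : Submodule ℝ (Matrix ι ι ℝ)} {N : Submodule ℝ (ι → ℝ)} (h : IsSplitPair K 𝓜 N)
    (hL' : (L' : Set (Matrix (ι ⊕ Unit) (ι ⊕ Unit) ℝ)) = splitSet 𝓜 N)
    (hconj : Conjugate K (L : Set _) K (L' : Set _)) : IsSplitting K L := by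
  refine ⟨L', splitAlgebra 𝓜 ⊥ h.comm (by rintro v rfl; simp), splitAlgebra ⊥ N
    (by rintro X rfl; simp) (by rintro v - X rfl; simp), hconj, ?_, ?_, ?_⟩
  · rintro Y ⟨X, hX, v, rfl, rfl⟩
    exact ⟨X, h.skew X hX, rfl⟩
  · rintro Y ⟨X, rfl, v, -, rfl⟩
    exact ⟨v, rfl⟩
  · ext Y
    have : Y ∈ L'.toSubmodule ↔ Y ∈ splitSet 𝓜 N := by rw [← hL']; rfl
    rw [this, Submodule.mem_sup]
    constructor
    · rintro ⟨X, hX, v, hv, rfl⟩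
      exact ⟨affineMatrix X 0, ⟨X, hX, 0, rfl, rfl⟩, affineMatrix 0 v, ⟨0, rfl, v, hv, rfl⟩, by
        rw [affineMatrix_add, add_zero, zero_add]⟩
    · rintro ⟨_, ⟨X, hX, _, rfl, rfl⟩, _, ⟨_, rfl, v, hv, rfl⟩, rfl⟩
      exact ⟨X, hX, v, hv, by rw [affineMatrix_add, add_zero, zero_add]⟩

variable [Fintype κ] [DecidableEq κ]

/-- Split pairs correspond under isometries. -/
lemma IsIsometry.image_splitSet {K : Matrix ι ι ℝ} {K' : Matrix κ κ ℝ} {G : Matrix κ ι ℝ}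
    {Q : Matrix ι κ ℝ} (hG : IsIsometry K K' G Q) {𝓜 : Submodule ℝ (Matrix ι ι ℝ)}
    {N : Submodule ℝ (ι → ℝ)} (h : IsSplitPair K 𝓜 N) {𝓜' : Submodule ℝ (Matrix κ κ ℝ)}
    {N' : Submodule ℝ (κ → ℝ)} (h' : IsSplitPair K' 𝓜' N')
    (hact : ∀ X ∈ 𝓜, ∃ M ∈ 𝓜', X * Q = Q * M)
    (hker : ∀ γ, (∀ X ∈ 𝓜, X *ᵥ (Q *ᵥ γ) = 0) → γ ∈ N') :
    (fun Y => affineMap G 0 * Y * affineMap Q 0) '' splitSet 𝓜 N = splitSet 𝓜' N' := by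
  have hQG : ∀ v, Q *ᵥ (G *ᵥ v) = v := fun v => by rw [mulVec_mulVec, hG.left_inv, one_mulVec]
  have hGQ : ∀ v, G *ᵥ (Q *ᵥ v) = v := fun v => by rw [mulVec_mulVec, hG.right_inv, one_mulVec]
  have hGN : ∀ v ∈ N, G *ᵥ v ∈ N' := fun v hv =>
    hker _ fun X hX => by rw [hQG, (h.mem_iff v).1 hv X hX]
  ext Y
  constructor
  · rintro ⟨_, ⟨X, hX, v, hv, rfl⟩, rfl⟩
    obtain ⟨M, hM, e⟩ := hact X hX
    refine ⟨M, hM, G *ᵥ v, hGN v hv, ?_⟩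
    change affineMap G 0 * affineMatrix X v * affineMap Q 0 = _
    rw [affineMap_conj, mulVec_zero, zero_add, Matrix.mul_assoc, e, ← Matrix.mul_assoc,
      hG.right_inv, Matrix.one_mul]
  · rintro ⟨M, hM, v, hv, rfl⟩
    -- Only the inclusion into the model is known so far. The pulled back model commutes with `𝓜`
    -- and kills `N`, so the maximality of `𝓜` supplies the reverse inclusion.
    refine ⟨affineMatrix (Q * M * G) (Q *ᵥ v), ⟨_, h.maximal _ (hG.symm.conj_mem (h'.skew M hM))
      (fun w hw => ?_) (fun X hX => ?_), _, (h.mem_iff _).2 fun X hX => ?_, rfl⟩, ?_⟩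
    · rw [Matrix.mul_assoc, ← mulVec_mulVec, ← mulVec_mulVec, (h'.mem_iff _).1 (hGN w hw) M hM,
        mulVec_zero]
    · obtain ⟨M', hM', e⟩ := hact X hX
      have e' : G * X = M' * G := by
        calc G * X = G * (X * Q) * G := by
              rw [Matrix.mul_assoc, Matrix.mul_assoc, hG.left_inv, Matrix.mul_one]
          _ = M' * G := by rw [e, ← Matrix.mul_assoc, hG.right_inv, Matrix.one_mul]
      calc Q * M * G * X = Q * (M * M') * G := by
            rw [Matrix.mul_assoc, e']; simp only [Matrix.mul_assoc]
        _ = X * (Q * M * G) := by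
            rw [h'.comm M hM M' hM', ← Matrix.mul_assoc X, ← Matrix.mul_assoc X, e]
            simp only [Matrix.mul_assoc]
    · obtain ⟨M', hM', e⟩ := hact X hX
      rw [mulVec_mulVec, e, ← mulVec_mulVec, (h'.mem_iff v).1 hv M' hM', mulVec_zero]
    · change affineMap G 0 * _ * affineMap Q 0 = _
      rw [affineMap_conj, mulVec_zero, zero_add, hGQ]
      congr 1
      calc G * (Q * M * G) * Q = (G * Q) * M * (G * Q) := by simp only [Matrix.mul_assoc]
        _ = M := by rw [hG.right_inv]; simp

/-- As `K` and `K'` are involutions, the Gram relation makes `K' * Qᵀ * K` a left inverse of `Q`;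
surjectivity makes it two-sided although the index types differ. -/
lemma exists_isIsometry_of_gram {K : Matrix ι ι ℝ} {K' : Matrix κ κ ℝ} (hK : K * K = 1)
    (hKT : Kᵀ = K) (hK' : K' * K' = 1) (hKT' : K'ᵀ = K') {Q : Matrix ι κ ℝ}
    (hgram : Qᵀ * K * Q = K') (hsurj : ∀ v, ∃ γ, Q *ᵥ γ = v) :
    ∃ G, IsIsometry K K' G Q := by
  have hGQ : K' * Qᵀ * K * Q = 1 := by
    rw [Matrix.mul_assoc, Matrix.mul_assoc, ← Matrix.mul_assoc Qᵀ, hgram, hK']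
  refine ⟨K' * Qᵀ * K, ?_, ?_, hGQ⟩
  · calc K' * Qᵀ * K * K * (K' * Qᵀ * K)ᵀ = K' * (Qᵀ * (K * K) * K * Q) * K' := by
          simp only [transpose_mul, transpose_transpose, hKT, hKT', Matrix.mul_assoc]
      _ = K' := by rw [hK, Matrix.mul_one, hgram, hK', Matrix.one_mul]
  · refine Matrix.ext_of_mulVec_single fun i => ?_
    obtain ⟨γ, hγ⟩ := hsurj (Pi.single i 1)
    rw [← hγ, ← mulVec_mulVec, mulVec_mulVec γ (K' * Qᵀ * K), hGQ, one_mulVec, one_mulVec]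

end SplitPair

lemma mem_pseudoOrthogonal {ι : Type} [Fintype ι] [DecidableEq ι] {K X : Matrix ι ι ℝ} :
    X ∈ pseudoOrthogonal K ↔ X * K + K * Xᵀ = 0 := Iff.rfl

/-! ### The rotation blocks and their centralizer. -/

section Rotations

variable {l k : ℕ}

lemma rotationLin_mul_apply_zero {κ : Type} (a : Fin l → ℝ)
    (A : Matrix κ ((Fin 2 × Fin l) ⊕ Fin k) ℝ) (r : κ) (j : Fin l) :
    (A * rotationLin l k a) r (.inl (0, j)) = -a j * A r (.inl (1, j)) := by
  simp [rotationLin, Matrix.mul_apply, Fintype.sum_prod_type, blockDiagonal_apply]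
  ring

lemma rotationLin_mul_apply_one {κ : Type} (a : Fin l → ℝ)
    (A : Matrix κ ((Fin 2 × Fin l) ⊕ Fin k) ℝ) (r : κ) (j : Fin l) :
    (A * rotationLin l k a) r (.inl (1, j)) = a j * A r (.inl (0, j)) := by
  simp [rotationLin, Matrix.mul_apply, Fintype.sum_prod_type, blockDiagonal_apply]
  ring

lemma rotationLin_mulVec_zero (a : Fin l → ℝ) (v : (Fin 2 × Fin l) ⊕ Fin k → ℝ) (j : Fin l) :
    (rotationLin l k a *ᵥ v) (.inl (0, j)) = a j * v (.inl (1, j)) := by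
  simp [rotationLin, mulVec, dotProduct, Fintype.sum_prod_type, blockDiagonal_apply]

lemma rotationLin_mulVec_one (a : Fin l → ℝ) (v : (Fin 2 × Fin l) ⊕ Fin k → ℝ) (j : Fin l) :
    (rotationLin l k a *ᵥ v) (.inl (1, j)) = -a j * v (.inl (0, j)) := by
  simp [rotationLin, mulVec, dotProduct, Fintype.sum_prod_type, blockDiagonal_apply]

lemma rotationLin_mulVec_inr (a : Fin l → ℝ) (v : (Fin 2 × Fin l) ⊕ Fin k → ℝ) (j : Fin k) :
    (rotationLin l k a *ᵥ v) (.inr j) = 0 := by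
  simp [rotationLin, mulVec, dotProduct]

lemma rotationLin_mulVec_fixedLin (a : Fin l → ℝ) (x : Fin k → ℝ) :
    rotationLin l k a *ᵥ fixedLin l k x = 0 := by
  ext (⟨s, i⟩ | i)
  · fin_cases s
    · exact (rotationLin_mulVec_zero ..).trans (by simp [fixedLin])
    · exact (rotationLin_mulVec_one ..).trans (by simp [fixedLin])
  · exact rotationLin_mulVec_inr ..

lemma rotationLin_transpose (a : Fin l → ℝ) : (rotationLin l k a)ᵀ = -rotationLin l k a := by
  ext (⟨s, i⟩ | i) (⟨t, j⟩ | j) <;> simp [rotationLin, blockDiagonal_apply]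
  by_cases h : i = j
  · subst h
    fin_cases s <;> fin_cases t <;> simp
  · simp [h, Ne.symm h]

lemma rotationLin_mul_comm (a b : Fin l → ℝ) :
    rotationLin l k a * rotationLin l k b = rotationLin l k b * rotationLin l k a := by
  simp only [rotationLin, LinearMap.coe_mk, AddHom.coe_mk, fromBlocks_multiply, Matrix.mul_zero,
    Matrix.zero_mul, add_zero, ← blockDiagonal_mul]
  congr 2
  ext i s t
  fin_cases s <;> fin_cases t <;> simp [mul_comm]

/-- Commuting with the rotation of one plane alone clears the blocks between different planes. Skew
symmetry leaves one parameter in each diagonal block, and the killed columns clear the rest. -/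
lemma mem_range_rotationLin {A : Matrix ((Fin 2 × Fin l) ⊕ Fin k) ((Fin 2 × Fin l) ⊕ Fin k) ℝ}
    (hskew : Aᵀ = -A) (hcomm : ∀ a, A * rotationLin l k a = rotationLin l k a * A)
    (hkill : ∀ x, A *ᵥ fixedLin l k x = 0) : A ∈ LinearMap.range (rotationLin l k) := by
  have hsk : ∀ r c, A c r = -A r c := fun r c => congrFun (congrFun hskew r) c
  have hk : ∀ r j, A r (.inr j) = 0 := by
    intro r j
    have := congrFun (hkill (Pi.single j 1)) r
    simpa [fixedLin, mulVec, dotProduct, Pi.single_apply] using this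
  have hleft : ∀ a s i c, a i = 0 → (rotationLin l k a * A) (.inl (s, i)) c = 0 := by
    intro a s i c h
    change (rotationLin l k a *ᵥ fun r => A r c) _ = 0
    fin_cases s
    · exact (rotationLin_mulVec_zero ..).trans (by simp [h])
    · exact (rotationLin_mulVec_one ..).trans (by simp [h])
  have hoff : ∀ s i t j, i ≠ j → A (.inl (s, i)) (.inl (t, j)) = 0 := by
    intro s i t j hij
    have h0 : (Pi.single j (1 : ℝ) : Fin l → ℝ) i = 0 := by simp [hij]
    have h1 := fun t => (congrFun (congrFun (hcomm (Pi.single j 1)) (.inl (s, i)))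
      (.inl (t, j))).trans (hleft _ s i _ h0)
    fin_cases t
    · simpa [rotationLin_mul_apply_one] using h1 1
    · simpa [rotationLin_mul_apply_zero] using h1 0
  have hdiag : ∀ r, A r r = 0 := fun r => by linarith [hsk r r]
  refine ⟨fun i => A (.inl (0, i)) (.inl (1, i)), ?_⟩
  ext (⟨s, i⟩ | i) (⟨t, j⟩ | j)
  · by_cases hij : i = j
    · subst hij
      fin_cases s <;> fin_cases t <;>
        simp [rotationLin, hdiag, hsk (.inl (0, i)) (.inl (1, i))]
    · simp [rotationLin, blockDiagonal_apply, hij, hoff s i t j hij]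
  · simp [rotationLin, hk]
  · rw [hsk, hk]; simp [rotationLin]
  · simp [rotationLin, hk]

end Rotations

/-! ### Adding rotation planes and fixed directions to a split pair. -/

section BlockPair

variable {β : Type} {l k : ℕ}

lemma mem_blockLin {𝓜 : Submodule ℝ (Matrix β β ℝ)}
    {X : Matrix (BlockIndex β l k) (BlockIndex β l k) ℝ} :
    X ∈ blockLin l k 𝓜 ↔ ∃ M ∈ 𝓜, ∃ a, X = fromBlocks M 0 0 (rotationLin l k a) := by
  constructor
  · rintro ⟨⟨M, R⟩, ⟨hM, a, rfl⟩, rfl⟩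
    exact ⟨M, hM, a, rfl⟩
  · rintro ⟨M, hM, a, rfl⟩
    exact ⟨(M, rotationLin l k a), ⟨hM, a, rfl⟩, rfl⟩

lemma mem_blockTrans {N : Submodule ℝ (β → ℝ)} {v : BlockIndex β l k → ℝ} :
    v ∈ blockTrans l k N ↔ ∃ γ ∈ N, ∃ x, v = Sum.elim γ (fixedLin l k x) := by
  constructor
  · rintro ⟨⟨γ, w⟩, ⟨hγ, x, rfl⟩, rfl⟩
    exact ⟨γ, hγ, x, rfl⟩
  · rintro ⟨γ, hγ, x, rfl⟩
    exact ⟨(γ, fixedLin l k x), ⟨hγ, x, rfl⟩, rfl⟩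

lemma splitSet_block (𝓜 : Submodule ℝ (Matrix β β ℝ)) (N : Submodule ℝ (β → ℝ)) :
    splitSet (blockLin l k 𝓜) (blockTrans l k N) =
      {Y | ∃ M ∈ 𝓜, ∃ γ ∈ N, ∃ (a : Fin l → ℝ) (x : Fin k → ℝ), Y = masaMatrix M γ a x} := by
  ext Y
  constructor
  · rintro ⟨X, hX, v, hv, rfl⟩
    obtain ⟨M, hM, a, rfl⟩ := mem_blockLin.1 hX
    obtain ⟨γ, hγ, x, rfl⟩ := mem_blockTrans.1 hv
    exact ⟨M, hM, γ, hγ, a, x, rfl⟩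
  · rintro ⟨M, hM, γ, hγ, a, x, rfl⟩
    exact ⟨_, mem_blockLin.2 ⟨M, hM, a, rfl⟩, _, mem_blockTrans.2 ⟨γ, hγ, x, rfl⟩, rfl⟩

lemma IsSplitPair.block [Fintype β] [DecidableEq β] {K₀ : Matrix β β ℝ} (hK₀ : K₀ * K₀ = 1)
    {𝓜 : Submodule ℝ (Matrix β β ℝ)} {N : Submodule ℝ (β → ℝ)} (h : IsSplitPair K₀ 𝓜 N)
    (l k : ℕ) : IsSplitPair (blockMetric l k K₀) (blockLin l k 𝓜) (blockTrans l k N) where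
  skew X hX := by
    obtain ⟨M, hM, a, rfl⟩ := mem_blockLin.1 hX
    have := mem_pseudoOrthogonal.1 (h.skew M hM)
    rw [mem_pseudoOrthogonal, blockMetric, fromBlocks_transpose, fromBlocks_multiply,
      fromBlocks_multiply, fromBlocks_add]
    simp [this, rotationLin_transpose]
  comm X hX Y hY := by
    obtain ⟨M, hM, a, rfl⟩ := mem_blockLin.1 hX
    obtain ⟨M', hM', a', rfl⟩ := mem_blockLin.1 hY
    simp [fromBlocks_multiply, h.comm M hM M' hM', rotationLin_mul_comm a a']
  mem_iff v := by
    rw [mem_blockTrans]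
    constructor
    · rintro ⟨γ, hγ, x, rfl⟩ X hX
      obtain ⟨M, hM, a, rfl⟩ := mem_blockLin.1 hX
      rw [fromBlocks_mulVec]
      simp [Sum.elim_comp_inl, Sum.elim_comp_inr, (h.mem_iff γ).1 hγ M hM,
        rotationLin_mulVec_fixedLin]
    · intro hv
      have hblock : ∀ M ∈ 𝓜, ∀ a, M *ᵥ (v ∘ Sum.inl) = 0 ∧
          rotationLin l k a *ᵥ (v ∘ Sum.inr) = 0 := by
        intro M hM a
        have := hv _ (mem_blockLin.2 ⟨M, hM, a, rfl⟩)
        rw [fromBlocks_mulVec] at this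
        simp only [zero_mulVec, add_zero, zero_add] at this
        exact ⟨funext fun i => congrFun this (.inl i), funext fun i => congrFun this (.inr i)⟩
      refine ⟨v ∘ Sum.inl, (h.mem_iff _).2 fun M hM => (hblock M hM 0).1,
        fun j => v (.inr (.inr j)), ?_⟩
      -- With all angles equal to `1` the rotation is invertible on every plane, so the plane
      -- components of `v` vanish.
      have hrot := (hblock 0 (zero_mem _) 1).2
      ext (i | ⟨s, i⟩ | i)
      · rfl
      · fin_cases s
        · have := (rotationLin_mulVec_one ..).symm.trans (congrFun hrot (.inl (1, i)))
          simpa [fixedLin] using this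
        · have := (rotationLin_mulVec_zero ..).symm.trans (congrFun hrot (.inl (0, i)))
          simpa [fixedLin] using this
      · rfl
  maximal X hX hkill hcomm := by
    obtain ⟨A, C, D, E, rfl⟩ : ∃ A C D E, X = fromBlocks A C D E :=
      ⟨_, _, _, _, (fromBlocks_toBlocks X).symm⟩
    rw [mem_pseudoOrthogonal, blockMetric, fromBlocks_transpose, fromBlocks_multiply,
      fromBlocks_multiply, fromBlocks_add, ← fromBlocks_zero, fromBlocks_inj] at hX
    simp only [Matrix.mul_zero, Matrix.zero_mul, Matrix.mul_one, Matrix.one_mul, add_zero,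
      zero_add] at hX
    obtain ⟨hA, -, hDC, hE⟩ := hX
    have hkill' : ∀ γ ∈ N, ∀ x, A *ᵥ γ + C *ᵥ fixedLin l k x = 0 ∧
        D *ᵥ γ + E *ᵥ fixedLin l k x = 0 := by
      intro γ hγ x
      have := hkill _ (mem_blockTrans.2 ⟨γ, hγ, x, rfl⟩)
      rw [fromBlocks_mulVec, Sum.elim_comp_inl, Sum.elim_comp_inr] at this
      exact ⟨funext fun i => congrFun this (.inl i), funext fun i => congrFun this (.inr i)⟩
    have hcomm' : ∀ M ∈ 𝓜, ∀ a, A * M = M * A ∧ C * rotationLin l k a = M * C ∧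
        E * rotationLin l k a = rotationLin l k a * E := by
      intro M hM a
      have := hcomm _ (mem_blockLin.2 ⟨M, hM, a, rfl⟩)
      rw [fromBlocks_multiply, fromBlocks_multiply, fromBlocks_inj] at this
      simp only [Matrix.mul_zero, Matrix.zero_mul, add_zero, zero_add] at this
      exact ⟨this.1, this.2.1, this.2.2.2⟩
    -- Taking `M = 0` and all angles `1` gives `C R = 0` with `R` invertible on the planes; the
    -- remaining columns vanish because the translations `x` are killed. Skewness then clears `D`,
    -- since `K₀` is invertible.
    have hC : C = 0 := by
      have h1 := (hcomm' 0 (zero_mem _) 1).2.1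
      rw [Matrix.zero_mul] at h1
      ext i (⟨s, j⟩ | j)
      · fin_cases s
        · have := congrFun (congrFun h1 i) (.inl (1, j))
          simpa [rotationLin_mul_apply_one] using this
        · have := congrFun (congrFun h1 i) (.inl (0, j))
          simpa [rotationLin_mul_apply_zero] using this
      · have := congrFun (hkill' 0 (zero_mem _) (Pi.single j 1)).1 i
        simpa [fixedLin, mulVec, dotProduct, Pi.single_apply] using this
    have hD : D = 0 := by
      rw [hC, transpose_zero, add_zero] at hDC
      rw [← Matrix.mul_one D, ← hK₀, ← Matrix.mul_assoc, hDC, Matrix.zero_mul]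
    obtain ⟨a, ha⟩ := mem_range_rotationLin (A := E) (eq_neg_of_add_eq_zero_right hE)
      (fun a => (hcomm' 0 (zero_mem _) a).2.2)
      (fun x => by simpa using (hkill' 0 (zero_mem _) x).2)
    refine mem_blockLin.2 ⟨A, h.maximal A hA (fun γ hγ => ?_) fun M hM => (hcomm' M hM 0).1, a, ?_⟩
    · simpa using (hkill' γ hγ 0).1
    · rw [hC, hD, ha]

end BlockPair

/-! ### Maximality of the three Lorentzian blocks. -/

section Kinds

lemma isSplitPair_bot_top {ι : Type} [Fintype ι] [DecidableEq ι] (K : Matrix ι ι ℝ) :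
    IsSplitPair K ⊥ ⊤ where
  skew := by rintro X rfl; exact zero_mem _
  comm := by rintro X rfl; simp
  mem_iff v := by simp
  maximal X _ h _ := (Submodule.mem_bot ℝ).2
    (Matrix.ext_of_mulVec_single fun i => by rw [h _ trivial, zero_mulVec])

lemma mem_pseudoOrthogonal_metricB {X : Matrix (Fin 2) (Fin 2) ℝ} :
    X ∈ pseudoOrthogonal metricB ↔ ∃ c, blockB c = X := by
  rw [mem_pseudoOrthogonal]
  constructor
  · intro h
    refine ⟨X 0 0, ?_⟩
    have h00 := congrFun (congrFun h 0) 0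
    have h01 := congrFun (congrFun h 0) 1
    have h11 := congrFun (congrFun h 1) 1
    simp [metricB, Matrix.mul_apply, vecMul, dotProduct, Fin.sum_univ_two] at h00 h01 h11
    ext i j
    fin_cases i <;> fin_cases j <;> simp [blockB] <;> linarith
  · rintro ⟨c, rfl⟩
    ext i j
    fin_cases i <;> fin_cases j <;> simp [metricB, blockB, vecMul, dotProduct, Fin.sum_univ_two]

lemma isSplitPair_metricB : IsSplitPair metricB (LinearMap.range blockBLin) ⊥ where
  skew := by
    rintro _ ⟨c, rfl⟩
    exact mem_pseudoOrthogonal_metricB.2 ⟨c, rfl⟩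
  comm := by
    rintro _ ⟨c, rfl⟩ _ ⟨d, rfl⟩
    ext i j
    fin_cases i <;> fin_cases j <;> simp [blockBLin, blockB, mul_comm]
  mem_iff v := by
    constructor
    · rintro rfl; simp
    · intro h
      have := h (blockB 1) ⟨1, rfl⟩
      have h0 := congrFun this 0
      have h1 := congrFun this 1
      simp [blockB, mulVec, dotProduct, Fin.sum_univ_two] at h0 h1
      rw [Submodule.mem_bot]
      ext i
      fin_cases i <;> simp [h0, h1]
  maximal X hX _ _ := mem_pseudoOrthogonal_metricB.1 hX

variable {μ : ℕ}

lemma blockC_mem (α : Fin μ → ℝ) : blockC α ∈ pseudoOrthogonal (metricC μ) := by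
  rw [mem_pseudoOrthogonal]
  ext (i | i | i) (j | j | j) <;>
    simp [metricC, blockC, Matrix.mul_apply, Matrix.one_apply]

lemma blockC_mul_comm (α α' : Fin μ → ℝ) : blockC α * blockC α' = blockC α' * blockC α := by
  ext (i | i | i) (j | j | j) <;> simp [blockC, Matrix.mul_apply, mul_comm]

lemma blockC_mulVec (α : Fin μ → ℝ) (v : Unit ⊕ (Fin μ ⊕ Unit) → ℝ) :
    blockC α *ᵥ v = Sum.elim (fun _ => ∑ i, α i * v (.inr (.inl i)))
      (Sum.elim (fun i => -α i * v (.inr (.inr ()))) 0) := by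
  ext (i | i | i) <;> simp [blockC, mulVec, dotProduct]

/-- Commuting with all blocks makes the middle block of `X` a scalar matrix, with the corner entry
as scalar. It is also skew symmetric, so the scalar is zero once there is a middle row, that is `μ ≥
1`. The skew relations determine the remaining entries. -/
lemma exists_eq_blockC (hμ : 1 ≤ μ) {X : Matrix (Unit ⊕ (Fin μ ⊕ Unit)) (Unit ⊕ (Fin μ ⊕ Unit)) ℝ}
    (hX : X ∈ pseudoOrthogonal (metricC μ)) (hc : ∀ α, X * blockC α = blockC α * X) :
    ∃ α, blockC α = X := by
  rw [mem_pseudoOrthogonal] at hX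
  have hsk := fun r c => congrFun (congrFun hX r) c
  have huw : X (.inl ()) (.inr (.inr ())) = 0 := by
    have := hsk (.inl ()) (.inl ())
    simp [metricC, Matrix.mul_apply] at this
    linarith
  have hwu : X (.inr (.inr ())) (.inl ()) = 0 := by
    have := hsk (.inr (.inr ())) (.inr (.inr ()))
    simp [metricC, Matrix.mul_apply] at this
    linarith
  have huu : X (.inl ()) (.inl ()) + X (.inr (.inr ())) (.inr (.inr ())) = 0 := by
    have := hsk (.inl ()) (.inr (.inr ()))
    simpa [metricC, Matrix.mul_apply, Matrix.one_apply] using this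
  have hui : ∀ i, X (.inl ()) (.inr (.inl i)) + X (.inr (.inl i)) (.inr (.inr ())) = 0 := by
    intro i
    have := hsk (.inl ()) (.inr (.inl i))
    simpa [metricC, Matrix.mul_apply, Matrix.one_apply] using this
  have hwi : ∀ i, X (.inr (.inr ())) (.inr (.inl i)) + X (.inr (.inl i)) (.inl ()) = 0 := by
    intro i
    have := hsk (.inr (.inr ())) (.inr (.inl i))
    simpa [metricC, Matrix.mul_apply, Matrix.one_apply] using this
  have hij : ∀ i j, X (.inr (.inl i)) (.inr (.inl j)) + X (.inr (.inl j)) (.inr (.inl i)) = 0 := by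
    intro i j
    have := hsk (.inr (.inl i)) (.inr (.inl j))
    simpa [metricC, Matrix.mul_apply, Matrix.one_apply] using this
  have hiu : ∀ i, X (.inr (.inl i)) (.inl ()) = 0 := by
    intro i
    have := congrFun (congrFun (hc (Pi.single i 1)) (.inl ())) (.inl ())
    simpa [blockC, Matrix.mul_apply, Pi.single_apply, eq_comm] using this
  have hdiag : ∀ i j, X (.inr (.inl i)) (.inr (.inl j)) =
      if i = j then X (.inl ()) (.inl ()) else 0 := by
    intro i j
    have := congrFun (congrFun (hc (Pi.single i 1)) (.inl ())) (.inr (.inl j))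
    simpa [blockC, Matrix.mul_apply, Pi.single_apply, eq_comm] using this
  have huu0 : X (.inl ()) (.inl ()) = 0 := by
    have h1 := hij ⟨0, hμ⟩ ⟨0, hμ⟩
    rw [hdiag, if_pos rfl] at h1
    linarith
  refine ⟨fun i => X (.inl ()) (.inr (.inl i)), ?_⟩
  ext (i | i | i) (j | j | j)
  · simp [blockC, huu0]
  · simp [blockC]
  · simp [blockC, huw]
  · simp [blockC, hiu]
  · simp [blockC, hdiag, huu0]
  · simpa [blockC] using (eq_neg_of_add_eq_zero_right (hui i)).symm
  · simp [blockC, hwu]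
  · have := hwi j
    rw [hiu, add_zero] at this
    simp [blockC, this]
  · rw [huu0, zero_add] at huu
    simp [blockC, huu]

lemma isSplitPair_metricC (hμ : 1 ≤ μ) : IsSplitPair (metricC μ) (LinearMap.range (blockCLin μ))
    (LinearMap.range (nullCLin μ)) where
  skew := by rintro _ ⟨α, rfl⟩; exact blockC_mem α
  comm := by rintro _ ⟨α, rfl⟩ _ ⟨α', rfl⟩; exact blockC_mul_comm α α'
  mem_iff v := by
    constructor
    · rintro ⟨z, rfl⟩ _ ⟨α, rfl⟩
      change blockC α *ᵥ _ = 0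
      rw [blockC_mulVec]
      ext (i | i | i) <;> simp [nullCLin]
    · intro h
      have h1 : ∀ α, _ := fun α => (blockC_mulVec α v).symm.trans (h _ ⟨α, rfl⟩)
      refine ⟨v (.inl ()), ?_⟩
      ext (i | i | i)
      · rfl
      · have := congrFun (h1 (Pi.single i 1)) (.inl ())
        simpa [nullCLin, Pi.single_apply, eq_comm] using this
      · have := congrFun (h1 1) (.inr (.inl ⟨0, hμ⟩))
        simpa [nullCLin, eq_comm] using this
  maximal X hX _ hc := exists_eq_blockC hμ hX fun α => hc _ ⟨α, rfl⟩

lemma blockC_mul_blockC_mul_blockC (α α' α'' : Fin μ → ℝ) :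
    blockC α * (blockC α' * blockC α'') = 0 := by
  ext (i | i | i) (j | j | j) <;> simp [blockC, Matrix.mul_apply]

lemma blockC_mul_blockC_mul_blockC_mul (α α' α'' : Fin μ → ℝ)
    (Y : Matrix (Unit ⊕ (Fin μ ⊕ Unit)) (Unit ⊕ (Fin μ ⊕ Unit)) ℝ) :
    blockC α * (blockC α' * (blockC α'' * Y)) = 0 := by
  rw [← Matrix.mul_assoc (blockC α'), ← Matrix.mul_assoc, blockC_mul_blockC_mul_blockC,
    Matrix.zero_mul]

/-- The abelian Lie algebra of the matrices `blockC α`. -/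
def blockCAlgebra (μ : ℕ) :
    LieSubalgebra ℝ (Matrix (Unit ⊕ (Fin μ ⊕ Unit)) (Unit ⊕ (Fin μ ⊕ Unit)) ℝ) where
  __ := LinearMap.range (blockCLin μ)
  lie_mem' := by
    rintro _ _ ⟨α, rfl⟩ ⟨α', rfl⟩
    refine ⟨0, ?_⟩
    rw [map_zero, Ring.lie_def]
    exact (sub_eq_zero.2 (blockC_mul_comm α α')).symm

lemma isMANS_blockCAlgebra (hμ : 1 ≤ μ) :
    IsMANS (pseudoOrthogonal (metricC μ)) (blockCAlgebra μ) := by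
  refine ⟨⟨?_, ?_, ?_⟩, 5, ?_⟩
  · rintro _ ⟨α, rfl⟩
    exact blockC_mem α
  · rintro _ ⟨α, rfl⟩ _ ⟨α', rfl⟩
    rw [Ring.lie_def]
    exact sub_eq_zero.2 (blockC_mul_comm α α')
  · intro X hX hc
    refine exists_eq_blockC hμ hX fun α => ?_
    have := hc (blockC α) ⟨α, rfl⟩
    rwa [Ring.lie_def, sub_eq_zero] at this
  -- A fivefold bracket expands into terms with five blocks distributed over the two sides of `Y`;
  -- one side carries at least three, and any product of three blocks is zero.
  · intro Y _ Zs hlen hZ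
    match Zs, hlen with
    | [a, b, c, d, e], _ =>
      obtain ⟨a, rfl⟩ := hZ a (by simp)
      obtain ⟨b, rfl⟩ := hZ b (by simp)
      obtain ⟨c, rfl⟩ := hZ c (by simp)
      obtain ⟨d, rfl⟩ := hZ d (by simp)
      obtain ⟨e, rfl⟩ := hZ e (by simp)
      have key : ∀ α, blockCLin μ α = blockC α := fun _ => rfl
      simp only [List.foldl_cons, List.foldl_nil, key, Ring.lie_def, Matrix.sub_mul,
        Matrix.mul_sub, Matrix.mul_assoc, blockC_mul_blockC_mul_blockC,
        blockC_mul_blockC_mul_blockC_mul, Matrix.mul_zero, Matrix.zero_mul, sub_zero]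

lemma metricA_mul_self : metricA * metricA = 1 := by simp [metricA]

lemma metricB_mul_self : metricB * metricB = 1 := by
  ext i j
  fin_cases i <;> fin_cases j <;> simp [metricB]

lemma metricC_mul_self (μ : ℕ) : metricC μ * metricC μ = 1 := by
  ext (i | i | i) (j | j | j) <;> simp [metricC, Matrix.mul_apply, Matrix.one_apply]

lemma metricA_transpose : metricAᵀ = metricA := by simp [metricA]

lemma metricB_transpose : metricBᵀ = metricB := by
  ext i j
  fin_cases i <;> fin_cases j <;> simp [metricB]

lemma metricC_transpose (μ : ℕ) : (metricC μ)ᵀ = metricC μ := by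
  ext (i | i | i) (j | j | j) <;> simp [metricC, Matrix.one_apply, eq_comm]

lemma blockMetric_mul_self {β : Type} [Fintype β] [DecidableEq β] {K₀ : Matrix β β ℝ}
    (h : K₀ * K₀ = 1) (l k : ℕ) : blockMetric l k K₀ * blockMetric l k K₀ = 1 := by
  simp [blockMetric, fromBlocks_multiply, h]

lemma blockMetric_transpose {β : Type} {K₀ : Matrix β β ℝ} (h : K₀ᵀ = K₀) (l k : ℕ) :
    (blockMetric l k K₀)ᵀ = blockMetric l k K₀ := by
  simp [blockMetric, fromBlocks_transpose, h]

end Kinds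

/-! ### Transport of split pairs by isometries, and dimensions. -/

section Transport

variable {ι κ : Type} [Fintype ι]

/-- The map `X ↦ G X Q`. -/
def conjLin (G : Matrix κ ι ℝ) (Q : Matrix ι κ ℝ) : Matrix ι ι ℝ →ₗ[ℝ] Matrix κ κ ℝ where
  toFun X := G * X * Q
  map_add' X Y := by rw [Matrix.mul_add, Matrix.add_mul]
  map_smul' c X := by simp

lemma image_splitSet_map (G : Matrix κ ι ℝ) (Q : Matrix ι κ ℝ)
    (𝓜 : Submodule ℝ (Matrix ι ι ℝ)) (N : Submodule ℝ (ι → ℝ)) :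
    (fun Y => affineMap G 0 * Y * affineMap Q 0) '' splitSet 𝓜 N =
      splitSet (𝓜.map (conjLin G Q)) (N.map G.mulVecLin) := by
  have hconj : ∀ X v, affineMap G 0 * affineMatrix X v * affineMap Q 0 =
      affineMatrix (conjLin G Q X) (G *ᵥ v) := fun X v => by
    rw [affineMap_conj, mulVec_zero, zero_add]; rfl
  ext Y
  constructor
  · rintro ⟨_, ⟨X, hX, v, hv, rfl⟩, rfl⟩
    exact ⟨_, ⟨X, hX, rfl⟩, _, ⟨v, hv, rfl⟩, hconj X v⟩
  · rintro ⟨_, ⟨X, hX, rfl⟩, _, ⟨v, hv, rfl⟩, rfl⟩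
    exact ⟨_, ⟨X, hX, v, hv, rfl⟩, hconj X v⟩

variable [DecidableEq ι] [Fintype κ] [DecidableEq κ]

lemma IsSplitPair.map {K : Matrix ι ι ℝ} {K' : Matrix κ κ ℝ} {G : Matrix κ ι ℝ}
    {Q : Matrix ι κ ℝ} {𝓜 : Submodule ℝ (Matrix ι ι ℝ)} {N : Submodule ℝ (ι → ℝ)}
    (h : IsSplitPair K 𝓜 N) (hG : IsIsometry K K' G Q) :
    IsSplitPair K' (𝓜.map (conjLin G Q)) (N.map G.mulVecLin) := by
  have hQG : ∀ v, Q *ᵥ (G *ᵥ v) = v := fun v => by rw [mulVec_mulVec, hG.left_inv, one_mulVec]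
  have hGQ : ∀ v, G *ᵥ (Q *ᵥ v) = v := fun v => by rw [mulVec_mulVec, hG.right_inv, one_mulVec]
  have hmul : ∀ X Y, conjLin G Q X * conjLin G Q Y = conjLin G Q (X * Y) := fun X Y => by
    change G * X * Q * (G * Y * Q) = G * (X * Y) * Q
    calc _ = G * X * (Q * G) * Y * Q := by simp only [Matrix.mul_assoc]
      _ = _ := by rw [hG.left_inv]; simp only [Matrix.mul_assoc, Matrix.one_mul]
  have hvec : ∀ X v, conjLin G Q X *ᵥ v = G *ᵥ (X *ᵥ (Q *ᵥ v)) := fun X v => by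
    simp [conjLin, Matrix.mul_assoc]
  have hback : ∀ X, conjLin G Q (Q * X * G) = X := fun X => by
    change G * (Q * X * G) * Q = X
    calc _ = (G * Q) * X * (G * Q) := by simp only [Matrix.mul_assoc]
      _ = X := by rw [hG.right_inv]; simp
  have hinj : ∀ X Y, conjLin G Q X = conjLin G Q Y → X = Y := fun X Y e => by
    have : ∀ X, Q * conjLin G Q X * G = X := fun X => by
      change Q * (G * X * Q) * G = X
      calc _ = (Q * G) * X * (Q * G) := by simp only [Matrix.mul_assoc]
        _ = X := by rw [hG.left_inv]; simp
    rw [← this X, e, this]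
  refine ⟨?_, ?_, fun v => ⟨?_, fun hv => ?_⟩, fun X hX hXN hXc => ?_⟩
  · rintro _ ⟨X, hX, rfl⟩
    exact hG.conj_mem (h.skew X hX)
  · rintro _ ⟨X, hX, rfl⟩ _ ⟨Y, hY, rfl⟩
    rw [hmul, hmul, h.comm X hX Y hY]
  · rintro ⟨w, hw, rfl⟩ _ ⟨X, hX, rfl⟩
    rw [hvec, mulVecLin_apply, hQG, (h.mem_iff w).1 hw X hX, mulVec_zero]
  · refine ⟨Q *ᵥ v, (h.mem_iff _).2 fun X hX => ?_, hGQ v⟩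
    have := hv _ ⟨X, hX, rfl⟩
    rw [hvec] at this
    rw [← hQG (X *ᵥ (Q *ᵥ v)), this, mulVec_zero]
  · refine ⟨Q * X * G, h.maximal _ (hG.symm.conj_mem hX) (fun w hw => ?_) (fun Y hY => ?_), hback X⟩
    · rw [Matrix.mul_assoc, ← mulVec_mulVec, ← mulVec_mulVec]
      have := hXN _ ⟨w, hw, rfl⟩
      rw [mulVecLin_apply] at this
      rw [this, mulVec_zero]
    · apply hinj
      rw [← hmul, ← hmul, hback]
      exact hXc _ ⟨Y, hY, rfl⟩

/-- The Lie algebra of a split pair. -/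
def IsSplitPair.algebra {K : Matrix ι ι ℝ} {𝓜 : Submodule ℝ (Matrix ι ι ℝ)}
    {N : Submodule ℝ (ι → ℝ)} (h : IsSplitPair K 𝓜 N) :
    LieSubalgebra ℝ (Matrix (ι ⊕ Unit) (ι ⊕ Unit) ℝ) :=
  splitAlgebra 𝓜 N h.comm fun v hv => (h.mem_iff v).1 hv

lemma IsSplitPair.isMASA {K : Matrix ι ι ℝ} {𝓜 : Submodule ℝ (Matrix ι ι ℝ)}
    {N : Submodule ℝ (ι → ℝ)} (h : IsSplitPair K 𝓜 N) : IsMASA (pseudoEuclidean K) h.algebra :=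
  (isMASA_iff_isSplitPair rfl).2 h

lemma IsSplitPair.isMASA_of_conjugate {K : Matrix ι ι ℝ} {K' : Matrix κ κ ℝ}
    {𝓜 : Submodule ℝ (Matrix κ κ ℝ)} {N : Submodule ℝ (κ → ℝ)} (h : IsSplitPair K' 𝓜 N)
    {L : LieSubalgebra ℝ (Matrix (ι ⊕ Unit) (ι ⊕ Unit) ℝ)}
    (hL : Conjugate K (L : Set _) K' (splitSet 𝓜 N)) : IsMASA (pseudoEuclidean K) L :=
  Conjugate.isMASA (L := h.algebra) hL.symm h.isMASA

/-- Splitting asks for a conjugacy inside `e(K)`. Returning from the model by the linear isometry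
alone, without the translation, produces a split set over `K` that is conjugate to `L`. -/
lemma IsSplitPair.isSplitting_of_conjugate {K : Matrix ι ι ℝ} {K' : Matrix κ κ ℝ}
    {𝓜 : Submodule ℝ (Matrix κ κ ℝ)} {N : Submodule ℝ (κ → ℝ)} (h : IsSplitPair K' 𝓜 N)
    {L : LieSubalgebra ℝ (Matrix (ι ⊕ Unit) (ι ⊕ Unit) ℝ)}
    (hL : Conjugate K (L : Set _) K' (splitSet 𝓜 N)) : IsSplitting K L := by
  obtain ⟨G, Q, a, hG, -⟩ := conjugate_iff.1 hL
  refine isSplitting_of_splitSet (h.map hG.symm) (L' := (h.map hG.symm).algebra) rfl ?_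
  refine hL.trans ?_
  have := hG.symm.conjugate (splitSet 𝓜 N)
  rwa [image_splitSet_map] at this

lemma IsSplitPair.exists_conjugate {K : Matrix ι ι ℝ} {K' : Matrix κ κ ℝ}
    {𝓜 : Submodule ℝ (Matrix κ κ ℝ)} {N : Submodule ℝ (κ → ℝ)} (h : IsSplitPair K' 𝓜 N)
    {G : Matrix κ ι ℝ} {Q : Matrix ι κ ℝ} (hG : IsIsometry K K' G Q) :
    ∃ L : LieSubalgebra ℝ (Matrix (ι ⊕ Unit) (ι ⊕ Unit) ℝ),
      Conjugate K (L : Set _) K' (splitSet 𝓜 N) := by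
  refine ⟨(h.map hG.symm).algebra, ?_⟩
  have := (hG.symm.conjugate (splitSet 𝓜 N)).symm
  rwa [image_splitSet_map] at this

lemma finrank_prod_submodule {V V' : Type*} [AddCommGroup V] [Module ℝ V] [AddCommGroup V']
    [Module ℝ V'] [FiniteDimensional ℝ V] [FiniteDimensional ℝ V'] (P : Submodule ℝ V)
    (P' : Submodule ℝ V') :
    Module.finrank ℝ (P.prod P') = Module.finrank ℝ P + Module.finrank ℝ P' := by
  have h : P.prod P' = LinearMap.range (P.subtype.prodMap P'.subtype) := by
    rw [LinearMap.range_prodMap, Submodule.range_subtype, Submodule.range_subtype]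
  rw [h, LinearMap.finrank_range_of_inj, Module.finrank_prod]
  rw [LinearMap.coe_prodMap]
  exact P.injective_subtype.prodMap P'.injective_subtype

lemma finrank_map_of_injective {V V' : Type*} [AddCommGroup V] [Module ℝ V] [AddCommGroup V']
    [Module ℝ V'] {f : V →ₗ[ℝ] V'} (hf : Function.Injective f) (P : Submodule ℝ V) :
    Module.finrank ℝ (P.map f) = Module.finrank ℝ P :=
  (Submodule.equivMapOfInjective f hf P).finrank_eq.symm

/-- The map `(X, v) ↦ affineMatrix X v`. -/
def affineLin (ι : Type) : (Matrix ι ι ℝ × (ι → ℝ)) →ₗ[ℝ] Matrix (ι ⊕ Unit) (ι ⊕ Unit) ℝ where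
  toFun q := affineMatrix q.1 q.2
  map_add' _ _ := (affineMatrix_add ..).symm
  map_smul' _ _ := (affineMatrix_smul ..).symm

lemma affineLin_injective (ι : Type) : Function.Injective (affineLin ι) := fun _ _ h =>
  Prod.ext (affineMatrix_inj h).1 (affineMatrix_inj h).2

lemma IsSplitPair.finrank_of_conjugate {K : Matrix ι ι ℝ} {K' : Matrix κ κ ℝ}
    {𝓜 : Submodule ℝ (Matrix κ κ ℝ)} {N : Submodule ℝ (κ → ℝ)}
    {L : LieSubalgebra ℝ (Matrix (ι ⊕ Unit) (ι ⊕ Unit) ℝ)}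
    (hL : Conjugate K (L : Set _) K' (splitSet 𝓜 N)) :
    Module.finrank ℝ L = Module.finrank ℝ 𝓜 + Module.finrank ℝ N := by
  obtain ⟨Φ, G, Q, -, hS, -⟩ := hL.exists_equiv
  have h1 : L.toSubmodule.map (Φ.toLinearEquiv : _ →ₗ[ℝ] _) = (𝓜.prod N).map (affineLin κ) := by
    apply SetLike.coe_injective
    rw [Submodule.map_coe]
    refine hS.symm.trans ?_
    ext Y
    constructor
    · rintro ⟨X, hX, v, hv, rfl⟩
      exact ⟨(X, v), ⟨hX, hv⟩, rfl⟩
    · rintro ⟨⟨X, v⟩, ⟨hX, hv⟩, rfl⟩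
      exact ⟨X, hX, v, hv, rfl⟩
  have h2 := LinearEquiv.finrank_map_eq Φ.toLinearEquiv L.toSubmodule
  rw [h1, finrank_map_of_injective (affineLin_injective κ), finrank_prod_submodule] at h2
  exact h2.symm

lemma finrank_blockLin {β : Type} [Finite β] (l k : ℕ) (𝓜 : Submodule ℝ (Matrix β β ℝ)) :
    Module.finrank ℝ (blockLin l k 𝓜) = Module.finrank ℝ 𝓜 + l := by
  have hinj : Function.Injective (diagLin β ((Fin 2 × Fin l) ⊕ Fin k)) := by
    rintro ⟨A, A'⟩ ⟨D, D'⟩ h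
    obtain ⟨h1, -, -, h2⟩ := fromBlocks_inj.1 h
    exact Prod.ext h1 h2
  have hrot : Function.Injective (rotationLin l k) := by
    intro a b h
    ext i
    have := congrFun (congrFun h (.inl (0, i))) (.inl (1, i))
    simpa [rotationLin] using this
  cases nonempty_fintype β
  rw [blockLin, finrank_map_of_injective hinj, finrank_prod_submodule,
    LinearMap.finrank_range_of_inj hrot, Module.finrank_fin_fun]

lemma finrank_blockTrans {β : Type} [Finite β] (l k : ℕ) (N : Submodule ℝ (β → ℝ)) :
    Module.finrank ℝ (blockTrans l k N) = Module.finrank ℝ N + k := by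
  have hinj : Function.Injective (elimLin β ((Fin 2 × Fin l) ⊕ Fin k)) := by
    rintro ⟨v, w⟩ ⟨v', w'⟩ h
    exact Prod.ext (funext fun i => congrFun h (.inl i)) (funext fun i => congrFun h (.inr i))
  have hfix : Function.Injective (fixedLin l k) := by
    intro a b h
    ext i
    exact congrFun h (.inr i)
  rw [blockTrans, finrank_map_of_injective hinj, finrank_prod_submodule,
    LinearMap.finrank_range_of_inj hfix, Module.finrank_fin_fun]

end Transport

/-! ### Translation type and Sylvester's law of inertia. -/

section TranslationType

variable {ι κ : Type} [Fintype ι] [Fintype κ]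

/-- The subspace `N` has an orthogonal basis, with respect to `K`, of `a` vectors of positive
length, `b` of negative length and `c` isotropic vectors. -/
def HasType (K : Matrix ι ι ℝ) (N : Submodule ℝ (ι → ℝ)) (a b c : ℕ) : Prop :=
  ∃ f : Fin a ⊕ (Fin b ⊕ Fin c) → ι → ℝ, LinearIndependent ℝ f ∧
    Submodule.span ℝ (Set.range f) = N ∧ (∀ i j, i ≠ j → f i ⬝ᵥ K *ᵥ f j = 0) ∧
    (∀ i, 0 < f (.inl i) ⬝ᵥ K *ᵥ f (.inl i)) ∧
    (∀ i, f (.inr (.inl i)) ⬝ᵥ K *ᵥ f (.inr (.inl i)) < 0) ∧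
    ∀ i, f (.inr (.inr i)) ⬝ᵥ K *ᵥ f (.inr (.inr i)) = 0

lemma hasTranslationType_iff {p : ℕ} {L : LieSubalgebra ℝ (Ambient p)} {a b c : ℕ} :
    HasTranslationType p L a b c ↔ HasType (minkowski p) (translationSpace L) a b c := by
  constructor
  · rintro ⟨e, h⟩
    refine ⟨fun i => e i, e.linearIndependent.map' _ (Submodule.ker_subtype _), ?_, h⟩
    have : Set.range (fun i => (e i : Fin p ⊕ Unit → ℝ)) =
        (translationSpace L).subtype '' Set.range e := by
      rw [← Set.range_comp]; rfl
    rw [this, Submodule.span_image, e.span_eq, Submodule.map_top, Submodule.range_subtype]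
  · rintro ⟨f, hli, hspan, h⟩
    have hmem : ∀ i, f i ∈ translationSpace L := fun i =>
      hspan ▸ Submodule.subset_span ⟨i, rfl⟩
    have hli' : LinearIndependent ℝ fun i => (⟨f i, hmem i⟩ : translationSpace L) :=
      LinearIndependent.of_comp (translationSpace L).subtype hli
    refine ⟨Module.Basis.mk hli' ?_, ?_⟩
    · rintro ⟨v, hv⟩ -
      have hv' := hv
      rw [← hspan] at hv'
      obtain ⟨c, hc⟩ := (Submodule.mem_span_range_iff_exists_fun ℝ).1 hv'
      refine (Submodule.mem_span_range_iff_exists_fun ℝ).2 ⟨c, Subtype.ext ?_⟩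
      simpa using hc
    · simpa only [Module.Basis.mk_apply, minkowskiProduct] using h

/-- If `K` is positive on part of one orthogonal basis and nonpositive on part of another one,
then the two parts together are not larger than a basis. -/
lemma card_add_card_le {I J I' J' : Type} [Fintype I] [Fintype J] [Fintype I'] [Fintype J']
    {K : Matrix ι ι ℝ} {f : I → ι → ℝ} {f' : J → ι → ℝ} (hf : LinearIndependent ℝ f)
    (hf' : LinearIndependent ℝ f')
    (hspan : Submodule.span ℝ (Set.range f) = Submodule.span ℝ (Set.range f'))
    (ho : ∀ i j, i ≠ j → f i ⬝ᵥ K *ᵥ f j = 0) (ho' : ∀ i j, i ≠ j → f' i ⬝ᵥ K *ᵥ f' j = 0)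
    {g : I' → I} (hg : Function.Injective g) (hpos : ∀ i, 0 < f (g i) ⬝ᵥ K *ᵥ f (g i))
    {g' : J' → J} (hg' : Function.Injective g') (hnon : ∀ i, f' (g' i) ⬝ᵥ K *ᵥ f' (g' i) ≤ 0) :
    Fintype.card I' + Fintype.card J' ≤ Fintype.card J := by
  have key : ∀ {I I' : Type} [Fintype I] [Fintype I'] {f : I → ι → ℝ} {g : I' → I},
      (∀ i j, i ≠ j → f i ⬝ᵥ K *ᵥ f j = 0) → Function.Injective g → ∀ x : I' → ℝ,
      (∑ i, x i • f (g i)) ⬝ᵥ K *ᵥ (∑ i, x i • f (g i)) =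
        ∑ i, x i * x i * (f (g i) ⬝ᵥ K *ᵥ f (g i)) := by
    intro I I' _ _ f g ho hg x
    rw [sum_dotProduct]
    refine Finset.sum_congr rfl fun i _ => ?_
    rw [mulVec_sum, dotProduct_sum, Finset.sum_eq_single i]
    · simp only [mulVec_smul, smul_dotProduct, dotProduct_smul, smul_eq_mul]; ring
    · intro j _ hji
      simp [mulVec_smul, ho _ _ (hg.ne hji.symm)]
    · simp
  set P := Submodule.span ℝ (Set.range (f ∘ g))
  set R := Submodule.span ℝ (Set.range (f' ∘ g'))
  have hP : Module.finrank ℝ P = Fintype.card I' := finrank_span_eq_card (hf.comp g hg)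
  have hR : Module.finrank ℝ R = Fintype.card J' := finrank_span_eq_card (hf'.comp g' hg')
  -- On a common vector the form is a nonnegative combination of positive numbers and at the same
  -- time not positive, so all its coefficients vanish.
  have hinf : P ⊓ R = ⊥ := by
    rw [eq_bot_iff]
    rintro v ⟨hv, hv'⟩
    obtain ⟨x, rfl⟩ := (Submodule.mem_span_range_iff_exists_fun ℝ).1 hv
    obtain ⟨y, hy⟩ := (Submodule.mem_span_range_iff_exists_fun ℝ).1 hv'
    have e1 := key ho hg x
    have e2 := key ho' hg' y
    simp only [Function.comp_apply] at hy ⊢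
    rw [hy, e1] at e2
    have hle : ∑ i, x i * x i * (f (g i) ⬝ᵥ K *ᵥ f (g i)) ≤ 0 := by
      rw [e2]
      exact Finset.sum_nonpos fun i _ => mul_nonpos_of_nonneg_of_nonpos (mul_self_nonneg _) (hnon i)
    have hnn : ∀ i ∈ Finset.univ, 0 ≤ x i * x i * (f (g i) ⬝ᵥ K *ᵥ f (g i)) := fun i _ =>
      mul_nonneg (mul_self_nonneg _) (hpos i).le
    have hzero := (Finset.sum_eq_zero_iff_of_nonneg hnn).1
      (le_antisymm hle (Finset.sum_nonneg hnn))
    refine (Submodule.mem_bot ℝ).2 (Finset.sum_eq_zero fun i hi => ?_)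
    have := hzero i hi
    rw [mul_eq_zero, or_iff_left (hpos i).ne', mul_self_eq_zero] at this
    rw [this, zero_smul]
  have hle : P ⊔ R ≤ Submodule.span ℝ (Set.range f') := by
    refine sup_le ?_ ?_
    · rw [← hspan]; exact Submodule.span_mono (Set.range_comp_subset_range _ _)
    · exact Submodule.span_mono (Set.range_comp_subset_range _ _)
  have h1 := Submodule.finrank_sup_add_finrank_inf_eq P R
  have h2 := Submodule.finrank_mono hle
  rw [hinf, finrank_bot, hP, hR] at h1
  rw [finrank_span_eq_card hf'] at h2
  omega

/-- The positive part of one basis meets the nonpositive part of the other trivially, so `a + b' +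
c' ≤ a' + b' + c'`. The bound on `b` is the same argument for `-K`. -/
lemma HasType.le {K : Matrix ι ι ℝ} {N : Submodule ℝ (ι → ℝ)} {a b c a' b' c' : ℕ}
    (h : HasType K N a b c) (h' : HasType K N a' b' c') : a ≤ a' ∧ b ≤ b' := by
  obtain ⟨f, hli, hspan, ho, hp, hn, -⟩ := h
  obtain ⟨f', hli', hspan', ho', hp', hn', hz'⟩ := h'
  constructor
  · have := card_add_card_le hli hli' (hspan.trans hspan'.symm) ho ho' Sum.inl_injective hp
      Sum.inr_injective (by
        rintro (i | i)
        · exact (hn' i).le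
        · exact (hz' i).le)
    simp at this
    omega
  · have hneg : ∀ v w : ι → ℝ, v ⬝ᵥ (-K) *ᵥ w = -(v ⬝ᵥ K *ᵥ w) := fun v w => by
      rw [neg_mulVec, dotProduct_neg]
    have := card_add_card_le (K := -K) (I' := Fin b) (J' := Fin a' ⊕ Fin c') hli hli'
      (hspan.trans hspan'.symm)
      (fun i j h => by rw [hneg, ho i j h, neg_zero]) (fun i j h => by rw [hneg, ho' i j h, neg_zero])
      (g := Sum.inr ∘ Sum.inl) (Sum.inr_injective.comp Sum.inl_injective)
      (fun i => by rw [hneg]; exact neg_pos.2 (hn i))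
      (g' := Sum.map id Sum.inr) (Function.injective_id.sumMap Sum.inr_injective) (by
        rintro (i | i)
        · rw [hneg]; exact neg_nonpos.2 (hp' i).le
        · rw [hneg]; exact neg_nonpos.2 (hz' i).ge)
    simp at this
    omega

/-- **Sylvester's law of inertia** for subspaces. -/
lemma HasType.unique {K : Matrix ι ι ℝ} {N : Submodule ℝ (ι → ℝ)} {a b c a' b' c' : ℕ}
    (h : HasType K N a b c) (h' : HasType K N a' b' c') : a = a' ∧ b = b' ∧ c = c' := by
  have h1 := h.le h'
  have h2 := h'.le h
  obtain ⟨f, hli, hspan, -⟩ := h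
  obtain ⟨f', hli', hspan', -⟩ := h'
  have e := finrank_span_eq_card hli
  have e' := finrank_span_eq_card hli'
  rw [hspan] at e
  rw [hspan', e] at e'
  simp at e'
  omega

lemma HasType.block {β : Type} [Fintype β] [DecidableEq β] {K₀ : Matrix β β ℝ}
    {N : Submodule ℝ (β → ℝ)} {b c : ℕ} (h : HasType K₀ N 0 b c) (l k : ℕ) :
    HasType (blockMetric l k K₀) (blockTrans l k N) k b c := by
  obtain ⟨f, hli, hspan, ho, -, hn, hz⟩ := h
  have hprod : ∀ (v v' : β → ℝ) (w w' : (Fin 2 × Fin l) ⊕ Fin k → ℝ),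
      Sum.elim v w ⬝ᵥ blockMetric l k K₀ *ᵥ Sum.elim v' w' = v ⬝ᵥ K₀ *ᵥ v' + w ⬝ᵥ w' := by
    intro v v' w w'
    rw [blockMetric, fromBlocks_mulVec, Sum.elim_comp_inl, Sum.elim_comp_inr]
    simp [sumElim_dotProduct_sumElim]
  have hfix : ∀ i j, fixedLin l k (Pi.single i 1) ⬝ᵥ fixedLin l k (Pi.single j 1) =
      if i = j then 1 else 0 := by
    intro i j
    simp [fixedLin, Pi.single_apply, eq_comm]
  refine ⟨Sum.elim (fun j => Sum.elim 0 (fixedLin l k (Pi.single j 1)))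
    (fun i => Sum.elim (f (.inr i)) 0), ?_, ?_, ?_, ?_, ?_, ?_⟩
  · rw [Fintype.linearIndependent_iff] at hli ⊢
    intro x hx
    rw [Fintype.sum_sum_type] at hx
    simp only [Sum.elim_inl, Sum.elim_inr] at hx
    rintro (j | i)
    · have := congrFun hx (.inr (.inr j))
      simpa [fixedLin, Pi.single_apply] using this
    · refine hli (Sum.elim 0 (x ∘ Sum.inr)) ?_ (.inr i)
      ext q
      have := congrFun hx (.inl q)
      simpa using this
  · apply le_antisymm
    · rw [Submodule.span_le]
      rintro _ ⟨j | i, rfl⟩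
      · exact mem_blockTrans.2 ⟨0, zero_mem _, _, rfl⟩
      · refine mem_blockTrans.2 ⟨f (.inr i), hspan ▸ Submodule.subset_span ⟨_, rfl⟩, 0, ?_⟩
        simp
    · intro v hv
      obtain ⟨γ, hγ, x, rfl⟩ := mem_blockTrans.1 hv
      rw [← hspan] at hγ
      obtain ⟨y, rfl⟩ := (Submodule.mem_span_range_iff_exists_fun ℝ).1 hγ
      refine (Submodule.mem_span_range_iff_exists_fun ℝ).2 ⟨Sum.elim x (y ∘ Sum.inr), ?_⟩
      rw [Fintype.sum_sum_type]
      ext (q | q | q) <;> simp [fixedLin, Pi.single_apply]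
  · rintro (i | i) (j | j) hij
    · simp only [Sum.elim_inl, hprod, hfix]
      simp [show i ≠ j by rintro rfl; exact hij rfl]
    · simp [hprod]
    · simp [hprod]
    · simp [hprod, ho (.inr i) (.inr j) (by simpa using hij)]
  · intro i
    simp [hprod, hfix]
  · intro i
    simpa [hprod] using hn i
  · intro i
    simpa [hprod] using hz i

variable [DecidableEq ι] [DecidableEq κ]

/-- The relation `G K Gᵀ = K'` transforms the inverse metrics; it becomes the Gram relation `Qᵀ K Q
= K'` because both metrics are their own inverses. -/
lemma IsIsometry.dotProduct {K : Matrix ι ι ℝ} {K' : Matrix κ κ ℝ} (hK : K * K = 1)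
    (hK' : K' * K' = 1) {G : Matrix κ ι ℝ} {Q : Matrix ι κ ℝ} (h : IsIsometry K K' G Q)
    (v w : κ → ℝ) : (Q *ᵥ v) ⬝ᵥ K *ᵥ (Q *ᵥ w) = v ⬝ᵥ K' *ᵥ w := by
  have e : Qᵀ * K * Q = K' := by
    calc Qᵀ * K * Q = Qᵀ * K * Q * (K' * K') := by rw [hK', Matrix.mul_one]
      _ = Qᵀ * K * (Q * G) * K * Gᵀ * K' := by
          nth_rewrite 1 [← h.map]; simp only [Matrix.mul_assoc]
      _ = Qᵀ * (K * K) * Gᵀ * K' := by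
          rw [h.left_inv, Matrix.mul_one]; simp only [Matrix.mul_assoc]
      _ = K' := by
          rw [hK, Matrix.mul_one, ← transpose_mul, h.right_inv, transpose_one, Matrix.one_mul]
  rw [← e, ← vecMul_transpose, ← dotProduct_mulVec, mulVec_mulVec, mulVec_mulVec]

lemma HasType.map {K : Matrix ι ι ℝ} {K' : Matrix κ κ ℝ} (hK : K * K = 1)
    (hK' : K' * K' = 1) {G : Matrix κ ι ℝ} {Q : Matrix ι κ ℝ} (h : IsIsometry K K' G Q)
    {N : Submodule ℝ (κ → ℝ)} {a b c : ℕ} (hN : HasType K' N a b c) :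
    HasType K (N.map Q.mulVecLin) a b c := by
  obtain ⟨f, hli, hspan, ho, hp, hn, hz⟩ := hN
  refine ⟨fun i => Q *ᵥ f i, ?_, ?_, ?_, ?_, ?_, ?_⟩
  · refine hli.map' Q.mulVecLin (LinearMap.ker_eq_bot.2 fun v w hvw => ?_)
    rw [mulVecLin_apply, mulVecLin_apply] at hvw
    rw [← one_mulVec v, ← h.right_inv, ← mulVec_mulVec, hvw, mulVec_mulVec, h.right_inv, one_mulVec]
  · rw [← hspan, Submodule.map_span, ← Set.range_comp]; rfl
  · simpa only [h.dotProduct hK hK'] using ho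
  · simpa only [h.dotProduct hK hK'] using hp
  · simpa only [h.dotProduct hK hK'] using hn
  · simpa only [h.dotProduct hK hK'] using hz

/-- Conjugation acts on pure translations by the linear part `G` alone, so the translation spaces
correspond under an isometry. -/
lemma Conjugate.hasType {K : Matrix ι ι ℝ} {K' : Matrix κ κ ℝ} (hK : K * K = 1)
    (hK' : K' * K' = 1) {𝓜 : Submodule ℝ (Matrix κ κ ℝ)} {N : Submodule ℝ (κ → ℝ)}
    {L : LieSubalgebra ℝ (Matrix (ι ⊕ Unit) (ι ⊕ Unit) ℝ)}
    (hL : Conjugate K (L : Set _) K' (splitSet 𝓜 N)) {a b c : ℕ} (hN : HasType K' N a b c) :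
    HasType K (translationSpace L) a b c := by
  obtain ⟨Φ, G, Q, hG, hS, -, hΦ⟩ := hL.exists_equiv
  have hmem : ∀ v, v ∈ translationSpace L ↔ G *ᵥ v ∈ N := by
    intro v
    have h1 : Φ (affineMatrix 0 v) ∈ splitSet 𝓜 N ↔ G *ᵥ v ∈ N := by
      rw [hΦ, affineMatrix_mem_splitSet, and_iff_right (zero_mem _)]
    rw [← h1, hS]
    exact (Φ.injective.mem_set_image (s := (L : Set _))).symm
  have : translationSpace L = N.map Q.mulVecLin := by
    ext v
    rw [hmem]
    constructor
    · intro hv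
      exact ⟨_, hv, by rw [mulVecLin_apply, mulVec_mulVec, hG.left_inv, one_mulVec]⟩
    · rintro ⟨w, hw, rfl⟩
      rwa [mulVecLin_apply, mulVec_mulVec, hG.right_inv, one_mulVec]
  rw [this]
  exact hN.map hK hK' hG

end TranslationType

/-! ### From models of operator families to conjugate matrix algebras. -/

section Models

variable {ι κ : Type} [Fintype ι] [DecidableEq ι] [Fintype κ] [DecidableEq κ]

lemma toBilin'_symm {K : Matrix ι ι ℝ} (hKT : Kᵀ = K) (v w : ι → ℝ) :
    Matrix.toBilin' K v w = Matrix.toBilin' K w v := by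
  rw [Matrix.toBilin'_apply', Matrix.toBilin'_apply', dotProduct_mulVec, dotProduct_comm,
    ← mulVec_transpose, hKT]

/-- The condition `X K + K Xᵀ = 0` expresses skewness for the inverse metric; multiplying by `K` on
both sides gives skewness for `K`, as `K * K = 1`. -/
lemma IsSplitPair.isSkewFamily {K : Matrix ι ι ℝ} (hK : K * K = 1) (hKT : Kᵀ = K)
    {𝓜 : Submodule ℝ (Matrix ι ι ℝ)} {N : Submodule ℝ (ι → ℝ)} (h : IsSplitPair K 𝓜 N) :
    IsSkewFamily (Matrix.toBilin' K) (𝓜.map (Matrix.toLin' : _ ≃ₗ[ℝ] _).toLinearMap) where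
  symm := toBilin'_symm hKT
  comm := by
    rintro _ ⟨X, hX, rfl⟩ _ ⟨Y, hY, rfl⟩ v
    simp [h.comm X hX Y hY]
  skew := by
    rintro _ ⟨X, hX, rfl⟩ v w
    have h1 : X * K = -(K * Xᵀ) :=
      eq_neg_of_add_eq_zero_left (mem_pseudoOrthogonal.1 (h.skew X hX))
    have h2 : Xᵀ * K = -(K * X) := by
      have : K * (X * K) * K = -(K * (K * Xᵀ) * K) := by rw [h1]; simp
      rw [Matrix.mul_assoc, Matrix.mul_assoc, hK, Matrix.mul_one, ← Matrix.mul_assoc K K, hK,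
        Matrix.one_mul] at this
      rw [this, neg_neg]
    simp only [LinearEquiv.coe_coe, Matrix.toLin'_apply, Matrix.toBilin'_apply']
    rw [← vecMul_transpose, ← dotProduct_mulVec, mulVec_mulVec, mulVec_mulVec, h2, neg_mulVec,
      dotProduct_neg]

/-- A model of a split pair is a conjugation to the split pair of the model. -/
lemma IsModel.conjugate {K : Matrix ι ι ℝ} (hK : K * K = 1) (hKT : Kᵀ = K) {K' : Matrix κ κ ℝ}
    (hK' : K' * K' = 1) (hKT' : K'ᵀ = K') {𝓜 : Submodule ℝ (Matrix ι ι ℝ)}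
    {N : Submodule ℝ (ι → ℝ)} (h : IsSplitPair K 𝓜 N) {𝓜' : Submodule ℝ (Matrix κ κ ℝ)}
    {N' : Submodule ℝ (κ → ℝ)} (h' : IsSplitPair K' 𝓜' N') {c : κ → ι → ℝ}
    (hc : IsModel (Matrix.toBilin' K) (𝓜.map (Matrix.toLin' : _ ≃ₗ[ℝ] _).toLinearMap) ⊤
      K' 𝓜' N' c) :
    Fintype.card κ = Fintype.card ι ∧ Conjugate K (splitSet 𝓜 N) K' (splitSet 𝓜' N') := by
  -- The columns of `Q` are the basis vectors of the model, so the Gram matrix of the basis is `Qᵀ *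
  -- K * Q`.
  set Q : Matrix ι κ ℝ := Matrix.of fun i j => c j i with hQ
  have hQv : ∀ γ, Q *ᵥ γ = ∑ j, γ j • c j := by
    intro γ
    ext i
    simp [hQ, mulVec, dotProduct, mul_comm]
  have hgram : Qᵀ * K * Q = K' := by
    ext i j
    rw [← hc.gram, Matrix.toBilin'_apply', dotProduct_mulVec]
    simp [Matrix.mul_apply, hQ, dotProduct, vecMul]
  have hsurj : ∀ v, ∃ γ, Q *ᵥ γ = v := by
    intro v
    have hv : v ∈ Submodule.span ℝ (Set.range c) := hc.span_eq ▸ trivial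
    obtain ⟨γ, hγ⟩ := (Submodule.mem_span_range_iff_exists_fun ℝ).1 hv
    exact ⟨γ, by rw [hQv, hγ]⟩
  obtain ⟨G, hG⟩ := exists_isIsometry_of_gram hK hKT hK' hKT' hgram hsurj
  refine ⟨?_, ?_⟩
  · have e1 : LinearMap.comp G.mulVecLin Q.mulVecLin = LinearMap.id := by
      rw [← mulVecLin_mul, hG.right_inv, mulVecLin_one]
    have e2 : LinearMap.comp Q.mulVecLin G.mulVecLin = LinearMap.id := by
      rw [← mulVecLin_mul, hG.left_inv, mulVecLin_one]
    have := (LinearEquiv.ofLinearMap Q.mulVecLin G.mulVecLin e2 e1).finrank_eq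
    simpa using this
  · have := hG.conjugate (splitSet 𝓜 N)
    rwa [hG.image_splitSet h h' (fun X hX => ?_) fun γ hγ => ?_] at this
    · obtain ⟨M, hM, e⟩ := hc.act _ ⟨X, hX, rfl⟩
      refine ⟨M, hM, ?_⟩
      ext i j
      have := congrFun (e j) i
      simp only [LinearEquiv.coe_coe, Matrix.toLin'_apply, mulVec, dotProduct, Finset.sum_apply,
        Pi.smul_apply, smul_eq_mul] at this
      simpa [Matrix.mul_apply, hQ, mul_comm] using this
    · refine hc.kernel γ ?_
      rintro _ ⟨X, hX, rfl⟩
      rw [← hQv]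
      simpa using hγ X hX

end Models

/-! ### Minkowski space and bases realizing the block metrics. -/

section Minkowski

variable {p : ℕ}

lemma minkowski_eq_diagonal (p : ℕ) :
    minkowski p = Matrix.diagonal (Sum.elim (fun _ => 1) fun _ => -1) := rfl

lemma minkowski_mul_self (p : ℕ) : minkowski p * minkowski p = 1 := by
  rw [minkowski_eq_diagonal, diagonal_mul_diagonal, ← diagonal_one]
  congr 1
  ext (i | i) <;> simp

lemma minkowski_transpose (p : ℕ) : (minkowski p)ᵀ = minkowski p := by
  rw [minkowski_eq_diagonal, diagonal_transpose]

lemma dotProduct_minkowski (v w : Fin p ⊕ Unit → ℝ) :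
    v ⬝ᵥ minkowski p *ᵥ w = ∑ i, v (.inl i) * w (.inl i) - v (.inr ()) * w (.inr ()) := by
  simp [minkowski_eq_diagonal, dotProduct, mulVec_diagonal]
  ring

lemma isLorentzian_minkowski (p : ℕ) : IsLorentzian (Matrix.toBilin' (minkowski p)) := by
  refine ⟨toBilin'_symm (minkowski_transpose p), Pi.single (.inr ()) 1, ?_, fun v h h0 => ?_⟩
  · rw [Matrix.toBilin'_apply', dotProduct_minkowski]
    simp
  · rw [Matrix.toBilin'_apply', dotProduct_minkowski] at h ⊢
    have hz : v (.inr ()) = 0 := by simpa using h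
    obtain ⟨i, hi⟩ : ∃ i, v (.inl i) ≠ 0 := by
      by_contra! hcon
      exact h0 (by ext (i | i) <;> simp [hcon, hz])
    rw [hz, mul_zero, sub_zero]
    exact Finset.sum_pos' (fun i _ => mul_self_nonneg _) ⟨i, Finset.mem_univ i, mul_self_pos.2 hi⟩

lemma exists_isIsometry_of_family {κ : Type} [Fintype κ] [DecidableEq κ] {K' : Matrix κ κ ℝ}
    (hK' : K' * K' = 1) (hKT' : K'ᵀ = K') (hcard : Fintype.card κ = p + 1)
    (c : κ → Fin p ⊕ Unit → ℝ) (hc : ∀ i j, c i ⬝ᵥ minkowski p *ᵥ c j = K' i j) :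
    ∃ G Q, IsIsometry (minkowski p) K' G Q := by
  set Q : Matrix (Fin p ⊕ Unit) κ ℝ := Matrix.of fun i j => c j i with hQ
  have hgram : Qᵀ * minkowski p * Q = K' := by
    ext i j
    rw [← hc, dotProduct_mulVec]
    simp [Matrix.mul_apply, hQ, dotProduct, vecMul]
  have h1 : K' * Qᵀ * minkowski p * Q = 1 := by
    rw [Matrix.mul_assoc, Matrix.mul_assoc, ← Matrix.mul_assoc Qᵀ, hgram, hK']
  have h2 := (Matrix.mul_eq_one_comm_of_card_eq κ (Fin p ⊕ Unit) ℝ (by simp [hcard])).1 h1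
  obtain ⟨G, hG⟩ := exists_isIsometry_of_gram (minkowski_mul_self p) (minkowski_transpose p) hK'
    hKT' hgram fun v => ⟨(K' * Qᵀ * minkowski p) *ᵥ v, by rw [mulVec_mulVec, h2, one_mulVec]⟩
  exact ⟨G, Q, hG⟩

/-- The spacelike basis vectors. -/
def spaceVec (i : Fin p) : Fin p ⊕ Unit → ℝ := Pi.single (.inl i) 1

/-- The timelike basis vector. -/
def timeVec (p : ℕ) : Fin p ⊕ Unit → ℝ := Pi.single (.inr ()) 1

lemma spaceVec_spaceVec (i j : Fin p) :
    spaceVec i ⬝ᵥ minkowski p *ᵥ spaceVec j = if i = j then 1 else 0 := by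
  rw [dotProduct_minkowski]
  simp [spaceVec, Pi.single_apply, eq_comm]

lemma spaceVec_timeVec (i : Fin p) : spaceVec i ⬝ᵥ minkowski p *ᵥ timeVec p = 0 := by
  rw [dotProduct_minkowski]
  simp [spaceVec, timeVec]

lemma timeVec_spaceVec (i : Fin p) : timeVec p ⬝ᵥ minkowski p *ᵥ spaceVec i = 0 := by
  rw [dotProduct_minkowski]
  simp [spaceVec, timeVec]

lemma timeVec_timeVec : timeVec p ⬝ᵥ minkowski p *ᵥ timeVec p = -1 := by
  rw [dotProduct_minkowski]
  simp [timeVec]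

lemma exists_isIsometry_A {k l : ℕ} (h : 2 * l + k = p) :
    ∃ G Q, IsIsometry (minkowski p) (blockMetric l k metricA) G Q := by
  have e : (Fin 2 × Fin l) ⊕ Fin k ≃ Fin p := Fintype.equivOfCardEq (by simp [h])
  refine exists_isIsometry_of_family (blockMetric_mul_self metricA_mul_self l k)
    (blockMetric_transpose metricA_transpose l k) (by simp; omega)
    (Sum.elim (fun _ => timeVec p) fun q => spaceVec (e q)) ?_
  rintro (i | i) (j | j) <;>
    simp [spaceVec_spaceVec, spaceVec_timeVec, timeVec_spaceVec, timeVec_timeVec, blockMetric,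
      metricA, Matrix.one_apply]

lemma exists_isIsometry_B {k l : ℕ} (h : 1 + 2 * l + k = p) :
    ∃ G Q, IsIsometry (minkowski p) (blockMetric l k metricB) G Q := by
  have e : Unit ⊕ ((Fin 2 × Fin l) ⊕ Fin k) ≃ Fin p := Fintype.equivOfCardEq (by simp; omega)
  -- For a unit spacelike `e` and the timelike `t`, the vectors `e + t` and `(e - t) / 2` are null
  -- with product `1`; they realize the antidiagonal metric.
  refine exists_isIsometry_of_family (blockMetric_mul_self metricB_mul_self l k)
    (blockMetric_transpose metricB_transpose l k) (by simp; omega)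
    (Sum.elim ![spaceVec (e (.inl ())) + timeVec p,
      (1 / 2 : ℝ) • (spaceVec (e (.inl ())) - timeVec p)] fun q => spaceVec (e (.inr q))) ?_
  rintro (i | i) (j | j)
  · fin_cases i <;> fin_cases j <;>
      simp [mulVec_add, mulVec_sub, mulVec_smul, spaceVec_spaceVec, spaceVec_timeVec,
        timeVec_spaceVec, timeVec_timeVec, blockMetric, metricB] <;> norm_num
  · fin_cases i <;>
      simp [spaceVec_spaceVec, timeVec_spaceVec, blockMetric]
  · fin_cases j <;>
      simp [mulVec_add, mulVec_sub, mulVec_smul, spaceVec_spaceVec, spaceVec_timeVec, blockMetric]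
  · simp [spaceVec_spaceVec, blockMetric, Matrix.one_apply]

lemma exists_isIsometry_C {k l μ : ℕ} (h : μ + 1 + 2 * l + k = p) :
    ∃ G Q, IsIsometry (minkowski p) (blockMetric l k (metricC μ)) G Q := by
  have e : Unit ⊕ (Fin μ ⊕ ((Fin 2 × Fin l) ⊕ Fin k)) ≃ Fin p :=
    Fintype.equivOfCardEq (by simp; omega)
  refine exists_isIsometry_of_family (blockMetric_mul_self (metricC_mul_self μ) l k)
    (blockMetric_transpose (metricC_transpose μ) l k) (by simp; omega)
    (Sum.elim (Sum.elim (fun _ => spaceVec (e (.inl ())) + timeVec p)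
      (Sum.elim (fun i => spaceVec (e (.inr (.inl i))))
        fun _ => (1 / 2 : ℝ) • (spaceVec (e (.inl ())) - timeVec p)))
      fun q => spaceVec (e (.inr (.inr q)))) ?_
  rintro ((i | i | i) | i) ((j | j | j) | j) <;>
    simp [mulVec_add, mulVec_sub, mulVec_smul, spaceVec_spaceVec, spaceVec_timeVec,
      timeVec_spaceVec, timeVec_timeVec, blockMetric, metricC, Matrix.one_apply] <;> norm_num

end Minkowski

/-! ### Properties, existence and uniqueness of the normal forms. -/

section NormalForms

variable {p : ℕ}

lemma hasNormalForm_A {k l : ℕ} {L : LieSubalgebra ℝ (Ambient p)} :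
    HasNormalForm p L (.A k l) ↔ Conjugate (minkowski p) (L : Set (Ambient p))
      (blockMetric l k metricA) (splitSet (blockLin l k ⊥) (blockTrans l k ⊤)) := by
  rw [splitSet_block]
  unfold HasNormalForm
  congr!
  constructor
  · rintro ⟨z, a, x, rfl⟩
    exact ⟨0, zero_mem _, _, trivial, a, x, rfl⟩
  · rintro ⟨M, rfl, γ, -, a, x, rfl⟩
    exact ⟨γ (), a, x, rfl⟩

lemma hasNormalForm_B {k l : ℕ} {L : LieSubalgebra ℝ (Ambient p)} :
    HasNormalForm p L (.B k l) ↔ Conjugate (minkowski p) (L : Set (Ambient p))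
      (blockMetric l k metricB)
      (splitSet (blockLin l k (LinearMap.range blockBLin)) (blockTrans l k ⊥)) := by
  rw [splitSet_block]
  unfold HasNormalForm
  congr!
  constructor
  · rintro ⟨c, a, x, rfl⟩
    exact ⟨_, ⟨c, rfl⟩, 0, rfl, a, x, rfl⟩
  · rintro ⟨_, ⟨c, rfl⟩, _, rfl, a, x, rfl⟩
    exact ⟨c, a, x, rfl⟩

lemma hasNormalForm_C {k μ l : ℕ} {L : LieSubalgebra ℝ (Ambient p)} :
    HasNormalForm p L (.C k μ l) ↔ Conjugate (minkowski p) (L : Set (Ambient p))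
      (blockMetric l k (metricC μ))
      (splitSet (blockLin l k (LinearMap.range (blockCLin μ)))
        (blockTrans l k (LinearMap.range (nullCLin μ)))) := by
  rw [splitSet_block]
  unfold HasNormalForm
  congr!
  constructor
  · rintro ⟨z, α, a, x, rfl⟩
    exact ⟨_, ⟨α, rfl⟩, _, ⟨z, rfl⟩, a, x, rfl⟩
  · rintro ⟨_, ⟨α, rfl⟩, _, ⟨z, rfl⟩, a, x, rfl⟩
    exact ⟨z, α, a, x, rfl⟩

lemma hasType_metricA : HasType metricA ⊤ 0 1 0 := by
  refine ⟨fun _ _ => 1, ?_, ?_, ?_, fun i => i.elim0, ?_, fun i => i.elim0⟩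
  · rw [Fintype.linearIndependent_iff]
    rintro x hx (i | i | i)
    · exact i.elim0
    · have := congrFun hx ()
      simpa [Subsingleton.elim i 0] using this
    · exact i.elim0
  · rw [eq_top_iff]
    rintro v -
    refine (Submodule.mem_span_range_iff_exists_fun ℝ).2 ⟨fun _ => v (), ?_⟩
    ext
    simp
  · intro i j hij
    have : Subsingleton (Fin 0 ⊕ (Fin 1 ⊕ Fin 0)) := Fintype.card_le_one_iff_subsingleton.1 (by simp)
    exact absurd (Subsingleton.elim i j) hij
  · intro i
    simp [metricA, neg_mulVec, dotProduct]

lemma hasType_metricB : HasType metricB ⊥ 0 0 0 := by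
  refine ⟨0, linearIndependent_empty_type, ?_, ?_, fun i => i.elim0, fun i => i.elim0,
    fun i => i.elim0⟩
  · simp
  · simp

lemma hasType_metricC (μ : ℕ) :
    HasType (metricC μ) (LinearMap.range (nullCLin μ)) 0 0 1 := by
  refine ⟨fun _ => nullCLin μ 1, ?_, ?_, ?_, fun i => i.elim0, fun i => i.elim0, ?_⟩
  · rw [Fintype.linearIndependent_iff]
    rintro x hx (i | i | i)
    · exact i.elim0
    · exact i.elim0
    · have := congrFun hx (.inl ())
      simpa [nullCLin, Subsingleton.elim i 0] using this
  · apply le_antisymm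
    · rw [Submodule.span_le]
      rintro _ ⟨i, rfl⟩
      exact ⟨1, rfl⟩
    · rintro _ ⟨z, rfl⟩
      refine (Submodule.mem_span_range_iff_exists_fun ℝ).2 ⟨fun _ => z, ?_⟩
      simp [← map_smul]
  · intro i j hij
    have : Subsingleton (Fin 0 ⊕ (Fin 0 ⊕ Fin 1)) := Fintype.card_le_one_iff_subsingleton.1 (by simp)
    exact absurd (Subsingleton.elim i j) hij
  · intro i
    simp [metricC, nullCLin, mulVec, dotProduct]

lemma properties_of_conjugate {β : Type} [Fintype β] [DecidableEq β] {K₀ : Matrix β β ℝ}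
    (hK₀ : K₀ * K₀ = 1) {𝓜 : Submodule ℝ (Matrix β β ℝ)} {N : Submodule ℝ (β → ℝ)}
    (h : IsSplitPair K₀ 𝓜 N) {b c k l : ℕ} (hN : HasType K₀ N 0 b c)
    {L : LieSubalgebra ℝ (Ambient p)}
    (hL : Conjugate (minkowski p) (L : Set (Ambient p)) (blockMetric l k K₀)
      (splitSet (blockLin l k 𝓜) (blockTrans l k N))) :
    IsSplittingMASA p L ∧ (∀ a' b' c', HasTranslationType p L a' b' c' ↔
      a' = k ∧ b' = b ∧ c' = c) ∧
      Module.finrank ℝ L = Module.finrank ℝ 𝓜 + l + (Module.finrank ℝ N + k) := by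
  have hpair := h.block hK₀ l k
  have htype := hL.hasType (minkowski_mul_self p) (blockMetric_mul_self hK₀ l k) (hN.block l k)
  refine ⟨⟨hpair.isMASA_of_conjugate hL, hpair.isSplitting_of_conjugate hL⟩, fun a' b' c' => ?_, ?_⟩
  · rw [hasTranslationType_iff]
    constructor
    · intro h
      exact h.unique htype
    · rintro ⟨rfl, rfl, rfl⟩
      exact htype
  · rw [IsSplitPair.finrank_of_conjugate hL, finrank_blockLin, finrank_blockTrans]

lemma properties_A {k l : ℕ} {L : LieSubalgebra ℝ (Ambient p)} (hL : HasNormalForm p L (.A k l)) :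
    IsSplittingMASA p L ∧ (∀ a b c, HasTranslationType p L a b c ↔ a = k ∧ b = 1 ∧ c = 0) ∧
      Module.finrank ℝ L = 1 + l + k := by
  obtain ⟨h1, h2, h3⟩ := properties_of_conjugate metricA_mul_self (isSplitPair_bot_top _)
    hasType_metricA (hasNormalForm_A.1 hL)
  refine ⟨h1, h2, ?_⟩
  rw [h3, finrank_bot, finrank_top, Module.finrank_fintype_fun_eq_card, Fintype.card_unit]
  omega

lemma properties_B {k l : ℕ} {L : LieSubalgebra ℝ (Ambient p)} (hL : HasNormalForm p L (.B k l)) :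
    IsSplittingMASA p L ∧ (∀ a b c, HasTranslationType p L a b c ↔ a = k ∧ b = 0 ∧ c = 0) ∧
      Module.finrank ℝ L = 1 + l + k := by
  obtain ⟨h1, h2, h3⟩ := properties_of_conjugate metricB_mul_self isSplitPair_metricB
    hasType_metricB (hasNormalForm_B.1 hL)
  refine ⟨h1, h2, ?_⟩
  have hinj : Function.Injective blockBLin := by
    intro c d h
    have := congrFun (congrFun h 0) 0
    simpa [blockBLin, blockB] using this
  rw [h3, finrank_bot, LinearMap.finrank_range_of_inj hinj, Module.finrank_self]
  omega

lemma properties_C {k μ l : ℕ} (hμ : 1 ≤ μ) {L : LieSubalgebra ℝ (Ambient p)}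
    (hL : HasNormalForm p L (.C k μ l)) :
    IsSplittingMASA p L ∧ (∀ a b c, HasTranslationType p L a b c ↔ a = k ∧ b = 0 ∧ c = 1) ∧
      Module.finrank ℝ L = μ + l + k + 1 := by
  obtain ⟨h1, h2, h3⟩ := properties_of_conjugate (metricC_mul_self μ) (isSplitPair_metricC hμ)
    (hasType_metricC μ) (hasNormalForm_C.1 hL)
  refine ⟨h1, h2, ?_⟩
  have hinj : Function.Injective (blockCLin μ) := by
    intro α α' h
    ext i
    have := congrFun (congrFun h (.inl ())) (.inr (.inl i))
    simpa [blockCLin, blockC] using this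
  have hinj' : Function.Injective (nullCLin μ) := fun z z' h => congrFun h (.inl ())
  rw [h3, LinearMap.finrank_range_of_inj hinj, LinearMap.finrank_range_of_inj hinj',
    Module.finrank_fin_fun, Module.finrank_self]
  omega

lemma exists_hasNormalForm {s : NormalForm} (hs : s.Allowed p) : ∃ L, HasNormalForm p L s := by
  cases s with
  | A k l =>
    obtain ⟨G, Q, hG⟩ := exists_isIsometry_A hs.2.2
    obtain ⟨L, hL⟩ := ((isSplitPair_bot_top metricA).block metricA_mul_self l k).exists_conjugate hG
    exact ⟨L, hasNormalForm_A.2 hL⟩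
  | B k l =>
    obtain ⟨G, Q, hG⟩ := exists_isIsometry_B hs.2.2
    obtain ⟨L, hL⟩ := (isSplitPair_metricB.block metricB_mul_self l k).exists_conjugate hG
    exact ⟨L, hasNormalForm_B.2 hL⟩
  | C k μ l =>
    obtain ⟨G, Q, hG⟩ := exists_isIsometry_C hs.2.2.2.2
    obtain ⟨L, hL⟩ :=
      ((isSplitPair_metricC hs.2.1).block (metricC_mul_self μ) l k).exists_conjugate hG
    exact ⟨L, hasNormalForm_C.2 hL⟩

lemma IsSplittingMASA.exists_normalForm {L : LieSubalgebra ℝ (Ambient p)}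
    (hL : IsSplittingMASA p L) : ∃ s : NormalForm, s.Allowed p ∧ HasNormalForm p L s := by
  obtain ⟨L', 𝓜, N, hconj, hL'⟩ := hL.2.exists_splitSet
  have hpair := (isMASA_iff_isSplitPair hL').1 (hconj.isMASA hL.1)
  rw [hL'] at hconj
  have hK := minkowski_mul_self p
  have hKT := minkowski_transpose p
  obtain ⟨l, k, ⟨c, hc⟩ | ⟨c, hc⟩ | ⟨μ, c, hμ, hc⟩⟩ :=
    exists_isModel (isLorentzian_minkowski p) (hpair.isSkewFamily hK hKT)
  · obtain ⟨hcard, h⟩ := hc.conjugate hK hKT (blockMetric_mul_self metricA_mul_self l k)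
      (blockMetric_transpose metricA_transpose l k) hpair
      ((isSplitPair_bot_top metricA).block metricA_mul_self l k)
    refine ⟨.A k l, ?_, hasNormalForm_A.2 (hconj.trans h)⟩
    -- The size of the model equals `p + 1`; the allowed ranges and the parity of `p - k` follow
    -- from this equality.
    simp at hcard
    have : p - k = 2 * l := by omega
    exact ⟨by omega, by simp [this], by omega⟩
  · obtain ⟨hcard, h⟩ := hc.conjugate hK hKT (blockMetric_mul_self metricB_mul_self l k)
      (blockMetric_transpose metricB_transpose l k) hpair
      (isSplitPair_metricB.block metricB_mul_self l k)
    refine ⟨.B k l, ?_, hasNormalForm_B.2 (hconj.trans h)⟩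
    simp at hcard
    have : p - k = 2 * l + 1 := by omega
    exact ⟨by omega, by simp [this], by omega⟩
  · obtain ⟨hcard, h⟩ := hc.conjugate hK hKT (blockMetric_mul_self (metricC_mul_self μ) l k)
      (blockMetric_transpose (metricC_transpose μ) l k) hpair
      ((isSplitPair_metricC hμ).block (metricC_mul_self μ) l k)
    refine ⟨.C k μ l, ?_, hasNormalForm_C.2 (hconj.trans h)⟩
    simp at hcard
    exact ⟨by omega, hμ, by omega, by omega, by omega⟩

/-- The translation type determines the kind and `k`. For kinds A and B the size then gives `l`; for
kind C the size gives `μ + 2 * l` and the dimension gives `μ + l`. -/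
lemma NormalForm.eq_of_hasNormalForm {s s' : NormalForm} (hs : s.Allowed p) (hs' : s'.Allowed p)
    {L : LieSubalgebra ℝ (Ambient p)} (h : HasNormalForm p L s) (h' : HasNormalForm p L s') :
    s = s' := by
  cases s with
  | A k l =>
    have ht := ((properties_A h).2.1 k 1 0).2 ⟨rfl, rfl, rfl⟩
    cases s' with
    | A k' l' =>
      obtain ⟨rfl, -⟩ := ((properties_A h').2.1 _ _ _).1 ht
      have h1 := hs.2.2
      have h2 := hs'.2.2
      obtain rfl : l = l' := by omega
      rfl
    | B k' l' => simpa using ((properties_B h').2.1 _ _ _).1 ht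
    | C k' μ' l' => simpa using ((properties_C hs'.2.1 h').2.1 _ _ _).1 ht
  | B k l =>
    have ht := ((properties_B h).2.1 k 0 0).2 ⟨rfl, rfl, rfl⟩
    cases s' with
    | A k' l' => simpa using ((properties_A h').2.1 _ _ _).1 ht
    | B k' l' =>
      obtain ⟨rfl, -⟩ := ((properties_B h').2.1 _ _ _).1 ht
      have h1 := hs.2.2
      have h2 := hs'.2.2
      obtain rfl : l = l' := by omega
      rfl
    | C k' μ' l' => simpa using ((properties_C hs'.2.1 h').2.1 _ _ _).1 ht
  | C k μ l =>
    obtain ⟨-, h1, h2⟩ := properties_C hs.2.1 h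
    have ht := (h1 k 0 1).2 ⟨rfl, rfl, rfl⟩
    cases s' with
    | A k' l' => simpa using ((properties_A h').2.1 _ _ _).1 ht
    | B k' l' => simpa using ((properties_B h').2.1 _ _ _).1 ht
    | C k' μ' l' =>
      obtain ⟨-, h1', h2'⟩ := properties_C hs'.2.1 h'
      obtain ⟨rfl, -⟩ := (h1' _ _ _).1 ht
      have h3 := hs.2.2.2.2
      have h4 := hs'.2.2.2.2
      obtain rfl : l = l' := by omega
      obtain rfl : μ = μ' := by omega
      rfl

lemma conjugate_of_hasNormalForm {s : NormalForm} {L L' : LieSubalgebra ℝ (Ambient p)}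
    (h : HasNormalForm p L s) (h' : HasNormalForm p L' s) :
    Conjugate (minkowski p) (L : Set (Ambient p)) (minkowski p) (L' : Set (Ambient p)) := by
  cases s with
  | A k l => exact Conjugate.trans h (Conjugate.symm h')
  | B k l => exact Conjugate.trans h (Conjugate.symm h')
  | C k μ l => exact Conjugate.trans h (Conjugate.symm h')

end NormalForms

end PseudoEuclidean

end

open PseudoEuclidean in
theorem theorem4p1 (p : ℕ) :
    -- Kind A
    (∀ k l : ℕ, (NormalForm.A k l).Allowed p →
      (∃ L, HasNormalForm p L (.A k l)) ∧
      ∀ L, HasNormalForm p L (.A k l) →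
        IsSplittingMASA p L ∧
        (∀ a b c, HasTranslationType p L a b c ↔ a = k ∧ b = 1 ∧ c = 0) ∧
        Module.finrank ℝ L = 1 + l + k ∧
        (p + 3) / 2 ≤ Module.finrank ℝ L ∧ Module.finrank ℝ L ≤ p + 1) ∧
    -- Kind B
    (∀ k l : ℕ, (NormalForm.B k l).Allowed p →
      (∃ L, HasNormalForm p L (.B k l)) ∧
      ∀ L, HasNormalForm p L (.B k l) →
        IsSplittingMASA p L ∧
        (∀ a b c, HasTranslationType p L a b c ↔ a = k ∧ b = 0 ∧ c = 0) ∧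
        Module.finrank ℝ L = 1 + l + k ∧
        (p + 2) / 2 ≤ Module.finrank ℝ L ∧ Module.finrank ℝ L ≤ p) ∧
    -- Kind C
    (∀ k μ l : ℕ, (NormalForm.C k μ l).Allowed p →
      (∃ L, HasNormalForm p L (.C k μ l)) ∧
      ∀ L, HasNormalForm p L (.C k μ l) →
        IsSplittingMASA p L ∧
        (∀ a b c, HasTranslationType p L a b c ↔ a = k ∧ b = 0 ∧ c = 1) ∧
        Module.finrank ℝ L = μ + l + k + 1 ∧
        (p + 3) / 2 ≤ Module.finrank ℝ L ∧ Module.finrank ℝ L ≤ p) ∧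
    -- There are no others, and the normal form is unique
    (∀ L, IsSplittingMASA p L → ∃! s : NormalForm, s.Allowed p ∧ HasNormalForm p L s) ∧
    -- Algebras with the same normal form are conjugate under E(p,1)
    (∀ (s : NormalForm) (L L' : LieSubalgebra ℝ (Ambient p)),
      HasNormalForm p L s → HasNormalForm p L' s →
        Conjugate (minkowski p) (L : Set (Ambient p)) (minkowski p) (L' : Set (Ambient p))) ∧
    -- The block of kind B is all of o(1,1)
    (pseudoOrthogonal metricB : Set (Matrix (Fin 2) (Fin 2) ℝ)) = Set.range blockB ∧
    -- The block of kind C is a MANS of o(μ+1,1)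
    (∀ μ : ℕ, 1 ≤ μ → ∃ M : LieSubalgebra ℝ
        (Matrix (Unit ⊕ (Fin μ ⊕ Unit)) (Unit ⊕ (Fin μ ⊕ Unit)) ℝ),
      (M : Set (Matrix (Unit ⊕ (Fin μ ⊕ Unit)) (Unit ⊕ (Fin μ ⊕ Unit)) ℝ)) =
        Set.range (blockC (μ := μ)) ∧
      IsMANS (pseudoOrthogonal (metricC μ)) M) := by
  refine ⟨fun k l hs => ⟨exists_hasNormalForm hs, fun L hL => ?_⟩,
    fun k l hs => ⟨exists_hasNormalForm hs, fun L hL => ?_⟩,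
    fun k μ l hs => ⟨exists_hasNormalForm hs, fun L hL => ?_⟩, fun L hL => ?_,
    fun s L L' h h' => conjugate_of_hasNormalForm h h', ?_, fun μ hμ => ?_⟩
  · obtain ⟨h1, h2, h3⟩ := properties_A hL
    -- With `d` the dimension, `2 * d = p + 2 + k` and `d = p + 1 - l`; rounding up gives the lower
    -- bound.
    have h4 := hs.2.2
    exact ⟨h1, h2, h3, by omega, by omega⟩
  · obtain ⟨h1, h2, h3⟩ := properties_B hL
    -- Here `2 * d = p + 1 + k` and `d = p - l`.
    have h4 := hs.2.2
    exact ⟨h1, h2, h3, by omega, by omega⟩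
  · obtain ⟨h1, h2, h3⟩ := properties_C hs.2.1 hL
    -- Here `2 * d = p + 1 + μ + k` and `d = p - l`; the lower bound uses `μ ≥ 1`.
    have h4 := hs.2.2.2.2
    have h5 := hs.2.1
    exact ⟨h1, h2, h3, by omega, by omega⟩
  · obtain ⟨s, hs, h⟩ := hL.exists_normalForm
    exact ⟨s, ⟨hs, h⟩, fun s' hs' => NormalForm.eq_of_hasNormalForm hs'.1 hs hs'.2 h⟩
  · ext X
    exact mem_pseudoOrthogonal_metricB
  · exact ⟨blockCAlgebra μ, rfl, isMANS_blockCAlgebra hμ⟩
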